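/- Let $n\ge 1$. Let $\mathscr P_0$ be the class of $(1+n)$-dimensional nonlinear Schrödinger equations $$\mathcal L_{\delta,V}:\qquad i\psi_t+\psi_{aa}+\delta\,\psi\ln\rho+V(t,x)\psi=0,\qquad \rho=|\psi|\neq 0,$$ for a complex-valued function $\psi$ of $t\in\mathbb R$ and $x=(x_1,\dots,x_n)\in\mathbb R^n$, where the arbitrary elements are a constant $\delta\in\mathbb C\setminus\{0\}$ and a smooth complex-valued function $V$ of $(t,x)$. Indices $a,b$ run from $1$ to $n$, repeated indices are summed over, and subscripts denote derivatives. Point transformations are local: a point transformation is a diffeomorphism of an open set of points $(t,x,\psi)$ with $\psi\ne0$ onto another such set (its components being smooth functions of $(t,x,\psi,\psi^*)$), and equations are considered over such sets, with $V$ defined on the corresponding set of $(t,x)$. An admissible transformation of $\mathscr P_0$ is a triple $((\delta,V),\varphi,(\tilde\delta,\tilde V))$, where $\varphi$ is a point transformation whose prolongation to second-order jets maps $\mathcal L_{\delta,V}$ to $\mathcal L_{\tilde\delta,\tilde V}$. The equivalence group $G^\sim_{\mathscr P_0}$ consists of the point transformations $\Phi$ of the space with coordinates $(t,x,\psi,\psi^*,\delta,\delta^*,V,V^*)$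 (with $\delta\neq0$ and $V$ unrestricted) whose $(t,x,\psi)$-components depend only on $(t,x,\psi,\psi^*)$, thus defining a point transformation $\varphi$ of the variables, and which map each pair $(\delta,V)$ of arbitrary elements to a pair $(\tilde\delta,\tilde V)$ of arbitrary elements such that $((\delta,V),\varphi,(\tilde\delta,\tilde V))$ is an admissible transformation. Call a domain of $(t,x,\psi)$ a patch if it is open, is contained in $\{\psi\neq0\}$, its projection to the $t$-axis is an interval $I$ and its sections $t=\mathrm{const}$ are connected (every point of an open set in $\{\psi\ne0\}$ has a neighbourhood in this set that is a patch). Then the following holds. 1. The class $\mathscr P_0$ is normalized: for every admissible transformation $((\delta,V),\varphi,(\tilde\delta,\tilde V))$ and every patch in the domain of $\varphi$, there is an equivalence transformation $\Phi\in G^\sim_{\mathscr P_0}$ over this patch whose $(t,x,\psi)$-components coincide with $\varphi$ on the patch and which maps $(\delta,V)$ to $(\tilde\delta,\tilde V)$. 2. Over every patch, the equivalence group $G^\sim_{\mathscr P_0}$ consists precisely of the transformations $$\tilde t=T,\qquad \tilde x_a=|T_t|^{1/2}O^{ab}x_b+\mathcal X^a,$$ $$\tilde\psi=\exp\Big(\frac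 i8\frac{T_{tt}}{|T_t|}x_ax_a+\frac i2\frac{\varepsilon'\mathcal X^b_t}{|T_t|^{1/2}}O^{ba}x_a+i\Sigma+Z\Big)\hat\psi,$$ $$\tilde\delta=\frac{\hat\delta}{|T_t|},\qquad \tilde V=\frac{\hat V}{|T_t|}+\frac{\mathcal X^b_{tt}}{2|T_t|^{3/2}}O^{ba}x_a-\hat\delta\frac{Z}{|T_t|}-\frac14\frac{\mathcal X^a_t\mathcal X^a_t}{T_t^2}+\frac{\Sigma_t-iZ_t}{T_t},$$ where $T$, $\mathcal X^a$, $Z$, $\Sigma$ are arbitrary smooth real-valued functions of $t\in I$ with $T_t\neq0$ and $T_{tt}=0$ (so that the first term in the exponent vanishes), $\varepsilon'=\operatorname{sgn}T_t$, $O=(O^{ab})$ is an arbitrary constant orthogonal $n\times n$ matrix, and $\hat\beta=\beta$ if $T_t>0$, $\hat\beta=\beta^*$ (complex conjugate) if $T_t<0$. -/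

import Mathlib

open scoped ContDiff Topology

noncomputable section

namespace LogNLS

/-- The space of the independent variables `(t, x)`, `x = (x₁, …, xₙ)`. -/
abbrev Base (n : ℕ) : Type := ℝ × (Fin n → ℝ)

/-- The space of the variables `((t, x), ψ)`. A real-smooth function on it is a smooth function
of `(t, x, ψ, ψ*)`. -/
abbrev Vars (n : ℕ) : Type := Base n × ℂ

/-- The joint space of the variables and of the values of the arbitrary elements,
with coordinates `(((t, x), ψ), (δ, V))`. -/
abbrev Ext (n : ℕ) : Type := Vars n × (ℂ × ℂ)

variable {n : ℕ}

/-- The derivative `ψ_t` at the point `p`. -/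
def dt (ψ : Base n → ℂ) (p : Base n) : ℂ := fderiv ℝ ψ p (1, 0)

/-- The derivative `∂ψ/∂x_a` at the point `p`. -/
def dx (a : Fin n) (ψ : Base n → ℂ) (p : Base n) : ℂ := fderiv ℝ ψ p (0, Pi.single a 1)

/-- At the point `p`, the function `ψ` satisfies
`i ψ_t + ψ_aa + δ ψ ln |ψ| + V ψ = 0` (summation over `a`). -/
def SatisfiesAt (δ : ℂ) (V ψ : Base n → ℂ) (p : Base n) : Prop :=
  Complex.I * dt ψ p + ∑ a, dx a (dx a ψ) p
    + δ * ψ p * (Real.log ‖ψ p‖ : ℂ) + V p * ψ p = 0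

/-- The pair `(δ, V)` is a value of the arbitrary elements of the class `𝒫₀` over
the set `D` of values of `(t, x)`. -/
def InClass (D : Set (Base n)) (δ : ℂ) (V : Base n → ℂ) : Prop :=
  δ ≠ 0 ∧ ContDiffOn ℝ ∞ V D

/-- The part `ψ ≠ 0` of the space of variables, on which the equations are smooth. -/
def regular (n : ℕ) : Set (Vars n) := {z | z.2 ≠ 0}

/-- `f` is a smooth map on `U`, injective and with an invertible differential at every point:
a diffeomorphism of the open set `U` onto its image. -/
def IsDiffeoOn {E : Type*} [NormedAddCommGroup E] [NormedSpace ℝ E] (f : E → E) (U : Set E) :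
    Prop :=
  IsOpen U ∧ ContDiffOn ℝ ∞ f U ∧ Set.InjOn f U ∧ ∀ z ∈ U, (fderiv ℝ f z).IsInvertible

/-- A (local) point transformation of the variables `(t, x, ψ, ψ*)` with domain `U`. -/
def IsPointTransformation (φ : Vars n → Vars n) (U : Set (Vars n)) : Prop :=
  IsDiffeoOn φ U ∧ U ⊆ regular n ∧ Set.MapsTo φ U (regular n)

/-- The point transformation `φ` with domain `U` maps the equation with `(δ, V)` to the equation
with `(δ', V')`, as submanifolds of the second-order jet space. Jets are represented by germs of
functions: whenever `φ` maps the germ of the graph of `ψ` at `p` into the graph of `ψ'`,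
the 2-jet of `ψ` at `p` lies in the first equation if and only if the 2-jet of `ψ'` at the
corresponding point, which is the image of the former under the prolongation of `φ`,
lies in the second one. -/
def MapsEquation (φ : Vars n → Vars n) (U : Set (Vars n)) (δ : ℂ) (V : Base n → ℂ)
    (δ' : ℂ) (V' : Base n → ℂ) : Prop :=
  ∀ (p : Base n) (ψ ψ' : Base n → ℂ), (p, ψ p) ∈ U → ContDiffAt ℝ ∞ ψ p →
    ContDiffAt ℝ ∞ ψ' (φ (p, ψ p)).1 →
    (∀ᶠ q in 𝓝 p, ψ' (φ (q, ψ q)).1 = (φ (q, ψ q)).2) →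
    (SatisfiesAt δ V ψ p ↔ SatisfiesAt δ' V' ψ' (φ (p, ψ p)).1)

/-- The triple `((δ, V), φ, (δ', V'))`, where `φ` has domain `U`, is an admissible transformation
of the class `𝒫₀`, i.e., an element of its equivalence groupoid. -/
def IsAdmissible (U : Set (Vars n)) (δ : ℂ) (V : Base n → ℂ) (φ : Vars n → Vars n)
    (δ' : ℂ) (V' : Base n → ℂ) : Prop :=
  IsPointTransformation φ U ∧ InClass (Prod.fst '' U) δ V ∧
    InClass (Prod.fst '' (φ '' U)) δ' V' ∧ MapsEquation φ U δ V δ' V'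

/-- The point transformation `Φ` of the joint space, with `φ` as its action on the variables,
maps the arbitrary elements `(δ, V)` over `U` to `(δ', V')`. -/
def MapsElements (Φ : Ext n → Ext n) (φ : Vars n → Vars n) (U : Set (Vars n))
    (δ : ℂ) (V : Base n → ℂ) (δ' : ℂ) (V' : Base n → ℂ) : Prop :=
  ∀ z ∈ U, Φ (z, (δ, V z.1)) = (φ z, (δ', V' (φ z).1))

/-- `Φ` belongs to the (usual) equivalence group of the class `𝒫₀`, where `U` is the domain of
its action on the variables: `Φ` is a point transformation of the joint space of variables and
arbitrary elements, it is projectable to the space of variables, and its projection `φ` maps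
every equation of the class to the equation of the class whose arbitrary elements are the images
of the original ones under `Φ`. -/
def IsEquivalenceTransformation (U : Set (Vars n)) (Φ : Ext n → Ext n) : Prop :=
  IsDiffeoOn Φ (U ×ˢ ({0}ᶜ ×ˢ Set.univ)) ∧
  ∃ φ : Vars n → Vars n, IsPointTransformation φ U ∧
    (∀ e ∈ U ×ˢ (({0}ᶜ : Set ℂ) ×ˢ (Set.univ : Set ℂ)), (Φ e).1 = φ e.1) ∧
    ∀ (δ : ℂ) (V : Base n → ℂ), InClass (Prod.fst '' U) δ V →
      ∃ (δ' : ℂ) (V' : Base n → ℂ), MapsElements Φ φ U δ V δ' V' ∧ IsAdmissible U δ V φ δ' V'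

/-- The set of values of `t` on `U`. -/
def times (U : Set (Vars n)) : Set ℝ := (fun z : Vars n => z.1.1) '' U

/-- Domains of the local setting: open sets of points `(t, x, ψ)` with `ψ ≠ 0` on which `t` runs
through an interval and all sections `t = const` are connected. All boxes
`I × B × D` with an interval `I` and with connected `B` and `D` are such, and so is the whole
space. -/
structure IsPatch (U : Set (Vars n)) : Prop where
  isOpen : IsOpen U
  subset_regular : U ⊆ regular n
  times_conn : IsPreconnected (times U)
  section_conn : ∀ t : ℝ, IsPreconnected {w : (Fin n → ℝ) × ℂ | ((t, w.1), w.2) ∈ U}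

/-- Normalization of the class `𝒫₀`: its equivalence groupoid is generated by its equivalence
group, i.e., every admissible transformation is, on each patch of its domain, induced
by an equivalence transformation. -/
def IsNormalized (n : ℕ) : Prop :=
  ∀ (U : Set (Vars n)) (δ : ℂ) (V : Base n → ℂ) (φ : Vars n → Vars n) (δ' : ℂ)
    (V' : Base n → ℂ), IsAdmissible U δ V φ δ' V' →
    ∀ W ⊆ U, IsPatch W →
      ∃ Φ : Ext n → Ext n, IsEquivalenceTransformation W Φ ∧ MapsElements Φ φ W δ V δ' V'

/-- `β` if `s > 0` and the complex conjugate of `β` otherwise; used with `s = T_t`. -/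
def hat (s : ℝ) (β : ℂ) : ℂ := if 0 < s then β else starRingEnd ℂ β

/-- The `x`-components `|T_t|^{1/2} O^{ab} x_b + 𝒳^a`. -/
def newX (T : ℝ → ℝ) (X : Fin n → ℝ → ℝ) (O : Matrix (Fin n) (Fin n) ℝ)
    (t : ℝ) (x : Fin n → ℝ) (a : Fin n) : ℝ :=
  |deriv T t| ^ (1 / 2 : ℝ) * ∑ b, O a b * x b + X a t

/-- The `ψ`-component
`exp((i/8) (T_tt/|T_t|) x_a x_a + (i/2) (ε' 𝒳^b_t/|T_t|^{1/2}) O^{ba} x_a + iΣ + Z) ψ̂`. -/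
def newPsi (T : ℝ → ℝ) (X : Fin n → ℝ → ℝ) (O : Matrix (Fin n) (Fin n) ℝ) (S Z : ℝ → ℝ)
    (t : ℝ) (x : Fin n → ℝ) (ψ : ℂ) : ℂ :=
  Complex.exp
    (Complex.I * ((1 / 8 * (deriv (deriv T) t / |deriv T t|) * ∑ a, x a * x a
        + 1 / 2 * ∑ b, ∑ a, Real.sign (deriv T t) * deriv (X b) t / |deriv T t| ^ (1 / 2 : ℝ)
            * O b a * x a
        + S t : ℝ) : ℂ) + (Z t : ℂ))
    * hat (deriv T t) ψ

/-- The `δ`-component `δ̂ / |T_t|`. -/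
def newDelta (T : ℝ → ℝ) (t : ℝ) (δ : ℂ) : ℂ := hat (deriv T t) δ / ((|deriv T t| : ℝ) : ℂ)

/-- The `V`-component
`V̂/|T_t| + 𝒳^b_tt O^{ba} x_a/(2|T_t|^{3/2}) - δ̂ Z/|T_t| - 𝒳^a_t 𝒳^a_t/(4 T_t²)
  + (Σ_t - i Z_t)/T_t`. -/
def newV (T : ℝ → ℝ) (X : Fin n → ℝ → ℝ) (O : Matrix (Fin n) (Fin n) ℝ) (S Z : ℝ → ℝ)
    (t : ℝ) (x : Fin n → ℝ) (δ v : ℂ) : ℂ :=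
  hat (deriv T t) v / ((|deriv T t| : ℝ) : ℂ)
    + ((∑ b, ∑ a, deriv (deriv (X b)) t / (2 * |deriv T t| ^ (3 / 2 : ℝ)) * O b a * x a : ℝ) : ℂ)
    - hat (deriv T t) δ * ((Z t / |deriv T t| : ℝ) : ℂ)
    - ((1 / 4 * ∑ a, deriv (X a) t * deriv (X a) t / deriv T t ^ 2 : ℝ) : ℂ)
    + (((deriv S t : ℝ) : ℂ) - Complex.I * ((deriv Z t : ℝ) : ℂ)) / ((deriv T t : ℝ) : ℂ)

end LogNLS

end

/-! Whether a point transformation φ maps one equation to another can be tested on 2-jets at single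
points. Any slope and second-order form at a point are realised by a quadratic polynomial, and if
its graph is transversal the image is again a graph. The hypothesis thus becomes algebra in the
first and second derivatives of φ at each point (`JetTransfer`). Varying the jet inside the equation
gives the geometry. Trace-free changes of second derivatives force the new time to depend on t alone
(`JetTransfer.time_spatial`). Changing ψ_t against second derivatives makes the x-Jacobian conformal
with factor |T_t|, and makes the map on fibres complex linear or antilinear according to the sign of
T_t (`slopeMap_orthogonal`). Perturbing slopes then shows that the new x does not depend on ψ
(`JetTransfer.base_fiber`). What remains of the transformed equation is a polynomial of degree two
in the ψ_a (`defect`); its coefficients are the determining equations (`Determining`), and they make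
the new ψ locally affine in (ψ, ψ*) along fibres.

The logarithm supplies the rest. A second difference of the free determining equation along a fibre
cancels all terms affine in ψ, including those with V, and leaves only logarithmic terms. Since the
Laplacian of u ln|u| in the plane is 2/ū, comparing both sides at two points of a fibre shows that
the new ψ is homogeneous of degree one and that δ̂ = |T_t| δ' (`MapsEquation.homogeneous`). As δ and
δ' are constants, |T_t| is constant: this is the origin of T_tt = 0. The x-Jacobian then has
orthogonal rows of constant length, so its derivatives are antisymmetric. Symmetry of second
derivatives kills its x-derivatives, and symmetry of the x-Hessian of the new ψ kills its
t-derivative (`MapsEquation.mixed_second`). Hence O is constant and the phase is affine in x. On a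
patch the local statements integrate to functions of t, and a smooth logarithm produces Σ and Z
(`MapsEquation.exists_param`).

Conversely, the determining equations are sufficient, and the explicit form satisfies them for
exactly one pair (δ', V') (`SmoothParam.free_stdForm`, `SmoothParam.elements_eq`). This uniqueness
yields normalization, and, by testing an equivalence transformation on constant V, the formulas for
its δ- and V-components. -/

open scoped ContDiff Topology

noncomputable section

namespace LogNLS

variable {n : ℕ}


/-! ### Calculus of second derivatives. -/

section SecondDerivative

variable {E F G : Type*} [NormedAddCommGroup E] [NormedSpace ℝ E] [NormedAddCommGroup F]
  [NormedSpace ℝ F] [NormedAddCommGroup G] [NormedSpace ℝ G]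

/-- The second derivative of `f` at `p`. -/
abbrev D2 (f : E → F) (p : E) : E →L[ℝ] E →L[ℝ] F := fderiv ℝ (fderiv ℝ f) p

theorem ContDiffAt.hasFDerivAt_fderiv {f : E → F} {p : E} (hf : ContDiffAt ℝ ∞ f p) :
    HasFDerivAt (fderiv ℝ f) (D2 f p) p :=
  ((hf.fderiv_right (m := ∞) (by simp)).differentiableAt (by simp)).hasFDerivAt

theorem fderiv_fderiv_apply {f : E → F} {p : E} (hf : ContDiffAt ℝ ∞ f p) (u v : E) :
    fderiv ℝ (fun q => fderiv ℝ f q v) p u = D2 f p u v := by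
  have h := (ContDiffAt.hasFDerivAt_fderiv hf).clm_apply (hasFDerivAt_const v p)
  rw [h.fderiv]
  simp

theorem D2_symm {f : E → F} {p : E} (hf : ContDiffAt ℝ ∞ f p) (u v : E) :
    D2 f p u v = D2 f p v u :=
  (hf.isSymmSndFDerivAt (by simp; norm_cast)) u v

theorem D2_congr {f g : E → F} {p : E} (h : f =ᶠ[𝓝 p] g) : D2 f p = D2 g p :=
  h.fderiv.fderiv_eq

theorem eventually_differentiableAt {f : E → F} {p : E} (hf : ContDiffAt ℝ ∞ f p) :
    ∀ᶠ q in 𝓝 p, DifferentiableAt ℝ f q := by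
  filter_upwards [(hf.of_le (show (1 : ℕ∞ω) ≤ ∞ by norm_cast)).eventually
    (by simp)] with q hq
  exact hq.differentiableAt (by simp)

theorem D2_comp {f : E → F} {g : F → G} {p : E} (hf : ContDiffAt ℝ ∞ f p)
    (hg : ContDiffAt ℝ ∞ g (f p)) (u v : E) :
    D2 (g ∘ f) p u v = D2 g (f p) (fderiv ℝ f p u) (fderiv ℝ f p v)
      + fderiv ℝ g (f p) (D2 f p u v) := by
  have h1 : fderiv ℝ (g ∘ f) =ᶠ[𝓝 p] fun q => (fderiv ℝ g (f q)).comp (fderiv ℝ f q) := by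
    filter_upwards [eventually_differentiableAt hf,
      hf.continuousAt.eventually (eventually_differentiableAt hg)] with q h1 h2
    exact fderiv_comp q h2 h1
  have h2 : HasFDerivAt (fun q => fderiv ℝ g (f q)) ((D2 g (f p)).comp (fderiv ℝ f p)) p :=
    (ContDiffAt.hasFDerivAt_fderiv hg).comp p (hf.differentiableAt (by simp)).hasFDerivAt
  have h3 := h2.clm_comp (ContDiffAt.hasFDerivAt_fderiv hf)
  rw [D2, h1.fderiv_eq, h3.fderiv]
  simp [add_comm]

theorem D2_clm (l : E →L[ℝ] F) (p : E) : D2 (fun q => l q) p = 0 := by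
  have : fderiv ℝ (fun q => l q) = fun _ => l := by ext1 q; exact l.fderiv
  rw [D2, this]; simp

theorem D2_clm_comp {f : E → F} (l : F →L[ℝ] G) {p : E} (hf : ContDiffAt ℝ ∞ f p) (u v : E) :
    D2 (fun q => l (f q)) p u v = l (D2 f p u v) := by
  have := D2_comp hf (g := fun q => l q) l.contDiff.contDiffAt u v
  simp only [Function.comp_def] at this
  rw [this, D2_clm, l.fderiv]
  simp

theorem D2_prodMk {f : E → F} {g : E → G} {p : E} (hf : ContDiffAt ℝ ∞ f p)
    (hg : ContDiffAt ℝ ∞ g p) (u v : E) :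
    D2 (fun q => (f q, g q)) p u v = (D2 f p u v, D2 g p u v) := by
  have h := hf.prodMk hg
  have h1 := D2_clm_comp (ContinuousLinearMap.fst ℝ F G) h u v
  have h2 := D2_clm_comp (ContinuousLinearMap.snd ℝ F G) h u v
  exact Prod.ext h1.symm h2.symm

end SecondDerivative

/-! ### Prolongation of point transformations to 2-jets of graphs. -/

/-- The unit vector of the `t`-axis. -/
def et : Base n := (1, 0)

/-- The unit vector of the `x_a`-axis. -/
def ex (a : Fin n) : Base n := (0, Pi.single a 1)

theorem dx_dx {ψ : Base n → ℂ} {p : Base n} (h : ContDiffAt ℝ ∞ ψ p) (a : Fin n) :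
    dx a (dx a ψ) p = D2 ψ p (ex a) (ex a) :=
  fderiv_fderiv_apply h _ _

theorem satisfiesAt_iff {δ : ℂ} {V ψ : Base n → ℂ} {p : Base n} (h : ContDiffAt ℝ ∞ ψ p) :
    SatisfiesAt δ V ψ p ↔ Complex.I * fderiv ℝ ψ p et + ∑ a, D2 ψ p (ex a) (ex a)
      + (δ * ψ p * (Real.log ‖ψ p‖ : ℂ) + V p * ψ p) = 0 := by
  unfold SatisfiesAt
  simp only [dx_dx h, dt, et, add_assoc]

section Graph

variable {φ : Vars n → Vars n} {ψ ψ' : Base n → ℂ} {p : Base n}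

theorem contDiffAt_graph (hψ : ContDiffAt ℝ ∞ ψ p) :
    ContDiffAt ℝ ∞ (fun q => (q, ψ q) : Base n → Vars n) p :=
  contDiffAt_id.prodMk hψ

theorem fderiv_graph (hψ : ContDiffAt ℝ ∞ ψ p) (v : Base n) :
    fderiv ℝ (fun q => (q, ψ q) : Base n → Vars n) p v = (v, fderiv ℝ ψ p v) := by
  have h : HasFDerivAt (fun q => (q, ψ q) : Base n → Vars n) _ p :=
    (hasFDerivAt_id p).prodMk (hψ.differentiableAt (by simp)).hasFDerivAt
  rw [h.fderiv]
  simp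

theorem D2_graph (hψ : ContDiffAt ℝ ∞ ψ p) (u v : Base n) :
    D2 (fun q => (q, ψ q) : Base n → Vars n) p u v = (0, D2 ψ p u v) := by
  rw [D2_prodMk (f := fun q => q) contDiffAt_id hψ, show D2 (fun q : Base n => q) p = 0 from
    D2_clm (ContinuousLinearMap.id ℝ (Base n)) p]
  simp

theorem fderiv_comp_graph (hφ : ContDiffAt ℝ ∞ φ (p, ψ p)) (hψ : ContDiffAt ℝ ∞ ψ p)
    (v : Base n) :
    fderiv ℝ (fun q => φ (q, ψ q)) p v = fderiv ℝ φ (p, ψ p) (v, fderiv ℝ ψ p v) := by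
  have := fderiv_comp p (g := φ) (f := fun q => (q, ψ q)) (hφ.differentiableAt (by simp))
    ((contDiffAt_graph hψ).differentiableAt (by simp))
  rw [← fderiv_graph hψ]
  exact DFunLike.congr_fun this v

theorem D2_comp_graph (hφ : ContDiffAt ℝ ∞ φ (p, ψ p)) (hψ : ContDiffAt ℝ ∞ ψ p)
    (v : Base n) :
    D2 (fun q => φ (q, ψ q)) p v v
      = D2 φ (p, ψ p) (v, fderiv ℝ ψ p v) (v, fderiv ℝ ψ p v)
        + fderiv ℝ φ (p, ψ p) (0, D2 ψ p v v) := by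
  have := D2_comp (contDiffAt_graph hψ) hφ v v
  rw [fderiv_graph hψ, D2_graph hψ] at this
  exact this

/-- First prolongation of a point transformation. -/
theorem fderiv_transformed (hφ : ContDiffAt ℝ ∞ φ (p, ψ p)) (hψ : ContDiffAt ℝ ∞ ψ p)
    (hψ' : ContDiffAt ℝ ∞ ψ' (φ (p, ψ p)).1)
    (h : ∀ᶠ q in 𝓝 p, ψ' (φ (q, ψ q)).1 = (φ (q, ψ q)).2) (v : Base n) :
    fderiv ℝ ψ' (φ (p, ψ p)).1 (fderiv ℝ φ (p, ψ p) (v, fderiv ℝ ψ p v)).1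
      = (fderiv ℝ φ (p, ψ p) (v, fderiv ℝ ψ p v)).2 := by
  have hd : DifferentiableAt ℝ (fun q => φ (q, ψ q)) p :=
    (hφ.comp p (contDiffAt_graph hψ)).differentiableAt (by simp)
  have h1 := Filter.EventuallyEq.fderiv_eq (𝕜 := ℝ) h
  have h2 : HasFDerivAt (fun q => ψ' (φ (q, ψ q)).1) _ p :=
    (hψ'.differentiableAt (by simp)).hasFDerivAt.comp p hd.hasFDerivAt.fst
  rw [h2.fderiv, hd.hasFDerivAt.snd.fderiv] at h1
  have h3 := DFunLike.congr_fun h1 v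
  simp only [ContinuousLinearMap.comp_apply, ContinuousLinearMap.coe_fst',
    ContinuousLinearMap.coe_snd'] at h3
  rwa [fderiv_comp_graph hφ hψ] at h3

/-- Second prolongation of a point transformation. -/
theorem D2_transformed (hφ : ContDiffAt ℝ ∞ φ (p, ψ p)) (hψ : ContDiffAt ℝ ∞ ψ p)
    (hψ' : ContDiffAt ℝ ∞ ψ' (φ (p, ψ p)).1)
    (h : ∀ᶠ q in 𝓝 p, ψ' (φ (q, ψ q)).1 = (φ (q, ψ q)).2) (v : Base n) :
    D2 ψ' (φ (p, ψ p)).1 (fderiv ℝ φ (p, ψ p) (v, fderiv ℝ ψ p v)).1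
        (fderiv ℝ φ (p, ψ p) (v, fderiv ℝ ψ p v)).1
      + fderiv ℝ ψ' (φ (p, ψ p)).1
        (D2 φ (p, ψ p) (v, fderiv ℝ ψ p v) (v, fderiv ℝ ψ p v)
          + fderiv ℝ φ (p, ψ p) (0, D2 ψ p v v)).1
      = (D2 φ (p, ψ p) (v, fderiv ℝ ψ p v) (v, fderiv ℝ ψ p v)
          + fderiv ℝ φ (p, ψ p) (0, D2 ψ p v v)).2 := by
  have hc : ContDiffAt ℝ ∞ (fun q => φ (q, ψ q)) p := hφ.comp p (contDiffAt_graph hψ)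
  have hd := (hc.differentiableAt (by simp)).hasFDerivAt
  have h1 : D2 (fun q => ψ' (φ (q, ψ q)).1) p = D2 (fun q => (φ (q, ψ q)).2) p :=
    D2_congr h
  have h2 := D2_clm_comp (ContinuousLinearMap.snd ℝ (Base n) ℂ) hc v v
  have h3 := D2_clm_comp (ContinuousLinearMap.fst ℝ (Base n) ℂ) hc v v
  have h4 := D2_comp (f := fun q => (φ (q, ψ q)).1) (g := ψ') hc.fst hψ' v v
  have h5 := hd.fst.fderiv
  simp only [ContinuousLinearMap.coe_fst', ContinuousLinearMap.coe_snd', Function.comp_def]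
    at h2 h3 h4
  rw [h1, h2, h3, h5, D2_comp_graph hφ hψ, ContinuousLinearMap.comp_apply,
    fderiv_comp_graph hφ hψ] at h4
  exact h4.symm

/-- A point transformation maps the graph of a function to the graph of a function
near each point where the graph is transversal. -/
theorem exists_transformed (hφ : ContDiffAt ℝ ∞ φ (p, ψ p)) (hψ : ContDiffAt ℝ ∞ ψ p)
    (hA : Function.Bijective fun v => (fderiv ℝ φ (p, ψ p) (v, fderiv ℝ ψ p v)).1) :
    ∃ ψ' : Base n → ℂ, ContDiffAt ℝ ∞ ψ' (φ (p, ψ p)).1 ∧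
      ∀ᶠ q in 𝓝 p, ψ' (φ (q, ψ q)).1 = (φ (q, ψ q)).2 := by
  have hc : ContDiffAt ℝ ∞ (fun q => φ (q, ψ q)) p := hφ.comp p (contDiffAt_graph hψ)
  have hd := (hc.differentiableAt (by simp)).hasFDerivAt.fst
  set A : Base n →L[ℝ] Base n :=
    (ContinuousLinearMap.fst ℝ (Base n) ℂ).comp (fderiv ℝ (fun q => φ (q, ψ q)) p) with hAdef
  have hAb : Function.Bijective A := by
    convert hA using 2 with v
    simp [hAdef, fderiv_comp_graph hφ hψ]
  have hker : A.ker = ⊥ := LinearMap.ker_eq_bot.2 hAb.1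
  have hran : A.range = ⊤ := LinearMap.range_eq_top.2 hAb.2
  set e := ContinuousLinearEquiv.ofBijective A hker hran with he
  have hd' : HasFDerivAt (fun q => (φ (q, ψ q)).1) (e : Base n →L[ℝ] Base n) p := by
    rw [he, ContinuousLinearEquiv.coe_ofBijective]; exact hd
  have hne : (∞ : ℕ∞ω) ≠ 0 := by simp
  -- Inverse function theorem for the new independent variables along the graph; `ψ'` is the new
  -- dependent variable composed with the local inverse.
  have hs := hc.fst.hasStrictFDerivAt' hd' hne
  have hβ := hc.fst.to_localInverse hd' hne
  have hβp := hc.fst.localInverse_apply_image hd' hne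
  set β := hc.fst.localInverse hd' hne with hβdef
  refine ⟨fun y => (φ (β y, ψ (β y))).2, ?_, ?_⟩
  · have h1 : ContDiffAt ℝ ∞ (fun q => (φ (q, ψ q)).2) (β (φ (p, ψ p)).1) := by
      rw [hβp]; exact hc.snd
    exact h1.comp _ hβ
  · filter_upwards [hs.eventually_left_inverse] with q hq
    have : β (φ (q, ψ q)).1 = q := hq
    rw [this]

end Graph

/-- The quadratic polynomial with the given 2-jet at `p`. -/
def quad (p : Base n) (w : ℂ) (k : Base n →L[ℝ] ℂ) (H : Base n →L[ℝ] Base n →L[ℝ] ℂ)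
    (q : Base n) : ℂ :=
  w + k (q - p) + (1 / 2 : ℝ) • H (q - p) (q - p)

theorem contDiff_quad (p : Base n) (w : ℂ) (k : Base n →L[ℝ] ℂ)
    (H : Base n →L[ℝ] Base n →L[ℝ] ℂ) : ContDiff ℝ ∞ (quad p w k H) := by
  unfold quad; fun_prop

theorem fderiv_quad (p : Base n) (w : ℂ) (k : Base n →L[ℝ] ℂ)
    (H : Base n →L[ℝ] Base n →L[ℝ] ℂ) (q : Base n) :
    fderiv ℝ (quad p w k H) q = k + (1 / 2 : ℝ) • (H (q - p) + H.flip (q - p)) := by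
  have h0 : HasFDerivAt (fun q : Base n => q - p) (ContinuousLinearMap.id ℝ _) q :=
    (hasFDerivAt_id q).sub_const p
  have h1 := ((k.hasFDerivAt.comp q h0).const_add w).add
    (((H.hasFDerivAt.comp q h0).clm_apply h0).const_smul (1 / 2 : ℝ))
  rw [show quad p w k H = (fun q => w + k (q - p)) + (1 / 2 : ℝ) • fun q => H (q - p) (q - p)
    from rfl]
  refine h1.fderiv.trans ?_
  ext v <;> simp

/-- `H` need not be symmetric. Its diagonal values survive symmetrization, and only these enter the
equation and the prolongation formulas. -/
theorem D2_quad (p : Base n) (w : ℂ) (k : Base n →L[ℝ] ℂ)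
    (H : Base n →L[ℝ] Base n →L[ℝ] ℂ) (v : Base n) :
    D2 (quad p w k H) p v v = H v v := by
  have h0 : HasFDerivAt (fun q : Base n => q - p) (ContinuousLinearMap.id ℝ _) p :=
    (hasFDerivAt_id p).sub_const p
  set B : Base n →L[ℝ] Base n →L[ℝ] ℂ := (1 / 2 : ℝ) • (H + H.flip) with hB
  have h1 : HasFDerivAt (fun q => k + B (q - p)) (B.comp (ContinuousLinearMap.id ℝ _)) p :=
    (HasFDerivAt.comp (g := fun y => B y) (f := fun q => q - p) p B.hasFDerivAt h0).const_add k
  have : fderiv ℝ (quad p w k H) = fun q => k + B (q - p) := by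
    ext1 q; rw [fderiv_quad]; rfl
  rw [D2, this, h1.fderiv, hB]
  simp
  ring


/-! ### Pointwise conditions on jets; the new time depends on time only. -/

section

/-- The jets `(k, H)` and `(k', H')` correspond to each other under the prolongation of a point
transformation with first derivative `L` and second derivative `Q`. -/
structure Prolongs (L : Vars n →L[ℝ] Vars n) (Q : Vars n →L[ℝ] Vars n →L[ℝ] Vars n)
    (k : Base n →L[ℝ] ℂ) (H : Base n →L[ℝ] Base n →L[ℝ] ℂ)
    (k' : Base n →L[ℝ] ℂ) (H' : Base n →L[ℝ] Base n →L[ℝ] ℂ) : Prop where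
  first : ∀ v, k' (L (v, k v)).1 = (L (v, k v)).2
  second : ∀ v, H' (L (v, k v)).1 (L (v, k v)).1
      + k' (Q (v, k v) (v, k v) + L (0, H v v)).1 = (Q (v, k v) (v, k v) + L (0, H v v)).2

/-- Pointwise form of the condition that an equation is mapped to an equation. -/
def JetTransfer (L : Vars n →L[ℝ] Vars n) (Q : Vars n →L[ℝ] Vars n →L[ℝ] Vars n)
    (f f' : ℂ) : Prop :=
  ∀ (k : Base n →L[ℝ] ℂ) (H : Base n →L[ℝ] Base n →L[ℝ] ℂ),
    Function.Bijective (fun v => (L (v, k v)).1) →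
    ∃ (k' : Base n →L[ℝ] ℂ) (H' : Base n →L[ℝ] Base n →L[ℝ] ℂ), Prolongs L Q k H k' H' ∧
      (Complex.I * k et + ∑ a, H (ex a) (ex a) + f = 0 ↔
        Complex.I * k' et + ∑ a, H' (ex a) (ex a) + f' = 0)

/-- The hypothesis on germs is tested on quadratic polynomials, which realise any prescribed `k` and
`H`; bijectivity of the slope map provides the image germ. -/
theorem MapsEquation.jetTransfer {φ : Vars n → Vars n} {U : Set (Vars n)} {δ δ' : ℂ}
    {V V' : Base n → ℂ} (h : MapsEquation φ U δ V δ' V') {z : Vars n} (hz : z ∈ U)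
    (hφ : ContDiffAt ℝ ∞ φ z) :
    JetTransfer (fderiv ℝ φ z) (D2 φ z) (δ * z.2 * (Real.log ‖z.2‖ : ℂ) + V z.1 * z.2)
      (δ' * (φ z).2 * (Real.log ‖(φ z).2‖ : ℂ) + V' (φ z).1 * (φ z).2) := by
  obtain ⟨p, w⟩ := z
  intro k H hA
  have hψ : ContDiffAt ℝ ∞ (quad p w k H) p := (contDiff_quad p w k H).contDiffAt
  have hw : quad p w k H p = w := by simp [quad]
  have hk : fderiv ℝ (quad p w k H) p = k := by
    refine ContinuousLinearMap.ext fun v => ?_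
    simp [fderiv_quad]
  have hφ' : ContDiffAt ℝ ∞ φ (p, quad p w k H p) := by rwa [hw]
  obtain ⟨ψ', h1, h2⟩ := exists_transformed hφ' hψ (by rw [hk, hw]; exact hA)
  have h3 := fderiv_transformed hφ' hψ h1 h2
  have h4 := D2_transformed hφ' hψ h1 h2
  have h5 := h p (quad p w k H) ψ' (by rwa [hw]) hψ h1 h2
  rw [satisfiesAt_iff hψ, satisfiesAt_iff h1, h2.self_of_nhds] at h5
  simp only [D2_quad, hk, hw] at h3 h4 h5
  exact ⟨fderiv ℝ ψ' (φ (p, w)).1, D2 ψ' (φ (p, w)).1, ⟨h3, h4⟩, h5⟩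

/-- The coordinate `t`. -/
def tC : Base n →L[ℝ] ℝ := ContinuousLinearMap.fst ℝ ℝ (Fin n → ℝ)

/-- The coordinate `x_b`. -/
def xC (b : Fin n) : Base n →L[ℝ] ℝ :=
  (ContinuousLinearMap.proj b).comp (ContinuousLinearMap.snd ℝ ℝ (Fin n → ℝ))

@[simp] theorem tC_apply (v : Base n) : tC v = v.1 := rfl
@[simp] theorem xC_apply (b : Fin n) (v : Base n) : xC b v = v.2 b := rfl

theorem base_eq_sum (v : Base n) : v = v.1 • et + ∑ a, v.2 a • ex a := by
  refine Prod.ext ?_ ?_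
  · simp [et, ex, Prod.fst_sum]
  · ext b
    simp [et, ex, Prod.snd_sum, Pi.single_apply]

theorem spatial_eq_sum {v : Base n} (hv : v.1 = 0) : v = ∑ a, v.2 a • ex a := by
  conv_lhs => rw [base_eq_sum v, hv]
  simp

/-- The total derivative of the independent variables along a graph with slope `k`. -/
def slopeMap (L : Vars n →L[ℝ] Vars n) (k : Base n →L[ℝ] ℂ) : Base n →L[ℝ] Base n :=
  (ContinuousLinearMap.fst ℝ (Base n) ℂ).comp (L.comp ((ContinuousLinearMap.id ℝ _).prod k))

@[simp] theorem slopeMap_apply (L : Vars n →L[ℝ] Vars n) (k : Base n →L[ℝ] ℂ) (v : Base n) :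
    slopeMap L k v = (L (v, k v)).1 := rfl

/-- A transversal graph exists through every point. The kernel and the cokernel of the base part of
`L` have equal dimension, and surjectivity of `L` lets the fibre directions fill the cokernel; the
slope is chosen to send the kernel isomorphically onto it. -/
theorem exists_slope_bijective {L : Vars n →L[ℝ] Vars n} (hL : Function.Surjective L) :
    ∃ k : Base n →L[ℝ] ℂ, Function.Bijective (slopeMap L k) := by
  set P1 : Base n →ₗ[ℝ] Base n := (slopeMap L 0 : Base n →ₗ[ℝ] Base n) with hP1
  set P2 : ℂ →ₗ[ℝ] Base n := LinearMap.fst ℝ (Base n) ℂ ∘ₗ (L : Vars n →ₗ[ℝ] Vars n) ∘ₗ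
    LinearMap.inr ℝ (Base n) ℂ with hP2
  have hsum : ∀ v w, (L (v, w)).1 = P1 v + P2 w := by
    intro v w
    rw [show ((v, w) : Vars n) = (v, 0) + (0, w) by simp, map_add]
    simp [hP1, hP2]
  set q := P1.range.mkQ
  have hq : Function.Surjective (q ∘ₗ P2) := by
    intro y
    obtain ⟨y, rfl⟩ := Submodule.mkQ_surjective _ y
    obtain ⟨⟨v, w⟩, h⟩ := hL (y, 0)
    refine ⟨w, ?_⟩
    have h1 := hsum v w
    rw [h] at h1
    simp only at h1
    rw [h1, map_add]
    simp [q, Submodule.Quotient.mk_eq_zero]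
  obtain ⟨s, hs⟩ := LinearMap.exists_rightInverse_of_surjective _ (LinearMap.range_eq_top.2 hq)
  have hdim : Module.finrank ℝ P1.ker = Module.finrank ℝ (Base n ⧸ P1.range) := by
    have h1 := P1.finrank_range_add_finrank_ker
    have h2 := P1.range.finrank_quotient_add_finrank
    omega
  let e := LinearEquiv.ofFinrankEq P1.ker (Base n ⧸ P1.range) hdim
  obtain ⟨π, hπ⟩ := LinearMap.exists_leftInverse_of_injective P1.ker.subtype (by simp)
  let k0 : Base n →ₗ[ℝ] ℂ := s ∘ₗ e.toLinearMap ∘ₗ π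
  refine ⟨k0.toContinuousLinearMap, ?_⟩
  have hinj : Function.Injective (slopeMap L k0.toContinuousLinearMap) := by
    rw [injective_iff_map_eq_zero]
    intro v hv
    have hv1 : P1 v + P2 (k0 v) = 0 := by rw [← hsum]; exact hv
    have h1 : q (P2 (k0 v)) = e (π v) := by
      have := DFunLike.congr_fun hs (e (π v))
      simpa [k0] using this
    have h2 : q (P1 v) = 0 := by simp [q]
    have h3 : e (π v) = 0 := by
      rw [← h1]
      have := congrArg q hv1
      rwa [map_add, h2, zero_add, map_zero] at this
    have h4 : π v = 0 := by simpa using h3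
    have h5 : k0 v = 0 := by simp [k0, h4]
    have h6 : P1 v = 0 := by simpa [h5] using hv1
    have h7 := DFunLike.congr_fun hπ ⟨v, h6⟩
    simp only [LinearMap.comp_apply, Submodule.subtype_apply, h4, LinearMap.id_apply] at h7
    exact (congrArg Subtype.val h7).symm
  exact ⟨hinj, LinearMap.injective_iff_surjective.1 hinj⟩

/-- Transversality is an open condition on the slope. Both signs of the perturbation are provided so
that a parallelogram identity can be used later. -/
theorem exists_slope_perturbation {L : Vars n →L[ℝ] Vars n} {k : Base n →L[ℝ] ℂ}
    (hk : Function.Bijective (slopeMap L k)) (l : Base n →L[ℝ] ℂ) :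
    ∃ ε : ℝ, ε ≠ 0 ∧ Function.Bijective (slopeMap L (k + ε • l)) ∧
      Function.Bijective (slopeMap L (k - ε • l)) := by
  have hcont : Continuous fun ε : ℝ => slopeMap L (k + ε • l) := by
    unfold slopeMap
    have : Continuous fun ε : ℝ => (ContinuousLinearMap.id ℝ (Base n)).prod (k + ε • l) := by
      have h : ∀ ε : ℝ, (ContinuousLinearMap.id ℝ (Base n)).prod (k + ε • l) =
          (ContinuousLinearMap.id ℝ (Base n)).prod k
            + ε • (ContinuousLinearMap.inr ℝ (Base n) ℂ).comp l := by
        intro ε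
        refine ContinuousLinearMap.ext fun v => ?_
        simp
      simp only [h]
      fun_prop
    exact continuous_const.clm_comp (continuous_const.clm_comp this)
  have hopen : IsOpen {ε : ℝ | Function.Bijective (slopeMap L (k + ε • l))} := by
    have := Units.isOpen (R := Base n →L[ℝ] Base n) |>.preimage hcont
    simpa only [Set.preimage_ofPred_eq, ContinuousLinearMap.isUnit_iff_bijective] using this
  have h0 : {ε : ℝ | Function.Bijective (slopeMap L (k + ε • l))} ∈ 𝓝 (0 : ℝ) :=
    hopen.mem_nhds (by
      have : k + (0 : ℝ) • l = k := ContinuousLinearMap.ext fun v => by simp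
      rwa [Set.mem_ofPred_eq, this])
  obtain ⟨r, hr, hsub⟩ := Metric.mem_nhds_iff.1 h0
  refine ⟨r / 2, by positivity, hsub ?_, ?_⟩
  · simp [abs_of_pos hr, hr]
  · have : -(r / 2) ∈ {ε : ℝ | Function.Bijective (slopeMap L (k + ε • l))} :=
      hsub (by simp [abs_of_pos hr, hr])
    have h1 : k + (-(r / 2)) • l = k - (r / 2) • l := ContinuousLinearMap.ext fun v => by
      simp [sub_eq_add_neg]
    rwa [Set.mem_ofPred_eq, h1] at this

/-- The action of the prolongation on the variations of the dependent variable. -/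
def fiberMap (L : Vars n →L[ℝ] Vars n) (k' : Base n →L[ℝ] ℂ) : ℂ →L[ℝ] ℂ :=
  (ContinuousLinearMap.snd ℝ (Base n) ℂ - k'.comp (ContinuousLinearMap.fst ℝ (Base n) ℂ)).comp
    (L.comp (ContinuousLinearMap.inr ℝ (Base n) ℂ))

@[simp] theorem fiberMap_apply (L : Vars n →L[ℝ] Vars n) (k' : Base n →L[ℝ] ℂ) (w : ℂ) :
    fiberMap L k' w = (L (0, w)).2 - k' (L (0, w)).1 := rfl

/-- If `w` is annihilated, then the vertical vector `(0, w)` has the same image under `L` as some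
vector tangent to the graph, hence equals it and has zero base part. -/
theorem fiberMap_injective {L : Vars n →L[ℝ] Vars n} {k k' : Base n →L[ℝ] ℂ}
    (hL : Function.Injective L) (hk : Function.Bijective (slopeMap L k))
    (hk' : ∀ v, k' (L (v, k v)).1 = (L (v, k v)).2) : Function.Injective (fiberMap L k') := by
  rw [injective_iff_map_eq_zero]
  intro w hw
  obtain ⟨v, hv⟩ := hk.2 (L (0, w)).1
  have h1 : L (v, k v) = L (0, w) := by
    refine Prod.ext hv ?_
    rw [← hk', ← slopeMap_apply, hv]
    simp only [fiberMap_apply, sub_eq_zero] at hw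
    exact hw.symm
  have h2 := hL h1
  simp only [Prod.mk.injEq] at h2
  rw [← h2.2, h2.1, map_zero]

theorem exists_inverse_of_injective {M : ℂ →L[ℝ] ℂ} (hM : Function.Injective M) :
    ∃ N : ℂ →L[ℝ] ℂ, ∀ w, M (N w) = w := by
  let e := LinearEquiv.ofInjectiveEndo (M : ℂ →ₗ[ℝ] ℂ) hM
  refine ⟨(e.symm : ℂ →ₗ[ℝ] ℂ).toContinuousLinearMap, fun w => ?_⟩
  exact e.apply_symm_apply w

/-- The complex-valued bilinear form `(u, v) ↦ h(u, v) c`. -/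
def bilin (h : Base n →L[ℝ] Base n →L[ℝ] ℝ) (c : ℂ) : Base n →L[ℝ] Base n →L[ℝ] ℂ :=
  (ContinuousLinearMap.compL ℝ (Base n) ℝ ℂ (ContinuousLinearMap.toSpanSingleton ℝ c)).comp h

@[simp] theorem bilin_apply (h : Base n →L[ℝ] Base n →L[ℝ] ℝ) (c : ℂ) (u v : Base n) :
    bilin h c u v = (h u v : ℂ) * c := by
  simp [bilin]

theorem exists_bilin_trace (hn : 1 ≤ n) (c : ℂ) :
    ∃ H : Base n →L[ℝ] Base n →L[ℝ] ℂ, ∑ a, H (ex a) (ex a) = c := by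
  refine ⟨bilin ((xC ⟨0, hn⟩).smulRight (xC ⟨0, hn⟩)) c, ?_⟩
  rw [Finset.sum_eq_single ⟨0, hn⟩]
  · simp [ex]
  · intro b _ hb
    simp [ex, hb.symm]
  · simp

/-- The bilinear form `(u, v) ↦ N(h(A u, A v) c)`. -/
def pullbackForm (N : ℂ →L[ℝ] ℂ) (A : Base n →L[ℝ] Base n) (h : Base n →L[ℝ] Base n →L[ℝ] ℝ)
    (c : ℂ) : Base n →L[ℝ] Base n →L[ℝ] ℂ :=
  (ContinuousLinearMap.compL ℝ (Base n) ℂ ℂ N).comp (bilin (h.bilinearComp A A) c)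

@[simp] theorem pullbackForm_apply (N : ℂ →L[ℝ] ℂ) (A : Base n →L[ℝ] Base n)
    (h : Base n →L[ℝ] Base n →L[ℝ] ℝ) (c : ℂ) (u v : Base n) :
    pullbackForm N A h c u v = N ((h (A u) (A v) : ℂ) * c) := by
  simp [pullbackForm]

variable {L : Vars n →L[ℝ] Vars n} {Q : Vars n →L[ℝ] Vars n →L[ℝ] Vars n} {f f' : ℂ}

/-- Adding to `H` the form pulled back through the inverse fibre map changes the transformed second
derivative by exactly `h`. When `h` has zero spatial trace the new jet stays on the target equation,
so the old one must stay on the source equation, which says that the pulled-back trace vanishes. -/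
theorem JetTransfer.trace_pullback (hJ : JetTransfer L Q f f') (hn : 1 ≤ n)
    (hL : Function.Injective L) {k : Base n →L[ℝ] ℂ} (hk : Function.Bijective (slopeMap L k))
    (h : Base n →L[ℝ] Base n →L[ℝ] ℝ) (hh : ∑ a, h (ex a) (ex a) = 0) :
    ∑ a, h (slopeMap L k (ex a)) (slopeMap L k (ex a)) = 0 := by
  -- The trace is chosen so that the jet `(k, H0)` lies on the original equation.
  obtain ⟨H0, hH0⟩ := exists_bilin_trace hn (-(Complex.I * k et) - f)
  obtain ⟨k0, H0', P0, iff0⟩ := hJ k H0 hk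
  have hM := fiberMap_injective hL hk P0.first
  obtain ⟨N, hN⟩ := exists_inverse_of_injective hM
  set A := slopeMap L k with hA
  obtain ⟨k1, H1', P1, iff1⟩ := hJ k (H0 + pullbackForm N A h 1) hk
  have hk1 : k1 = k0 := by
    refine ContinuousLinearMap.ext fun u => ?_
    obtain ⟨v, rfl⟩ := hk.2 u
    exact (P1.first v).trans (P0.first v).symm
  subst hk1
  have hH1 : ∀ u, H1' u u = H0' u u + (h u u : ℂ) := by
    intro u
    obtain ⟨v, rfl⟩ := hk.2 u
    have e1 := P1.second v
    have e0 := P0.second v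
    have e2 := hN ((h (A v) (A v) : ℂ) * 1)
    have e3 : L (0, (H0 + pullbackForm N A h 1) v v)
        = L (0, H0 v v) + L (0, N ((h (A v) (A v) : ℂ) * 1)) := by
      rw [← map_add]; simp
    rw [e3] at e1
    simp only [Prod.fst_add, Prod.snd_add, map_add, fiberMap_apply] at e0 e1 e2
    change H1' (L (v, k v)).1 (L (v, k v)).1 = H0' (L (v, k v)).1 (L (v, k v)).1 + _
    linear_combination e1 - e0 + e2
  have hE0 := iff0.1 (by rw [hH0]; ring)
  have hsum : (∑ a, (h (ex a) (ex a) : ℂ)) = 0 := by exact_mod_cast hh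
  have hE1 := iff1.2 (by
    simp only [hH1, Finset.sum_add_distrib, hsum]
    linear_combination hE0)
  simp only [add_apply, Finset.sum_add_distrib, hH0] at hE1
  have hE2 : ∑ a, pullbackForm N A h 1 (ex a) (ex a) = 0 := by linear_combination hE1
  simp only [pullbackForm_apply, ← map_sum, mul_one] at hE2
  have hE3 := congrArg (fiberMap L k1) hE2
  rw [hN, map_zero] at hE3
  exact_mod_cast hE3

theorem slopeMap_perturb (l k : Base n →L[ℝ] ℂ) (ε : ℝ) (v : Base n) :
    slopeMap L (k + ε • l) v = slopeMap L k v + ε • (L (0, l v)).1 := by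
  have : ((v, (k + ε • l) v) : Vars n) = (v, k v) + ε • (0, l v) := by simp
  rw [slopeMap_apply, this, map_add, map_smul]
  simp

/-- The transformed time depends on time only. -/
theorem JetTransfer.time_spatial (hJ : JetTransfer L Q f f') (hn : 1 ≤ n)
    (hL : Function.Bijective L) (v : Fin n → ℝ) (w : ℂ) : (L ((0, v), w)).1.1 = 0 := by
  have key : ∀ k, Function.Bijective (slopeMap L k) → ∀ a, (slopeMap L k (ex a)).1 = 0 := by
    intro k hk a
    -- The form `dt ⊗ dt` has zero spatial trace, and its pullback has as trace a sum of squares of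
    -- time components, so each of them vanishes.
    have h1 := hJ.trace_pullback hn hL.1 hk (tC.smulRight tC) (by simp [ex])
    simp only [ContinuousLinearMap.smulRight_apply, smul_apply, tC_apply,
      smul_eq_mul] at h1
    have h2 := (Finset.sum_eq_zero_iff_of_nonneg (fun i _ => mul_self_nonneg _)).1 h1 a
      (Finset.mem_univ a)
    exact mul_self_eq_zero.1 h2
  obtain ⟨k, hk⟩ := exists_slope_bijective hL.2
  -- Two transversal slopes that differ by a multiple of `w` along one spatial direction isolate the
  -- contribution of the fibre vector `w`.
  have hw : ∀ w, (L (0, w)).1.1 = 0 := by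
    intro w
    obtain ⟨ε, hε, h1, -⟩ := exists_slope_perturbation hk ((xC ⟨0, hn⟩).smulRight w)
    have h2 := key _ h1 ⟨0, hn⟩
    rw [slopeMap_perturb, Prod.fst_add, key k hk, zero_add] at h2
    simpa [ex, hε] using h2
  have hx : ∀ a, (L (ex a, 0)).1.1 = 0 := by
    intro a
    have h1 := key k hk a
    have : ((ex a, k (ex a)) : Vars n) = (ex a, 0) + (0, k (ex a)) := by simp
    rw [slopeMap_apply, this, map_add] at h1
    simpa [hw] using h1
  have : (((0, v), w) : Vars n) = ∑ a, v a • ((ex a, 0) : Vars n) + (0, w) := by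
    refine Prod.ext ?_ ?_
    · have := spatial_eq_sum (v := ((0, v) : Base n)) rfl
      simpa [Prod.fst_sum] using this
    · simp [Prod.snd_sum]
  rw [this, map_add, map_sum]
  simp only [map_smul, Prod.fst_add, Prod.fst_sum, Prod.smul_fst, hx, hw, smul_zero,
    Finset.sum_const_zero, add_zero]


end

/-! ### Conformality of the spatial Jacobian and independence of the dependent variable. -/

section
variable {L : Vars n →L[ℝ] Vars n} {Q : Vars n →L[ℝ] Vars n →L[ℝ] Vars n} {f f' : ℂ}

/-- The derivative of the transformed time with respect to time. -/
def timeRate (L : Vars n →L[ℝ] Vars n) : ℝ := (L (et, 0)).1.1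

theorem slopeMap_time (hL1 : ∀ v w, (L ((0, v), w)).1.1 = 0) (k : Base n →L[ℝ] ℂ)
    (v : Base n) : (slopeMap L k v).1 = timeRate L * v.1 := by
  have : ((v, k v) : Vars n) = v.1 • ((et, 0) : Vars n) + ((0, v.2), k v) := by
    refine Prod.ext (Prod.ext ?_ ?_) ?_ <;> simp [et]
  rw [slopeMap_apply, this, map_add, map_smul]
  simp [hL1, timeRate, mul_comm]

theorem timeRate_ne_zero (hL1 : ∀ v w, (L ((0, v), w)).1.1 = 0)
    (hL : Function.Surjective L) : timeRate L ≠ 0 := by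
  intro h
  obtain ⟨k, hk⟩ := exists_slope_bijective hL
  obtain ⟨v, hv⟩ := hk.2 et
  have := slopeMap_time hL1 k v
  rw [hv, h] at this
  simp [et] at this

theorem slopeMap_spatial_surjective (hL1 : ∀ v w, (L ((0, v), w)).1.1 = 0)
    (hθ : timeRate L ≠ 0) {k : Base n →L[ℝ] ℂ} (hk : Function.Bijective (slopeMap L k))
    {u : Base n} (hu : u.1 = 0) : ∃ v : Base n, v.1 = 0 ∧ slopeMap L k v = u := by
  obtain ⟨v, hv⟩ := hk.2 u
  refine ⟨v, ?_, hv⟩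
  have := slopeMap_time hL1 k v
  rw [hv, hu] at this
  exact (mul_eq_zero.1 this.symm).resolve_left hθ

/-- The linearized equation must be mapped to the linearized equation. Here `s` is a variation of
ψ_t and `c0` scales a variation of the transformed second derivatives in the directions `b`, `c`;
the two sides express that the varied jet stays on the source and on the target equation. -/
theorem JetTransfer.variation (hJ : JetTransfer L Q f f') (hn : 1 ≤ n)
    (hL : Function.Bijective L) (hL1 : ∀ v w, (L ((0, v), w)).1.1 = 0)
    (hQ1 : ∀ v w v' w', (Q ((0, v), w) ((0, v'), w')).1.1 = 0) {k : Base n →L[ℝ] ℂ}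
    (hk : Function.Bijective (slopeMap L k)) :
    ∃ k' : Base n →L[ℝ] ℂ, Function.Injective (fiberMap L k') ∧ ∀ (b c : Fin n) (s c0 : ℂ),
      (fiberMap L k' (Complex.I * s)
          + (∑ a, (slopeMap L k (ex a)).2 b * (slopeMap L k (ex a)).2 c : ℝ) * c0 = 0 ↔
        Complex.I * fiberMap L k' s / timeRate L + (if b = c then 1 else 0) * c0 = 0) := by
  have hθ := timeRate_ne_zero hL1 hL.2
  obtain ⟨H0, hH0⟩ := exists_bilin_trace hn (-(Complex.I * k et) - f)
  obtain ⟨k0, H0', P0, iff0⟩ := hJ k H0 hk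
  have hM := fiberMap_injective hL.1 hk P0.first
  obtain ⟨N, hN⟩ := exists_inverse_of_injective hM
  refine ⟨k0, hM, fun b c s c0 => ?_⟩
  set A := slopeMap L k with hA
  set h : Base n →L[ℝ] Base n →L[ℝ] ℝ := (xC b).smulRight (xC c) with hh
  have hE0 := iff0.1 (by rw [hH0]; ring)
  -- Only the time slope changes, so everything evaluated on spatial vectors is unaffected.
  set k1 : Base n →L[ℝ] ℂ := k + (1 : ℝ) • tC.smulRight s with hk1
  have hk1a : ∀ v, k1 v = k v + v.1 * s := by intro v; simp [hk1]
  have hA1 : ∀ v, slopeMap L k1 v = A v + v.1 • (L (0, s)).1 := by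
    intro v
    rw [hk1, slopeMap_perturb, one_smul, ← hA]
    have : ((0, (tC.smulRight s) v) : Vars n) = v.1 • ((0, s) : Vars n) := by simp
    rw [this, map_smul]
    rfl
  have hA1s : ∀ v : Base n, v.1 = 0 → slopeMap L k1 v = A v := by
    intro v hv; rw [hA1, hv, zero_smul, add_zero]
  have hk1s : ∀ v : Base n, v.1 = 0 → k1 v = k v := by
    intro v hv; rw [hk1a, hv]; simp
  have hk1b : Function.Bijective (slopeMap L k1) := by
    have hinj : Function.Injective (slopeMap L k1) := by
      rw [injective_iff_map_eq_zero]
      intro v hv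
      have h1 := slopeMap_time hL1 k1 v
      rw [hv] at h1
      have h2 : v.1 = 0 := (mul_eq_zero.1 h1.symm).resolve_left hθ
      rw [hA1s v h2] at hv
      exact (injective_iff_map_eq_zero A).1 hk.1 v hv
    exact ⟨hinj, LinearMap.injective_iff_surjective.1 hinj⟩
  obtain ⟨k1', H1', P1, iff1⟩ := hJ k1 (H0 + pullbackForm N A h c0) hk1b
  have hk' : ∀ u : Base n, u.1 = 0 → k1' u = k0 u := by
    intro u hu
    obtain ⟨v, hv, rfl⟩ := slopeMap_spatial_surjective hL1 hθ hk hu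
    have e1 := P1.first v
    rw [← slopeMap_apply, hA1s v hv, hk1s v hv] at e1
    exact e1.trans (P0.first v).symm
  have hsp : ∀ w, (L (0, w)).1.1 = 0 := fun w => hL1 0 w
  have hkt : (timeRate L : ℂ) * k1' et = timeRate L * k0 et + fiberMap L k0 s := by
    have e0 := P0.first et
    have e1 := P1.first et
    have e2 : L (et, k1 et) = L (et, k et) + L (0, s) := by
      rw [← map_add, hk1a]; simp [et]
    have e3 : (L (et, k et)).1 = timeRate L • et + (0, (L (et, k et)).1.2) := by
      refine Prod.ext ?_ ?_
      · have := slopeMap_time hL1 k et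
        simpa [et] using this
      · simp [et]
    rw [e2, Prod.fst_add, map_add, hk' _ (hsp s), e3, map_add, map_smul,
      hk' (0, _) rfl] at e1
    rw [e3, map_add, map_smul] at e0
    simp only [Complex.real_smul, Prod.snd_add] at e0 e1
    rw [fiberMap_apply]
    linear_combination e1 - e0
  have hH1 : ∀ u : Base n, u.1 = 0 → H1' u u = H0' u u + (h u u : ℂ) * c0 := by
    intro u hu
    obtain ⟨v, hv, rfl⟩ := slopeMap_spatial_surjective hL1 hθ hk hu
    have e1 := P1.second v
    have e0 := P0.second v
    have e2 := hN ((h (A v) (A v) : ℂ) * c0)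
    have e3 : L (0, (H0 + pullbackForm N A h c0) v v)
        = L (0, H0 v v) + L (0, N ((h (A v) (A v) : ℂ) * c0)) := by
      rw [← map_add]; simp
    -- This makes the argument of `k1'` spatial, where `k1'` agrees with `k0`.
    have e4 : (Q (v, k v) (v, k v)).1.1 = 0 := by
      have := hQ1 v.2 (k v) v.2 (k v)
      rwa [show ((0, v.2) : Base n) = v from Prod.ext hv.symm rfl] at this
    rw [← slopeMap_apply, hA1s v hv, hk1s v hv, e3, hk' _ (by simp [e4, hsp])] at e1
    simp only [Prod.fst_add, Prod.snd_add, map_add, fiberMap_apply] at e0 e1 e2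
    change H1' (L (v, k v)).1 (L (v, k v)).1 = H0' (L (v, k v)).1 (L (v, k v)).1 + _
    change H1' (L (v, k v)).1 (L (v, k v)).1 + _ = _ at e1
    linear_combination e1 - e0 + e2
  have htr : ∑ a, (h (ex a) (ex a) : ℂ) = if b = c then 1 else 0 := by
    simp only [hh, ContinuousLinearMap.smulRight_apply, smul_apply, xC_apply, smul_eq_mul, ex,
      Pi.single_apply]
    by_cases hbc : b = c
    · subst hbc
      rw [if_pos rfl, Finset.sum_eq_single b] <;> simp +contextual [eq_comm]
    · rw [if_neg hbc]
      refine Finset.sum_eq_zero fun a _ => ?_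
      by_cases hb : b = a
      · simp [← hb, Ne.symm hbc]
      · simp [hb]
  have hH1s : ∑ a, H1' (ex a) (ex a)
      = ∑ a, H0' (ex a) (ex a) + (if b = c then 1 else 0) * c0 := by
    rw [← htr, Finset.sum_mul, ← Finset.sum_add_distrib]
    exact Finset.sum_congr rfl fun a _ => hH1 _ rfl
  have hG : ∑ a, pullbackForm N A h c0 (ex a) (ex a)
      = N ((∑ a, (A (ex a)).2 b * (A (ex a)).2 c : ℝ) * c0) := by
    simp only [pullbackForm_apply, ← map_sum, ← Finset.sum_mul, hh]
    congr 2
    push_cast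
    simp
  have hθ' : (timeRate L : ℂ) ≠ 0 := by exact_mod_cast hθ
  have hk1t : k1 et = k et + s := by rw [hk1a]; simp [et]
  constructor
  · intro hyp
    have := iff1.1 (by
      simp only [add_apply, Finset.sum_add_distrib, hH0, hG, hk1t]
      have e := hM (a₁ := Complex.I * s
        + N ((∑ a, (A (ex a)).2 b * (A (ex a)).2 c : ℝ) * c0)) (a₂ := 0) (by
          rw [map_add, hN, map_zero]; exact hyp)
      linear_combination e)
    rw [hH1s] at this
    have e : Complex.I * (k1' et - k0 et) + (if b = c then 1 else 0) * c0 = 0 := by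
      linear_combination this - hE0
    have e2 : k1' et - k0 et = fiberMap L k0 s / timeRate L := by
      field_simp; linear_combination hkt
    rw [e2] at e
    rw [mul_div_assoc]
    exact e
  · intro hyp
    have e2 : k1' et = k0 et + fiberMap L k0 s / timeRate L := by
      field_simp; linear_combination hkt
    have := iff1.2 (by
      rw [hH1s, e2]
      linear_combination hE0 + hyp)
    simp only [add_apply, Finset.sum_add_distrib, hH0, hG, hk1t] at this
    have e : Complex.I * s + N ((∑ a, (A (ex a)).2 b * (A (ex a)).2 c : ℝ) * c0) = 0 := by
      linear_combination this
    have e3 := congrArg (fiberMap L k0) e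
    rwa [map_add, hN, map_zero] at e3

/-- For `b = c` the variations give M(is) = (μ/θ) i M(s), with M the fibre map, θ the time rate and
μ the squared length of a row of the spatial Jacobian. Applying this twice gives (μ/θ)² = 1, hence μ
= |θ|, and M commutes with i up to the sign of θ. For `b ≠ c`, the choice `s = 0`, `c0 = 1` gives
orthogonality. -/
theorem slopeMap_orthogonal (hJ : JetTransfer L Q f f') (hn : 1 ≤ n)
    (hL : Function.Bijective L) (hL1 : ∀ v w, (L ((0, v), w)).1.1 = 0)
    (hQ1 : ∀ v w v' w', (Q ((0, v), w) ((0, v'), w')).1.1 = 0) {k : Base n →L[ℝ] ℂ}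
    (hk : Function.Bijective (slopeMap L k)) :
    (∀ b c, ∑ a, (slopeMap L k (ex a)).2 b * (slopeMap L k (ex a)).2 c
      = if b = c then |timeRate L| else 0) ∧
    ∃ k' : Base n →L[ℝ] ℂ, ∀ s, fiberMap L k' (Complex.I * s)
      = (SignType.sign (timeRate L) : ℝ) * (Complex.I * fiberMap L k' s) := by
  have hθ := timeRate_ne_zero hL1 hL.2
  have hθ' : (timeRate L : ℂ) ≠ 0 := by exact_mod_cast hθ
  obtain ⟨k', hM, hv⟩ := hJ.variation hn hL hL1 hQ1 hk
  set A := slopeMap L k with hA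
  have key : ∀ b s, fiberMap L k' (Complex.I * s) = ((∑ a, (A (ex a)).2 b * (A (ex a)).2 b : ℝ)
      / timeRate L : ℝ) * (Complex.I * fiberMap L k' s) := by
    intro b s
    -- The value of `c0` is the one that puts the varied jet on the target equation.
    have := (hv b b s (-(Complex.I * fiberMap L k' s / timeRate L))).2 (by simp)
    rw [Complex.ofReal_div]
    linear_combination this
  have hdiag : ∀ b, ∑ a, (A (ex a)).2 b * (A (ex a)).2 b = |timeRate L| := by
    intro b
    set μ : ℝ := ∑ a, (A (ex a)).2 b * (A (ex a)).2 b with hμ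
    have hμ0 : 0 ≤ μ := Finset.sum_nonneg fun a _ => mul_self_nonneg _
    have h1 := key b (Complex.I * 1)
    rw [key b 1, show Complex.I * (Complex.I * 1) = -1 by rw [← mul_assoc]; simp, map_neg,
      ← hμ] at h1
    have hne : fiberMap L k' 1 ≠ 0 := by
      intro h0
      exact one_ne_zero (hM (h0.trans (map_zero _).symm))
    have h2 : ((μ / timeRate L : ℝ) : ℂ) ^ 2 = 1 := by
      have h3 : (((μ / timeRate L : ℝ) : ℂ) ^ 2 - 1) * fiberMap L k' 1 = 0 := by
        linear_combination h1 + ((μ / timeRate L : ℝ) : ℂ) ^ 2 * fiberMap L k' 1 * Complex.I_sq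
      exact sub_eq_zero.1 ((mul_eq_zero.1 h3).resolve_right hne)
    have h4 : (μ / timeRate L) ^ 2 = 1 := by exact_mod_cast h2
    rw [div_pow, div_eq_one_iff_eq (pow_ne_zero 2 hθ)] at h4
    rw [← abs_of_nonneg hμ0]
    exact (sq_eq_sq_iff_abs_eq_abs _ _).1 h4
  refine ⟨fun b c => ?_, k', fun s => ?_⟩
  · split_ifs with hbc
    · subst hbc; exact hdiag b
    · have := (hv b c 0 1).2 (by rw [map_zero]; simp [hbc])
      simp only [mul_zero, map_zero, zero_add, mul_one] at this
      exact_mod_cast this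
  · rw [key ⟨0, hn⟩, hdiag]
    congr 2
    rw [div_eq_iff hθ]
    exact (sign_mul_self _).symm

/-- The transformed independent variables do not depend on the dependent variable. -/
theorem JetTransfer.base_fiber (hJ : JetTransfer L Q f f') (hn : 1 ≤ n)
    (hL : Function.Bijective L) (hL1 : ∀ v w, (L ((0, v), w)).1.1 = 0)
    (hQ1 : ∀ v w v' w', (Q ((0, v), w) ((0, v'), w')).1.1 = 0) (w : ℂ) :
    (L (0, w)).1 = 0 := by
  obtain ⟨k, hk⟩ := exists_slope_bijective hL.2
  obtain ⟨ε, hε, h1, h2⟩ := exists_slope_perturbation hk ((xC ⟨0, hn⟩).smulRight w)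
  refine Prod.ext (hL1 0 w) ?_
  ext b
  have e0 := (slopeMap_orthogonal hJ hn hL hL1 hQ1 hk).1 b b
  have e1 := (slopeMap_orthogonal hJ hn hL hL1 hQ1 h1).1 b b
  have e2 := (slopeMap_orthogonal hJ hn hL hL1 hQ1 h2).1 b b
  set l := (xC ⟨0, hn⟩).smulRight w with hl
  have hsub : k - ε • l = k + (-ε) • l := ContinuousLinearMap.ext fun v => by
    simp [sub_eq_add_neg]
  rw [hsub] at e2
  simp only [slopeMap_perturb, Prod.snd_add, Prod.smul_snd, Pi.add_apply, Pi.smul_apply,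
    smul_eq_mul] at e1 e2
  -- Parallelogram identity: the row for slope `k` and those for its perturbations in both
  -- directions all have squared length |θ|, so the increment has length zero.
  have e3 : ∑ a, (ε * (L (0, l (ex a))).1.2 b) * (ε * (L (0, l (ex a))).1.2 b) = 0 := by
    have h3 : 2 * ∑ a, (ε * (L (0, l (ex a))).1.2 b) * (ε * (L (0, l (ex a))).1.2 b)
        = ∑ a, ((slopeMap L k (ex a)).2 b + ε * (L (0, l (ex a))).1.2 b)
            * ((slopeMap L k (ex a)).2 b + ε * (L (0, l (ex a))).1.2 b)
          + ∑ a, ((slopeMap L k (ex a)).2 b + -ε * (L (0, l (ex a))).1.2 b)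
            * ((slopeMap L k (ex a)).2 b + -ε * (L (0, l (ex a))).1.2 b)
          - 2 * ∑ a, (slopeMap L k (ex a)).2 b * (slopeMap L k (ex a)).2 b := by
      rw [Finset.mul_sum, Finset.mul_sum, ← Finset.sum_add_distrib, ← Finset.sum_sub_distrib]
      exact Finset.sum_congr rfl fun a _ => by ring
    rw [e0, e1, e2] at h3
    simp only [if_true] at h3
    linarith
  have h4 := (Finset.sum_eq_zero_iff_of_nonneg (fun i _ => mul_self_nonneg _)).1 e3 ⟨0, hn⟩
    (Finset.mem_univ _)
  have h5 := mul_self_eq_zero.1 h4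
  simpa [hε, hl, ex] using h5


end

/-! ### Fibre-preserving prolongation and the determining equations. -/

section
variable {L : Vars n →L[ℝ] Vars n} {Q : Vars n →L[ℝ] Vars n →L[ℝ] Vars n} {f f' : ℂ}

/-- Restrictions on the 2-jet `(L, Q)` of a point transformation that reduce its prolongation
to fiber-preserving form with scaled orthogonal spatial part. -/
structure Reduced (L : Vars n →L[ℝ] Vars n) (Q : Vars n →L[ℝ] Vars n →L[ℝ] Vars n) : Prop where
  time : ∀ v w, (L ((0, v), w)).1.1 = 0
  base : ∀ w, (L (0, w)).1 = 0
  rate : timeRate L ≠ 0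
  orth : ∀ b c, ∑ a, (L (ex a, 0)).1.2 b * (L (ex a, 0)).1.2 c
    = if b = c then |timeRate L| else 0
  conj : ∀ s, (L (0, Complex.I * s)).2
    = (SignType.sign (timeRate L) : ℝ) * (Complex.I * (L (0, s)).2)
  time2 : ∀ v w v' w', (Q ((0, v), w) ((0, v'), w')).1.1 = 0
  base2 : ∀ u w, (Q u (0, w)).1 = 0
  symm : ∀ u v, Q u v = Q v u

/-- The coefficients of the first-order terms that arise in the transformed equation. -/
def drift (L : Vars n →L[ℝ] Vars n) (Q : Vars n →L[ℝ] Vars n →L[ℝ] Vars n) (a : Fin n) : ℂ :=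
  (∑ b, ((L (ex a, 0)).1.2 b : ℂ) * (Complex.I * (SignType.sign (timeRate L) : ℝ)
    * ((L (et, 0)).1.2 b : ℂ) + ((∑ c, Q (ex c, 0) (ex c, 0)).1.2 b : ℂ))) / (|timeRate L| : ℝ)

/-- The difference between the transformed equation and the image of the original one, as a
function of the values `κ` of the derivatives `ψ_a`. -/
def defect (L : Vars n →L[ℝ] Vars n) (Q : Vars n →L[ℝ] Vars n →L[ℝ] Vars n) (f f' : ℂ)
    (κ : Fin n → ℂ) : ℂ :=
  Complex.I * (SignType.sign (timeRate L) : ℝ) * (L (et, 0)).2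
    - ∑ a, drift L Q a * ((L (ex a, 0)).2 + (L (0, κ a)).2) - (L (0, f)).2
    + ∑ a, (Q (ex a, κ a) (ex a, κ a)).2 + (|timeRate L| : ℝ) * f'

theorem map_split (L : Vars n →L[ℝ] Vars n) (v : Base n) (w : ℂ) :
    L (v, w) = L (v, 0) + L (0, w) := by
  rw [← map_add]; simp

theorem Reduced.fst_apply (h : Reduced L Q) (v : Base n) (w : ℂ) :
    (L (v, w)).1 = (L (v, 0)).1 := by
  rw [map_split, Prod.fst_add, h.base, add_zero]

theorem Reduced.fst_spatial (h : Reduced L Q) (a : Fin n) :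
    (L (ex a, 0)).1 = (0, (L (ex a, 0)).1.2) :=
  Prod.ext (h.time _ _) rfl

theorem spatial_eq_sum_snd (y : Fin n → ℝ) : ((0, y) : Base n) = ∑ a, y a • ex a :=
  spatial_eq_sum (v := (0, y)) rfl

/-- With B_a the image of the a-th spatial unit vector, conformality gives |θ| y = Σ_a ⟨B_a, y⟩ B_a;
the new slope is known on each B_a from the old one. -/
theorem Reduced.apply_spatial (h : Reduced L Q) {k k' : Base n →L[ℝ] ℂ}
    (hk : ∀ v, k' (L (v, k v)).1 = (L (v, k v)).2) (y : Fin n → ℝ) :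
    (|timeRate L| : ℝ) * k' (0, y) = ∑ a, (∑ b, (L (ex a, 0)).1.2 b * y b : ℝ)
      * ((L (ex a, 0)).2 + (L (0, k (ex a))).2) := by
  have h1 : ∀ a, (L (ex a, 0)).2 + (L (0, k (ex a))).2 = k' (0, (L (ex a, 0)).1.2) := by
    intro a
    rw [← h.fst_spatial, ← h.fst_apply _ (k (ex a)), hk, ← Prod.snd_add, ← map_split]
  simp only [h1, ← Complex.real_smul, ← map_smul, ← map_sum]
  congr 1
  refine Prod.ext ?_ ?_
  · simp [Prod.fst_sum]
  · ext c
    simp only [Prod.snd_sum, Prod.smul_snd, Finset.sum_apply, Pi.smul_apply, smul_eq_mul,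
      Finset.sum_mul]
    rw [Finset.sum_comm]
    have h2 : ∀ b, ∑ a, (L (ex a, 0)).1.2 b * y b * (L (ex a, 0)).1.2 c
        = y b * if b = c then |timeRate L| else 0 := by
      intro b
      rw [← h.orth, Finset.mul_sum]
      exact Finset.sum_congr rfl fun a _ => by ring
    rw [Finset.sum_congr rfl fun b _ => h2 b]
    simp [mul_comm]

theorem Reduced.trace (h : Reduced L Q) (H : Base n →L[ℝ] Base n →L[ℝ] ℂ) :
    ∑ a, H (L (ex a, 0)).1 (L (ex a, 0)).1 = (|timeRate L| : ℝ) * ∑ a, H (ex a) (ex a) := by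
  have h1 : ∀ a, H (L (ex a, 0)).1 (L (ex a, 0)).1 = ∑ b, ∑ c,
      ((L (ex a, 0)).1.2 b * (L (ex a, 0)).1.2 c : ℝ) * H (ex b) (ex c) := by
    intro a
    conv_lhs => rw [h.fst_spatial, spatial_eq_sum_snd]
    simp only [map_sum, map_smul, sum_apply, smul_apply, Complex.real_smul, Finset.mul_sum,
      Complex.ofReal_mul, mul_assoc]
    rw [Finset.sum_comm]
    exact Finset.sum_congr rfl fun b _ => Finset.sum_congr rfl fun c _ => by ring
  simp only [h1]
  rw [Finset.sum_comm, Finset.mul_sum]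
  refine Finset.sum_congr rfl fun b _ => ?_
  rw [Finset.sum_comm, Finset.sum_eq_single b]
  · rw [← Finset.sum_mul, ← Complex.ofReal_sum, h.orth, if_pos rfl]
  · intro c _ hc
    rw [← Finset.sum_mul, ← Complex.ofReal_sum, h.orth, if_neg hc.symm]
    simp
  · simp

theorem Reduced.Q_fst (h : Reduced L Q) (a : Fin n) (w : ℂ) :
    (Q (ex a, w) (ex a, w)).1 = (Q (ex a, 0) (ex a, 0)).1 := by
  have : ((ex a, w) : Vars n) = (ex a, 0) + (0, w) := by simp
  rw [this]
  simp only [map_add, add_apply, Prod.fst_add, h.base2, h.symm (0, w) (ex a, 0), add_zero]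

/-- Transformation rule for the left-hand sides of the equations. -/
theorem Reduced.transfer (h : Reduced L Q) {k k' : Base n →L[ℝ] ℂ}
    {H H' : Base n →L[ℝ] Base n →L[ℝ] ℂ} (P : Prolongs L Q k H k' H') (f f' : ℂ) :
    (|timeRate L| : ℝ) * (Complex.I * k' et + ∑ a, H' (ex a) (ex a) + f')
      = (L (0, Complex.I * k et + ∑ a, H (ex a) (ex a) + f)).2
        + defect L Q f f' fun a => k (ex a) := by
  have hρ : ((|timeRate L| : ℝ) : ℂ) ≠ 0 := by
    exact_mod_cast abs_ne_zero.2 h.rate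
  have hs : ((|timeRate L| : ℝ) : ℂ) = (SignType.sign (timeRate L) : ℝ) * (timeRate L : ℂ) := by
    exact_mod_cast (sign_mul_self (timeRate L)).symm
  set ε : ℂ := ((SignType.sign (timeRate L) : ℝ) : ℂ) with hε
  set y : Fin n → ℝ := (L (et, 0)).1.2 with hy
  set l : Fin n → ℝ := (∑ c, Q (ex c, 0) (ex c, 0)).1.2 with hl
  have ht : (timeRate L : ℂ) * k' et + k' (0, y) = (L (et, 0)).2 + (L (0, k et)).2 := by
    have e := P.first et
    rw [h.fst_apply, map_split L et (k et), Prod.snd_add] at e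
    have e1 : (L (et, 0)).1 = timeRate L • et + (0, y) := by
      refine Prod.ext ?_ ?_
      · simp [timeRate, et]
      · simp [et, hy]
    rw [e1, map_add, map_smul, Complex.real_smul] at e
    exact e
  have hHs : ((|timeRate L| : ℝ) : ℂ) * ∑ a, H' (ex a) (ex a) + k' (0, l)
      = ∑ a, (Q (ex a, k (ex a)) (ex a, k (ex a))).2 + (L (0, ∑ a, H (ex a) (ex a))).2 := by
    have e : ∀ a, H' (L (ex a, 0)).1 (L (ex a, 0)).1 + k' (Q (ex a, 0) (ex a, 0)).1
        = (Q (ex a, k (ex a)) (ex a, k (ex a))).2 + (L (0, H (ex a) (ex a))).2 := by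
      intro a
      have e1 := P.second (ex a)
      rwa [h.fst_apply, Prod.fst_add, Prod.snd_add, h.Q_fst, h.base, add_zero] at e1
    have e2 := Finset.sum_congr (s₁ := Finset.univ) rfl fun a _ => e a
    rw [Finset.sum_add_distrib, Finset.sum_add_distrib, h.trace, ← map_sum] at e2
    have e3 : ∑ a, (Q (ex a, 0) (ex a, 0)).1 = (0, l) := by
      refine Prod.ext ?_ ?_
      · simp only [Prod.fst_sum]
        exact Finset.sum_eq_zero fun a _ => h.time2 _ _ _ _
      · rw [hl, Prod.fst_sum]
    have e4 : ∑ a, (L (0, H (ex a) (ex a))).2 = (L (0, ∑ a, H (ex a) (ex a))).2 := by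
      have : ((0, ∑ a, H (ex a) (ex a)) : Vars n) = ∑ a, (0, H (ex a) (ex a)) := by
        refine Prod.ext ?_ ?_ <;> simp [Prod.fst_sum, Prod.snd_sum]
      rw [this, map_sum, Prod.snd_sum]
    rw [e3, e4] at e2
    exact e2
  have hy1 := h.apply_spatial P.first y
  have hl1 := h.apply_spatial P.first l
  -- The drift coefficients collect the two places where the new spatial slope enters: the x-shift
  -- accompanying the t-derivative, and the second derivatives of the new x.
  have hd : ∑ a, drift L Q a * ((L (ex a, 0)).2 + (L (0, k (ex a))).2)
      = Complex.I * ε * k' (0, y) + k' (0, l) := by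
    apply mul_left_cancel₀ hρ
    rw [mul_add, mul_left_comm, hy1, hl1, Finset.mul_sum, Finset.mul_sum,
      ← Finset.sum_add_distrib]
    refine Finset.sum_congr rfl fun a _ => ?_
    rw [← mul_assoc, drift, mul_div_cancel₀ _ hρ]
    simp only [mul_add, Finset.sum_add_distrib, Complex.ofReal_sum, Complex.ofReal_mul]
    simp only [← hε, ← hy, ← hl]
    have : ∑ b, ((L (ex a, 0)).1.2 b : ℂ) * (Complex.I * ε * (y b : ℂ))
        = Complex.I * ε * ∑ b, ((L (ex a, 0)).1.2 b : ℂ) * (y b : ℂ) := by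
      rw [Finset.mul_sum]
      exact Finset.sum_congr rfl fun b _ => by ring
    rw [this]
    ring
  have hc : (L (0, Complex.I * k et)).2 = ε * (Complex.I * (L (0, k et)).2) := h.conj _
  have hsplit : (L (0, Complex.I * k et + ∑ a, H (ex a) (ex a) + f)).2
      = (L (0, Complex.I * k et)).2 + (L (0, ∑ a, H (ex a) (ex a))).2 + (L (0, f)).2 := by
    have : ((0, Complex.I * k et + ∑ a, H (ex a) (ex a) + f) : Vars n)
        = (0, Complex.I * k et) + (0, ∑ a, H (ex a) (ex a)) + (0, f) := by simp
    rw [this, map_add, map_add, Prod.snd_add, Prod.snd_add]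
  rw [hsplit, defect, hd, ← hε, hc]
  linear_combination (Complex.I * k' et) * hs + hHs + Complex.I * ε * ht

theorem Reduced.slopeMap_bijective (h : Reduced L Q) (hL : Function.Surjective L)
    (k : Base n →L[ℝ] ℂ) : Function.Bijective (slopeMap L k) := by
  obtain ⟨k0, hk0⟩ := exists_slope_bijective hL
  have : slopeMap L k = slopeMap L k0 := ContinuousLinearMap.ext fun v => by
    rw [slopeMap_apply, slopeMap_apply, h.fst_apply, h.fst_apply _ (k0 v)]
  rwa [this]

theorem JetTransfer.defect_eq_zero (hJ : JetTransfer L Q f f') (hn : 1 ≤ n)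
    (hL : Function.Surjective L) (h : Reduced L Q) (κ : Fin n → ℂ) :
    defect L Q f f' κ = 0 := by
  set k : Base n →L[ℝ] ℂ := ∑ a, (xC a).smulRight (κ a) with hk
  -- With this trace the jet solves the original equation, hence also the target one, and in
  -- `Reduced.transfer` only the defect is left.
  obtain ⟨H, hH⟩ := exists_bilin_trace hn (-(Complex.I * k et) - f)
  obtain ⟨k', H', P, hi⟩ := hJ k H (h.slopeMap_bijective hL k)
  have h0 : Complex.I * k et + ∑ a, H (ex a) (ex a) + f = 0 := by rw [hH]; ring
  have h1 := h.transfer P f f'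
  rw [hi.1 h0, h0] at h1
  have h2 : (L (0, 0)).2 = 0 := by rw [← Prod.zero_eq_mk, map_zero]; rfl
  rw [h2, mul_zero, zero_add] at h1
  have h3 : (fun a => k (ex a)) = κ := by
    ext1 a
    simp [hk, ex, Pi.single_apply]
  rw [h1, h3]

theorem Reduced.defect_expand (h : Reduced L Q) (κ : Fin n → ℂ) :
    defect L Q f f' κ = defect L Q f f' 0
      + ∑ a, (2 * (Q (ex a, 0) (0, κ a)).2 - drift L Q a * (L (0, κ a)).2)
      + ∑ a, (Q (0, κ a) (0, κ a)).2 := by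
  have h1 : ∀ a, (Q (ex a, κ a) (ex a, κ a)).2 = (Q (ex a, 0) (ex a, 0)).2
      + 2 * (Q (ex a, 0) (0, κ a)).2 + (Q (0, κ a) (0, κ a)).2 := by
    intro a
    have : ((ex a, κ a) : Vars n) = (ex a, 0) + (0, κ a) := by simp
    rw [this]
    simp only [map_add, add_apply, Prod.snd_add, h.symm (0, κ a) (ex a, 0)]
    ring
  have h2 : (L (0, 0)).2 = 0 := by rw [← Prod.zero_eq_mk, map_zero]; rfl
  simp only [defect, h1, Pi.zero_apply, h2, mul_add, add_zero, Finset.sum_add_distrib,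
    Finset.sum_sub_distrib]
  ring

/-- The determining equations for the dependent variable. -/
structure Determining (L : Vars n →L[ℝ] Vars n) (Q : Vars n →L[ℝ] Vars n →L[ℝ] Vars n)
    (f f' : ℂ) : Prop where
  quadratic : ∀ w, (Q (0, w) (0, w)).2 = 0
  linear : ∀ a w, 2 * (Q (ex a, 0) (0, w)).2 = drift L Q a * (L (0, w)).2
  free : defect L Q f f' 0 = 0

theorem Reduced.defect_eq_zero (h : Reduced L Q) (hd : Determining L Q f f') (κ : Fin n → ℂ) :
    defect L Q f f' κ = 0 := by
  rw [h.defect_expand, hd.free]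
  simp [hd.linear, hd.quadratic]

/-- The defect is a polynomial of degree two in κ. Setting all but one component to zero, and
comparing `w` with `-w`, separates its coefficients. -/
theorem Reduced.determining (h : Reduced L Q) (hn : 1 ≤ n)
    (hd : ∀ κ, defect L Q f f' κ = 0) : Determining L Q f f' := by
  have h0 := hd 0
  have h1 : ∀ κ : Fin n → ℂ,
      ∑ a, (2 * (Q (ex a, 0) (0, κ a)).2 - drift L Q a * (L (0, κ a)).2)
      + ∑ a, (Q (0, κ a) (0, κ a)).2 = 0 := by
    intro κ
    have := h.defect_expand (f := f) (f' := f') κ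
    rw [hd, h0] at this
    rw [zero_add] at this
    exact this.symm
  have hneg : ∀ w : ℂ, ((0, -w) : Vars n) = -(0, w) := by intro w; simp
  have hz : ((0, 0) : Vars n) = 0 := rfl
  have h2 : ∀ (b : Fin n) (w : ℂ), (2 * (Q (ex b, 0) (0, w)).2 - drift L Q b * (L (0, w)).2)
      + (Q (0, w) (0, w)).2 = 0 := by
    intro b w
    have e := h1 (Pi.single b w)
    rw [Finset.sum_eq_single b, Finset.sum_eq_single b] at e
    · simpa using e
    · intro a _ ha
      simp [Pi.single_eq_of_ne ha, hz]
    · simp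
    · intro a _ ha
      simp [Pi.single_eq_of_ne ha, hz]
    · simp
  have h3 : ∀ (b : Fin n) (w : ℂ), (Q (0, w) (0, w)).2 = 0 := by
    intro b w
    have e1 := h2 b w
    have e2 := h2 b (-w)
    rw [hneg] at e2
    simp only [map_neg, neg_apply, Prod.snd_neg, neg_neg] at e2
    linear_combination (e1 + e2) / 2
  refine ⟨h3 ⟨0, hn⟩, fun a w => ?_, h0⟩
  have := h2 a w
  rw [h3 a w] at this
  linear_combination this


end


/-! ### Second derivatives of u ln|u|. -/

section LogNonlinearity

open Complex

/-- The second derivative of `u ln |u|` along `h`. -/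
def logSecond (u h : ℂ) : ℂ :=
  2 * h * ((h.re * u.re + h.im * u.im) / normSq u : ℝ)
    + u * (normSq h / normSq u - 2 * (h.re * u.re + h.im * u.im) ^ 2 / normSq u ^ 2 : ℝ)

/-- The directions `h` and `εih` are orthogonal and equally long, so the sum is |h|² times the
Laplacian of u ln|u|. As u and ln|u| are harmonic, this Laplacian is 2∇u·∇ln|u| = 2/ū. -/
theorem logSecond_add (u h : ℂ) (hu : u ≠ 0) (ε : ℝ) (hε : ε ^ 2 = 1) :
    starRingEnd ℂ u * (logSecond u h + logSecond u (ε * (I * h))) = 2 * normSq h := by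
  have hn : normSq u ≠ 0 := by simpa using hu
  have h2 : normSq u = u.re * u.re + u.im * u.im := normSq_apply u
  have h3 : normSq h = h.re * h.re + h.im * h.im := normSq_apply h
  have hre : ((ε : ℂ) * (I * h)).re = -(ε * h.im) := by simp
  have him : ((ε : ℂ) * (I * h)).im = ε * h.re := by simp
  have hns : normSq ((ε : ℂ) * (I * h)) = normSq h := by
    rw [map_mul, map_mul, normSq_ofReal, normSq_I, ← sq, hε]; ring
  unfold logSecond
  rw [hre, him, hns]
  apply Complex.ext
  · simp only [mul_re, add_re, mul_im, add_im, conj_re, conj_im, ofReal_re, ofReal_im, hre, him,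
      re_ofNat, im_ofNat]
    field_simp
    rw [h2, h3]
    rcases sq_eq_one_iff.1 hε with rfl | rfl <;> ring
  · simp only [mul_re, add_re, mul_im, add_im, conj_re, conj_im, ofReal_re, ofReal_im, hre, him,
      re_ofNat, im_ofNat]
    field_simp
    rw [h2, h3]
    rcases sq_eq_one_iff.1 hε with rfl | rfl <;> ring

theorem hasDerivAt_line (u h : ℂ) (s : ℝ) : HasDerivAt (fun s : ℝ => u + s * h) h s := by
  simpa using ((hasDerivAt_id s).ofReal_comp.mul_const h).const_add u

theorem hasDerivAt_normSq_line (u h : ℂ) (s : ℝ) :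
    HasDerivAt (fun s : ℝ => normSq (u + s * h))
      (2 * (h.re * (u + s * h).re + h.im * (u + s * h).im)) s := by
  have h1 : HasDerivAt (fun s : ℝ => u.re + s * h.re) h.re s := by
    simpa using ((hasDerivAt_id s).mul_const h.re).const_add u.re
  have h2 : HasDerivAt (fun s : ℝ => u.im + s * h.im) h.im s := by
    simpa using ((hasDerivAt_id s).mul_const h.im).const_add u.im
  have h3 := (h1.mul h1).add (h2.mul h2)
  have h4 : (fun s : ℝ => normSq (u + s * h)) = fun s : ℝ =>
      (u.re + s * h.re) * (u.re + s * h.re) + (u.im + s * h.im) * (u.im + s * h.im) := by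
    ext1 s; simp [normSq_apply]
  rw [h4]
  refine h3.congr_deriv ?_
  simp
  ring

theorem hasDerivAt_log_line (u h : ℂ) {s : ℝ} (hs : u + s * h ≠ 0) :
    HasDerivAt (fun s : ℝ => Real.log ‖u + s * h‖)
      ((h.re * (u + s * h).re + h.im * (u + s * h).im) / normSq (u + s * h)) s := by
  have h1 : (fun s : ℝ => Real.log ‖u + s * h‖)
      = fun s : ℝ => Real.log (normSq (u + s * h)) / 2 := by
    ext1 s
    rw [Complex.norm_def, Real.log_sqrt (normSq_nonneg _)]
  rw [h1]
  refine (((hasDerivAt_normSq_line u h s).log (by simpa using hs)).div_const 2).congr_deriv ?_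
  ring

theorem hasDerivAt_mul_log (u h : ℂ) {s : ℝ} (hs : u + s * h ≠ 0) :
    HasDerivAt (fun s : ℝ => (u + s * h) * (Real.log ‖u + s * h‖ : ℂ))
      (h * (Real.log ‖u + s * h‖ : ℂ) + (u + s * h)
        * ((h.re * (u + s * h).re + h.im * (u + s * h).im) / normSq (u + s * h) : ℝ)) s :=
  (hasDerivAt_line u h s).mul (hasDerivAt_log_line u h hs).ofReal_comp

theorem hasDerivAt_mul_log_snd (u h : ℂ) (hu : u ≠ 0) :
    HasDerivAt (fun s : ℝ => h * (Real.log ‖u + s * h‖ : ℂ) + (u + s * h)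
        * ((h.re * (u + s * h).re + h.im * (u + s * h).im) / normSq (u + s * h) : ℝ))
      (logSecond u h) 0 := by
  have h0 : u + ((0 : ℝ) : ℂ) * h ≠ 0 := by simpa using hu
  have hn : normSq u ≠ 0 := by simpa using hu
  have h1 := (hasDerivAt_log_line u h h0).ofReal_comp.const_mul h
  have h2 : HasDerivAt (fun s : ℝ => h.re * (u + s * h).re + h.im * (u + s * h).im)
      (normSq h) 0 := by
    have e1 : HasDerivAt (fun s : ℝ => h.re * (u.re + s * h.re) + h.im * (u.im + s * h.im))
        (h.re * (1 * h.re) + h.im * (1 * h.im)) 0 :=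
      ((((hasDerivAt_id (0 : ℝ)).mul_const h.re).const_add u.re).const_mul h.re).add
        ((((hasDerivAt_id (0 : ℝ)).mul_const h.im).const_add u.im).const_mul h.im)
    have e2 : (fun s : ℝ => h.re * (u + s * h).re + h.im * (u + s * h).im) =
        fun s : ℝ => h.re * (u.re + s * h.re) + h.im * (u.im + s * h.im) := by
      ext1 s; simp
    rw [e2]
    refine e1.congr_deriv ?_
    rw [normSq_apply]; ring
  have h3 := (hasDerivAt_line u h 0).mul
    (h2.div (hasDerivAt_normSq_line u h 0) (by simpa using hu)).ofReal_comp
  refine (h1.add h3).congr_deriv ?_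
  unfold logSecond
  simp only [Pi.div_apply, ofReal_zero, zero_mul, add_zero]
  have h4 : (normSq h * normSq u
      - (h.re * u.re + h.im * u.im) * (2 * (h.re * u.re + h.im * u.im))) / normSq u ^ 2
      = normSq h / normSq u - 2 * (h.re * u.re + h.im * u.im) ^ 2 / normSq u ^ 2 := by
    field_simp
  rw [h4]
  ring

end LogNonlinearity

/-- Here `F1` is F′ near 0 and `c` is F″(0). One differentiation of the hypothesis gives F′(s) =
F′(−s), a second one gives 2c = 0. -/
theorem second_deriv_eq_zero_of_even {F F1 : ℝ → ℂ} {c : ℂ}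
    (h1 : ∀ᶠ s in 𝓝 (0 : ℝ), HasDerivAt F (F1 s) s) (h2 : HasDerivAt F1 c 0)
    (h : ∀ᶠ s in 𝓝 (0 : ℝ), F s + F (-s) - 2 * F 0 = 0) : c = 0 := by
  have hneg : ∀ᶠ s in 𝓝 (0 : ℝ), HasDerivAt F (F1 (-s)) (-s) := by
    have : Filter.Tendsto (fun s : ℝ => -s) (𝓝 0) (𝓝 0) := by
      simpa using (continuous_neg (G := ℝ)).tendsto 0
    exact this.eventually h1
  have h3 : ∀ᶠ s in 𝓝 (0 : ℝ), F1 s - F1 (-s) = 0 := by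
    filter_upwards [h1, hneg, h.eventually_nhds] with s e1 e2 e3
    have e4 : HasDerivAt (fun s => F s + F (-s) - 2 * F 0) (F1 s - F1 (-s)) s := by
      have := (e1.add (e2.scomp s (hasDerivAt_neg s))).sub_const (2 * F 0)
      simpa [sub_eq_add_neg] using this
    exact e4.unique ((hasDerivAt_const s (0 : ℂ)).congr_of_eventuallyEq e3)
  have h4 : HasDerivAt (fun s => F1 s - F1 (-s)) (c + c) 0 := by
    have e : HasDerivAt F1 c (-0) := by simpa using h2
    have := h2.sub (e.scomp (0 : ℝ) (hasDerivAt_neg (0 : ℝ)))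
    refine this.congr_deriv ?_
    simp
  have h5 := h4.unique ((hasDerivAt_const (0 : ℝ) (0 : ℂ)).congr_of_eventuallyEq h3)
  linear_combination h5 / 2



/-! ### From pointwise conditions to conditions on open sets. -/

section Smooth

variable {E F G : Type*} [NormedAddCommGroup E] [NormedSpace ℝ E] [NormedAddCommGroup F]
  [NormedSpace ℝ F] [NormedAddCommGroup G] [NormedSpace ℝ G] {U : Set E} {f : E → F}

/-- First-order conditions valid at all points of an open set are turned into second-order ones by
differentiation. -/
theorem D2_clm_eq_zero (hU : IsOpen U) (hf : ContDiffOn ℝ ∞ f U) (l : F →L[ℝ] G) (c : E)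
    {k : G} (h : ∀ z ∈ U, l (fderiv ℝ f z c) = k) {z : E} (hz : z ∈ U) (u : E) :
    l (D2 f z u c) = 0 := by
  have hfz := hf.contDiffAt (hU.mem_nhds hz)
  have h1 : HasFDerivAt (fun y => l (fderiv ℝ f y c)) _ z :=
    l.hasFDerivAt.comp z
      ((ContDiffAt.hasFDerivAt_fderiv hfz).clm_apply (hasFDerivAt_const c z))
  have h2 : (fun y => l (fderiv ℝ f y c)) =ᶠ[𝓝 z] fun _ => k := by
    filter_upwards [hU.mem_nhds hz] with y hy using h y hy
  have h3 := h1.unique ((hasFDerivAt_const k z).congr_of_eventuallyEq h2)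
  simpa using DFunLike.congr_fun h3 u

theorem IsDiffeoOn.bijective {f : E → E} (h : IsDiffeoOn f U) {z : E} (hz : z ∈ U) :
    Function.Bijective (fderiv ℝ f z) := by
  obtain ⟨e, he⟩ := h.2.2.2 z hz
  rw [← he]
  exact e.bijective

theorem IsDiffeoOn.contDiffAt {f : E → E} (h : IsDiffeoOn f U) {z : E} (hz : z ∈ U) :
    ContDiffAt ℝ ∞ f z :=
  h.2.1.contDiffAt (h.1.mem_nhds hz)

end Smooth

variable {φ : Vars n → Vars n} {U : Set (Vars n)} {δ δ' : ℂ} {V V' : Base n → ℂ}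

/-- The order matters: the time condition holds pointwise, its derivative over the open set is
needed for conformality and fibre independence, and the latter is differentiated in turn. -/
theorem MapsEquation.reduced (hM : MapsEquation φ U δ V δ' V') (hφ : IsDiffeoOn φ U)
    (hn : 1 ≤ n) {z : Vars n} (hz : z ∈ U) : Reduced (fderiv ℝ φ z) (D2 φ z) := by
  have hJ := fun (z : Vars n) (hz : z ∈ U) => hM.jetTransfer hz (hφ.contDiffAt hz)
  have ht : ∀ z ∈ U, ∀ v w, (fderiv ℝ φ z ((0, v), w)).1.1 = 0 := fun z hz =>
    (hJ z hz).time_spatial hn (hφ.bijective hz)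
  have ht2 : ∀ z ∈ U, ∀ v w v' w', (D2 φ z ((0, v), w) ((0, v'), w')).1.1 = 0 := by
    intro z hz v w v' w'
    exact D2_clm_eq_zero hφ.1 hφ.2.1
      (tC.comp (ContinuousLinearMap.fst ℝ (Base n) ℂ)) ((0, v'), w')
      (fun y hy => ht y hy v' w') hz _
  have hb : ∀ z ∈ U, ∀ w, (fderiv ℝ φ z (0, w)).1 = 0 := fun z hz =>
    (hJ z hz).base_fiber hn (hφ.bijective hz) (ht z hz) (ht2 z hz)
  obtain ⟨k, hk⟩ := exists_slope_bijective (hφ.bijective hz).2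
  obtain ⟨h1, k', h2⟩ := slopeMap_orthogonal (hJ z hz) hn (hφ.bijective hz) (ht z hz)
    (ht2 z hz) hk
  have hA : ∀ v, slopeMap (fderiv ℝ φ z) k v = (fderiv ℝ φ z (v, 0)).1 := by
    intro v
    rw [slopeMap_apply, map_split, Prod.fst_add, hb z hz, add_zero]
  simp only [fiberMap_apply, hb z hz, map_zero, sub_zero] at h2
  simp only [hA] at h1
  exact {
    time := ht z hz
    base := hb z hz
    rate := timeRate_ne_zero (ht z hz) (hφ.bijective hz).2
    orth := h1
    conj := h2
    time2 := ht2 z hz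
    base2 := fun u w => D2_clm_eq_zero hφ.1 hφ.2.1 (ContinuousLinearMap.fst ℝ (Base n) ℂ) (0, w)
      (fun y hy => hb y hy w) hz u
    symm := D2_symm (hφ.contDiffAt hz) }

theorem MapsEquation.determining (hM : MapsEquation φ U δ V δ' V') (hφ : IsDiffeoOn φ U)
    (hn : 1 ≤ n) {z : Vars n} (hz : z ∈ U) :
    Determining (fderiv ℝ φ z) (D2 φ z) (δ * z.2 * (Real.log ‖z.2‖ : ℂ) + V z.1 * z.2)
      (δ' * (φ z).2 * (Real.log ‖(φ z).2‖ : ℂ) + V' (φ z).1 * (φ z).2) :=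
  (hM.reduced hφ hn hz).determining hn
    ((hM.jetTransfer hz (hφ.contDiffAt hz)).defect_eq_zero hn (hφ.bijective hz).2
      (hM.reduced hφ hn hz))

theorem const_on_ball {F : Type*} [NormedAddCommGroup F] [NormedSpace ℝ F] {g : ℂ → F} {w : ℂ}
    {r : ℝ} {g' : ℂ → ℂ →L[ℝ] F} (hd : ∀ y ∈ Metric.ball w r, HasFDerivAt g (g' y) y)
    (h0 : ∀ y ∈ Metric.ball w r, ∀ h, g' y h = 0) {y : ℂ} (hy : y ∈ Metric.ball w r) :
    g y = g w := by
  refine (Metric.isOpen_ball).is_const_of_fderiv_eq_zero (𝕜 := ℝ)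
    (convex_ball w r).isPreconnected
    (fun y hy => (hd y hy).differentiableAt.differentiableWithinAt) (fun y hy => ?_) hy
    (Metric.mem_ball_self (Metric.pos_of_mem_ball hy))
  rw [(hd y hy).fderiv]
  exact ContinuousLinearMap.ext fun h => h0 y hy h

theorem hasFDerivAt_slice {F : Type*} [NormedAddCommGroup F] [NormedSpace ℝ F]
    {g : Vars n → F} {q : Base n} {w : ℂ} (hg : DifferentiableAt ℝ g (q, w)) :
    HasFDerivAt (fun y => g (q, y))
      ((fderiv ℝ g (q, w)).comp (ContinuousLinearMap.inr ℝ (Base n) ℂ)) w :=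
  hg.hasFDerivAt.comp w (hasFDerivAt_prodMk_right q w)

/-- Where the second derivative vanishes along the fibers, a map is affine along the fibers. -/
theorem local_affine {g : Vars n → Vars n} {q : Base n} {w : ℂ} {r : ℝ}
    (hg : ∀ y ∈ Metric.ball w r, ContDiffAt ℝ ∞ g (q, y))
    (h2 : ∀ y ∈ Metric.ball w r, ∀ h k, D2 g (q, y) (0, h) (0, k) = 0) {y : ℂ}
    (hy : y ∈ Metric.ball w r) :
    (∀ h, fderiv ℝ g (q, y) (0, h) = fderiv ℝ g (q, w) (0, h)) ∧
      g (q, y) = g (q, w) + fderiv ℝ g (q, w) (0, y - w) := by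
  have h1 : ∀ h, ∀ y ∈ Metric.ball w r, fderiv ℝ g (q, y) (0, h) = fderiv ℝ g (q, w) (0, h) := by
    intro h y hy
    refine const_on_ball (g := fun y => fderiv ℝ g (q, y) (0, h)) (fun y hy =>
      hasFDerivAt_slice (g := fun z => fderiv ℝ g z (0, h)) (((ContDiffAt.hasFDerivAt_fderiv
        (hg y hy)).clm_apply (hasFDerivAt_const _ _)).differentiableAt)) ?_ hy
    intro y hy k
    rw [ContinuousLinearMap.comp_apply, fderiv_fderiv_apply (hg y hy)]
    exact h2 y hy k h
  refine ⟨fun h => h1 h y hy, ?_⟩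
  set l := (fderiv ℝ g (q, w)).comp (ContinuousLinearMap.inr ℝ (Base n) ℂ) with hl
  have h3 := const_on_ball (g := fun y => g (q, y) - l y) (fun y hy =>
    (hasFDerivAt_slice ((hg y hy).differentiableAt (by simp))).sub l.hasFDerivAt)
    (fun y hy h => by
      have := h1 h y hy
      simp [hl, this]) hy
  have h4 : fderiv ℝ g (q, w) (0, y - w) = l y - l w := by
    rw [← map_sub]; rfl
  rw [h4]
  rw [sub_eq_iff_eq_add] at h3
  rw [h3]; abel

theorem ball_slices (hU : IsOpen U) {q : Base n} {w : ℂ} (hz : (q, w) ∈ U) :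
    ∃ r > 0, ∀ q' ∈ Metric.ball q r, ∀ y ∈ Metric.ball w r, (q', y) ∈ U := by
  obtain ⟨r, hr, hsub⟩ := Metric.mem_nhds_iff.1 (hU.mem_nhds hz)
  refine ⟨r, hr, fun q' hq' y hy => hsub ?_⟩
  rw [← ball_prod_same]
  exact ⟨hq', hy⟩

theorem fderiv_base_slice {q : Base n} {y : ℂ} (h : ContDiffAt ℝ ∞ φ (q, y)) (v : Base n) :
    fderiv ℝ (fun q => φ (q, y)) q v = fderiv ℝ φ (q, y) (v, 0) := by
  have := fderiv_comp_graph (ψ := fun _ => y) h contDiffAt_const v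
  simpa using this

theorem D2_base_slice {q : Base n} {y : ℂ} (h : ContDiffAt ℝ ∞ φ (q, y)) (v : Base n) :
    D2 (fun q => φ (q, y)) q v v = D2 φ (q, y) (v, 0) (v, 0) := by
  have h1 := D2_comp_graph (ψ := fun _ => y) h contDiffAt_const v
  have h2 : D2 (fun _ : Base n => y) q = 0 := by
    simp only [D2, fderiv_fun_const]
    exact fderiv_const_apply _
  rw [h2] at h1
  simpa [← Prod.zero_eq_mk] using h1

theorem contDiffAt_base_slice {q : Base n} {y : ℂ} (h : ContDiffAt ℝ ∞ φ (q, y)) :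
    ContDiffAt ℝ ∞ (fun q => φ (q, y)) q :=
  h.comp q (contDiffAt_id.prodMk contDiffAt_const)

/-- Polarization of the quadratic determining equation. -/
theorem MapsEquation.fiber_second (hM : MapsEquation φ U δ V δ' V') (hφ : IsDiffeoOn φ U)
    (hn : 1 ≤ n) {z : Vars n} (hz : z ∈ U) (h k : ℂ) : D2 φ z (0, h) (0, k) = 0 := by
  have hr := hM.reduced hφ hn hz
  have hd := (hM.determining hφ hn hz).quadratic
  refine Prod.ext (hr.base2 _ _) ?_
  have h1 := hd (h + k)
  have h2 : ((0, h + k) : Vars n) = (0, h) + (0, k) := by simp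
  rw [h2] at h1
  simp only [map_add, add_apply, Prod.snd_add, hd, hr.symm (0, k) (0, h)] at h1
  simp only [Prod.snd_zero]
  linear_combination h1 / 2


/-! ### Second differences along the fibres. -/

section
variable {φ : Vars n → Vars n} {U : Set (Vars n)} {δ δ' : ℂ} {V V' : Base n → ℂ}

theorem D2_add {E F : Type*} [NormedAddCommGroup E] [NormedSpace ℝ E] [NormedAddCommGroup F]
    [NormedSpace ℝ F] {f g : E → F} {p : E} (hf : ContDiffAt ℝ ∞ f p) (hg : ContDiffAt ℝ ∞ g p)
    (u v : E) : D2 (fun q => f q + g q) p u v = D2 f p u v + D2 g p u v := by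
  have h := D2_clm_comp (ContinuousLinearMap.fst ℝ F F + ContinuousLinearMap.snd ℝ F F)
    (hf.prodMk hg) u v
  rw [D2_prodMk hf hg] at h
  simpa using h

/-- The second-difference form of the determining equations along the fibers. -/
theorem MapsEquation.second_difference (hM : MapsEquation φ U δ V δ' V') (hφ : IsDiffeoOn φ U)
    (hn : 1 ≤ n) {q : Base n} {w : ℂ} (hz : (q, w) ∈ U) :
    ∃ r > 0, ∀ h : ℂ, ‖h‖ < r → (q, w + h) ∈ U ∧
      (φ (q, w + h)).2 = (φ (q, w)).2 + (fderiv ℝ φ (q, w) (0, h)).2 ∧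
      timeRate (fderiv ℝ φ (q, w + h)) = timeRate (fderiv ℝ φ (q, w)) ∧
      (∀ k, fderiv ℝ φ (q, w + h) (0, k) = fderiv ℝ φ (q, w) (0, k)) ∧
      (fderiv ℝ φ (q, w) (0, δ * ((w + h) * (Real.log ‖w + h‖ : ℂ)
          + (w - h) * (Real.log ‖w - h‖ : ℂ) - 2 * (w * (Real.log ‖w‖ : ℂ))))).2
        = (|timeRate (fderiv ℝ φ (q, w))| : ℝ) * (δ' *
          (((φ (q, w)).2 + (fderiv ℝ φ (q, w) (0, h)).2)
              * (Real.log ‖(φ (q, w)).2 + (fderiv ℝ φ (q, w) (0, h)).2‖ : ℂ)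
            + ((φ (q, w)).2 - (fderiv ℝ φ (q, w) (0, h)).2)
              * (Real.log ‖(φ (q, w)).2 - (fderiv ℝ φ (q, w) (0, h)).2‖ : ℂ)
            - 2 * ((φ (q, w)).2 * (Real.log ‖(φ (q, w)).2‖ : ℂ)))) := by
  obtain ⟨r, hr, hsub⟩ := ball_slices hφ.1 hz
  refine ⟨r, hr, fun h hh => ?_⟩
  have hp : w + h ∈ Metric.ball w r := by simpa using hh
  have hm : w - h ∈ Metric.ball w r := by simpa using hh
  have h0 : w ∈ Metric.ball w r := Metric.mem_ball_self hr
  have hqr : Metric.ball q r ∈ 𝓝 q := Metric.ball_mem_nhds q hr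
  have hq : q ∈ Metric.ball q r := Metric.mem_ball_self hr
  have haff : ∀ q' ∈ Metric.ball q r, ∀ y ∈ Metric.ball w r,
      (∀ h, fderiv ℝ φ (q', y) (0, h) = fderiv ℝ φ (q', w) (0, h)) ∧
      φ (q', y) = φ (q', w) + fderiv ℝ φ (q', w) (0, y - w) := by
    intro q' hq' y hy
    exact local_affine (fun y hy => hφ.contDiffAt (hsub q' hq' y hy))
      (fun y hy => hM.fiber_second hφ hn (hsub q' hq' y hy)) hy
  have hcp := hφ.contDiffAt (hsub q hq _ hp)
  have hcm := hφ.contDiffAt (hsub q hq _ hm)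
  have hc := hφ.contDiffAt hz
  -- The identity is needed for all `q'` near `q`, not only at `q`, so that it may be differentiated
  -- twice in the base variables; likewise for `hsum`.
  have hbase : ∀ y ∈ Metric.ball w r,
      (fun q' => (φ (q', y)).1) =ᶠ[𝓝 q] fun q' => (φ (q', w)).1 := by
    intro y hy
    filter_upwards [hqr] with q' hq'
    rw [(haff q' hq' y hy).2, Prod.fst_add, (hM.reduced hφ hn (hsub q' hq' w h0)).base, add_zero]
  have hsum : (fun q' => φ (q', w + h) + φ (q', w - h)) =ᶠ[𝓝 q]
      fun q' => φ (q', w) + φ (q', w) := by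
    filter_upwards [hqr] with q' hq'
    rw [(haff q' hq' _ hp).2, (haff q' hq' _ hm).2]
    have : ((0, w - h - w) : Vars n) = -(0, w + h - w) := by simp
    rw [this, map_neg]
    abel
  have hL1 : ∀ y ∈ Metric.ball w r, ∀ v,
      (fderiv ℝ φ (q, y) (v, 0)).1 = (fderiv ℝ φ (q, w) (v, 0)).1 := by
    intro y hy v
    have hcy := hφ.contDiffAt (hsub q hq y hy)
    have e := (hbase y hy).fderiv_eq (𝕜 := ℝ)
    rw [((contDiffAt_base_slice hcy).differentiableAt (by simp)).hasFDerivAt.fst.fderiv,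
      ((contDiffAt_base_slice hc).differentiableAt (by simp)).hasFDerivAt.fst.fderiv] at e
    have e' := DFunLike.congr_fun e v
    simp only [ContinuousLinearMap.comp_apply, ContinuousLinearMap.coe_fst'] at e'
    rwa [fderiv_base_slice hcy, fderiv_base_slice hc] at e'
  have hQ1 : ∀ y ∈ Metric.ball w r, ∀ v,
      (D2 φ (q, y) (v, 0) (v, 0)).1 = (D2 φ (q, w) (v, 0) (v, 0)).1 := by
    intro y hy v
    have hcy := hφ.contDiffAt (hsub q hq y hy)
    have e := DFunLike.congr_fun (DFunLike.congr_fun (D2_congr (hbase y hy)) v) v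
    have e1 := D2_clm_comp (ContinuousLinearMap.fst ℝ (Base n) ℂ) (contDiffAt_base_slice hcy) v v
    have e2 := D2_clm_comp (ContinuousLinearMap.fst ℝ (Base n) ℂ) (contDiffAt_base_slice hc) v v
    simp only [ContinuousLinearMap.coe_fst'] at e1 e2
    rwa [e1, e2, D2_base_slice hcy, D2_base_slice hc] at e
  have hL2 : ∀ v, fderiv ℝ φ (q, w + h) (v, 0) + fderiv ℝ φ (q, w - h) (v, 0)
      = fderiv ℝ φ (q, w) (v, 0) + fderiv ℝ φ (q, w) (v, 0) := by
    intro v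
    have d1 := (contDiffAt_base_slice hcp).differentiableAt (n := ∞) (by simp)
    have d2 := (contDiffAt_base_slice hcm).differentiableAt (n := ∞) (by simp)
    have d3 := (contDiffAt_base_slice hc).differentiableAt (n := ∞) (by simp)
    have e := hsum.fderiv_eq (𝕜 := ℝ)
    rw [fderiv_fun_add d1 d2, fderiv_fun_add d3 d3] at e
    have e' := DFunLike.congr_fun e v
    simpa only [add_apply, fderiv_base_slice hcp, fderiv_base_slice hcm,
      fderiv_base_slice hc] using e'
  have hQ2 : ∀ v, D2 φ (q, w + h) (v, 0) (v, 0) + D2 φ (q, w - h) (v, 0) (v, 0)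
      = D2 φ (q, w) (v, 0) (v, 0) + D2 φ (q, w) (v, 0) (v, 0) := by
    intro v
    have e := DFunLike.congr_fun (DFunLike.congr_fun (D2_congr hsum) v) v
    rwa [D2_add (contDiffAt_base_slice hcp) (contDiffAt_base_slice hcm),
      D2_add (contDiffAt_base_slice hc) (contDiffAt_base_slice hc), D2_base_slice hcp,
      D2_base_slice hcm, D2_base_slice hc] at e
  have hrate : ∀ y ∈ Metric.ball w r,
      timeRate (fderiv ℝ φ (q, y)) = timeRate (fderiv ℝ φ (q, w)) := by
    intro y hy
    simp only [timeRate, hL1 y hy]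
  have hdrift : ∀ y ∈ Metric.ball w r, ∀ a, drift (fderiv ℝ φ (q, y)) (D2 φ (q, y)) a
      = drift (fderiv ℝ φ (q, w)) (D2 φ (q, w)) a := by
    intro y hy a
    simp only [drift, hrate y hy, hL1 y hy, Prod.fst_sum, hQ1 y hy]
  have hP : ∀ y ∈ Metric.ball w r,
      (φ (q, y)).2 = (φ (q, w)).2 + (fderiv ℝ φ (q, w) (0, y - w)).2 := by
    intro y hy
    rw [(haff q hq y hy).2, Prod.snd_add]
  have hPp : (φ (q, w + h)).2 = (φ (q, w)).2 + (fderiv ℝ φ (q, w) (0, h)).2 := by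
    rw [hP _ hp]; simp
  have hPm : (φ (q, w - h)).2 = (φ (q, w)).2 - (fderiv ℝ φ (q, w) (0, h)).2 := by
    rw [hP _ hm]
    have : ((0, w - h - w) : Vars n) = -(0, h) := by simp
    rw [this, map_neg, Prod.snd_neg]; ring
  refine ⟨hsub q hq _ hp, hPp, hrate _ hp, (haff q hq _ hp).1, ?_⟩
  -- The free determining equation at `w + h`, `w - h` and `w`. All three points share the base
  -- image, so V and V' enter linearly and cancel in the second difference, as do the time and space
  -- derivatives, which are affine along the fibre.
  have ep := (hM.determining hφ hn (hsub q hq _ hp)).free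
  have em := (hM.determining hφ hn (hsub q hq _ hm)).free
  have e0 := (hM.determining hφ hn hz).free
  have hbp := (hbase _ hp).self_of_nhds
  have hbm := (hbase _ hm).self_of_nhds
  simp only at hbp hbm
  have hz0 : ((0, 0) : Vars n) = 0 := rfl
  simp only [defect, hrate _ hp, hrate _ hm, hdrift _ hp, hdrift _ hm, Pi.zero_apply,
    (haff q hq _ hp).1, (haff q hq _ hm).1, hbp, hbm, hPp, hPm, hz0, map_zero, Prod.snd_zero,
    add_zero] at ep em e0
  have hsL : ∀ v, (fderiv ℝ φ (q, w + h) (v, 0)).2 = 2 * (fderiv ℝ φ (q, w) (v, 0)).2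
      - (fderiv ℝ φ (q, w - h) (v, 0)).2 := by
    intro v
    have := congrArg Prod.snd (hL2 v)
    simp only [Prod.snd_add] at this
    linear_combination this
  have hsQ : ∀ v, (D2 φ (q, w + h) (v, 0) (v, 0)).2 = 2 * (D2 φ (q, w) (v, 0) (v, 0)).2
      - (D2 φ (q, w - h) (v, 0) (v, 0)).2 := by
    intro v
    have := congrArg Prod.snd (hQ2 v)
    simp only [Prod.snd_add] at this
    linear_combination this
  have hlin : ∀ x y z : ℂ, (fderiv ℝ φ (q, w) (0, x + y - 2 * z)).2
      = (fderiv ℝ φ (q, w) (0, x)).2 + (fderiv ℝ φ (q, w) (0, y)).2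
        - 2 * (fderiv ℝ φ (q, w) (0, z)).2 := by
    intro x y z
    have : ((0, x + y - 2 * z) : Vars n) = (0, x) + (0, y) - (2 : ℝ) • (0, z) := by simp
    rw [this, map_sub, map_add, map_smul]
    simp
  have hF := hlin (δ * (w + h) * (Real.log ‖w + h‖ : ℂ) + V q * (w + h))
    (δ * (w - h) * (Real.log ‖w - h‖ : ℂ) + V q * (w - h))
    (δ * w * (Real.log ‖w‖ : ℂ) + V q * w)
  have hF' : δ * ((w + h) * (Real.log ‖w + h‖ : ℂ)
          + (w - h) * (Real.log ‖w - h‖ : ℂ) - 2 * (w * (Real.log ‖w‖ : ℂ)))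
      = δ * (w + h) * (Real.log ‖w + h‖ : ℂ) + V q * (w + h)
        + (δ * (w - h) * (Real.log ‖w - h‖ : ℂ) + V q * (w - h))
        - 2 * (δ * w * (Real.log ‖w‖ : ℂ) + V q * w) := by ring
  rw [hF', hF]
  simp only [hsL, hsQ, mul_sub, Finset.sum_sub_distrib] at ep
  simp only [← Finset.mul_sum, mul_left_comm _ (2 : ℂ)] at ep
  linear_combination 2 * e0 - ep - em


end

/-! ### Homogeneity in the dependent variable and the rescaling of δ. -/

section
variable {φ : Vars n → Vars n} {U : Set (Vars n)} {δ δ' : ℂ} {V V' : Base n → ℂ}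
variable {L : Vars n →L[ℝ] Vars n} {Q : Vars n →L[ℝ] Vars n →L[ℝ] Vars n}

theorem hat_mul (s : ℝ) (x y : ℂ) : hat s (x * y) = hat s x * hat s y := by
  unfold hat; split_ifs <;> simp

theorem hat_add (s : ℝ) (x y : ℂ) : hat s (x + y) = hat s x + hat s y := by
  unfold hat; split_ifs <;> simp

theorem hat_ofReal (s r : ℝ) : hat s (r : ℂ) = r := by
  unfold hat; split_ifs <;> simp

@[simp] theorem hat_zero (s : ℝ) : hat s 0 = 0 := by
  unfold hat; split_ifs <;> simp

theorem hat_hat (s : ℝ) (x : ℂ) : hat s (hat s x) = x := by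
  unfold hat; split_ifs <;> simp

theorem hat_conj (s : ℝ) (x : ℂ) : hat s (starRingEnd ℂ x) = starRingEnd ℂ (hat s x) := by
  unfold hat; split_ifs <;> simp

theorem norm_hat (s : ℝ) (x : ℂ) : ‖hat s x‖ = ‖x‖ := by
  unfold hat; split_ifs <;> simp

theorem hat_ne_zero {s : ℝ} {x : ℂ} (hx : x ≠ 0) : hat s x ≠ 0 := by
  rw [← norm_ne_zero_iff, norm_hat]; exact norm_ne_zero_iff.2 hx

theorem hat_I {s : ℝ} (hs : s ≠ 0) :
    hat s Complex.I = (SignType.sign s : ℝ) * Complex.I := by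
  unfold hat
  rcases lt_or_gt_of_ne hs with h | h
  · simp [h.le.not_gt, sign_neg h]
  · simp [h, sign_pos h]

/-- `hat s` as a real-linear isometry. -/
def hatL (s : ℝ) : ℂ →L[ℝ] ℂ :=
  if 0 < s then ContinuousLinearMap.id ℝ ℂ else (Complex.conjCLE : ℂ →L[ℝ] ℂ)

@[simp] theorem hatL_apply (s : ℝ) (x : ℂ) : hatL s x = hat s x := by
  unfold hatL hat; split_ifs <;> simp

/-- A real-linear map that commutes with i up to the sign of the time rate is multiplication by its
value at 1, preceded by conjugation when the rate is negative. -/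
theorem Reduced.fiber_apply (h : Reduced L Q) (c : ℂ) :
    (L (0, c)).2 = (L (0, 1)).2 * hat (timeRate L) c := by
  have h1 : ((0, c) : Vars n) = c.re • (0, 1) + c.im • (0, Complex.I * 1) := by
    refine Prod.ext ?_ ?_
    · simp
    · simp only [Prod.snd_add, Prod.smul_snd, Complex.real_smul, mul_one]
      exact (Complex.re_add_im c).symm
  have h2 : hat (timeRate L) c = c.re + c.im * ((SignType.sign (timeRate L) : ℝ) * Complex.I) := by
    conv_lhs => rw [← Complex.re_add_im c]
    rw [hat_add, hat_mul, hat_ofReal, hat_ofReal, hat_I h.rate]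
  rw [h1, map_add, map_smul, map_smul, Prod.snd_add, Prod.smul_snd, Prod.smul_snd, h.conj, h2,
    Complex.real_smul, Complex.real_smul]
  ring

theorem Reduced.fiber_ne_zero (h : Reduced L Q) (hL : Function.Injective L) {c : ℂ}
    (hc : c ≠ 0) : (L (0, c)).2 ≠ 0 := by
  intro h0
  have h1 : L (0, c) = 0 := Prod.ext (h.base c) h0
  have h2 := (injective_iff_map_eq_zero L).1 hL _ h1
  exact hc (congrArg Prod.snd h2)

/-- The second-difference identity is taken for increments sh and differentiated twice in s at 0. -/
theorem MapsEquation.log_second (hM : MapsEquation φ U δ V δ' V')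
    (hφ : IsPointTransformation φ U) (hn : 1 ≤ n) {q : Base n} {w : ℂ} (hz : (q, w) ∈ U)
    (h : ℂ) :
    (fderiv ℝ φ (q, w) (0, δ * logSecond w h)).2
      = (|timeRate (fderiv ℝ φ (q, w))| : ℝ) * (δ' * logSecond (φ (q, w)).2
        (fderiv ℝ φ (q, w) (0, h)).2) := by
  set L := fderiv ℝ φ (q, w) with hL
  set Ψ := (φ (q, w)).2 with hΨ
  have hw : w ≠ 0 := hφ.2.1 hz
  have hΨ0 : Ψ ≠ 0 := hφ.2.2 hz
  obtain ⟨r, hr, hsd⟩ := hM.second_difference hφ.1 hn hz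
  set l : ℂ →L[ℝ] ℂ := (ContinuousLinearMap.snd ℝ (Base n) ℂ).comp
    (L.comp ((ContinuousLinearMap.inr ℝ (Base n) ℂ).comp
      (ContinuousLinearMap.mul ℝ ℂ δ))) with hl
  have hla : ∀ x, l x = (L (0, δ * x)).2 := fun x => rfl
  set m := (L (0, h)).2 with hm
  set c : ℂ := (|timeRate L| : ℝ) * δ' with hc
  have hms : ∀ s : ℝ, (L (0, (s : ℂ) * h)).2 = s * m := by
    intro s
    have : ((0, (s : ℂ) * h) : Vars n) = s • (0, h) := by simp
    rw [this, map_smul]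
    simp [hm]
  have hev : ∀ u k : ℂ, u ≠ 0 → ∀ᶠ s : ℝ in 𝓝 0, u + s * k ≠ 0 := by
    intro u k hu
    have : ContinuousAt (fun s : ℝ => u + s * k) 0 := by fun_prop
    exact this.eventually_ne (by simpa using hu)
  have hsm : ∀ᶠ s : ℝ in 𝓝 0, ‖(s : ℂ) * h‖ < r := by
    have : ContinuousAt (fun s : ℝ => ‖(s : ℂ) * h‖) 0 := by fun_prop
    exact this.eventually_lt continuousAt_const (by simpa using hr)
  have key := second_deriv_eq_zero_of_even
    (F := fun s : ℝ => l ((w + s * h) * (Real.log ‖w + s * h‖ : ℂ))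
      - c * ((Ψ + s * m) * (Real.log ‖Ψ + s * m‖ : ℂ)))
    (F1 := fun s : ℝ => l (h * (Real.log ‖w + s * h‖ : ℂ) + (w + s * h)
        * ((h.re * (w + s * h).re + h.im * (w + s * h).im) / Complex.normSq (w + s * h) : ℝ))
      - c * (m * (Real.log ‖Ψ + s * m‖ : ℂ) + (Ψ + s * m)
        * ((m.re * (Ψ + s * m).re + m.im * (Ψ + s * m).im) / Complex.normSq (Ψ + s * m) : ℝ)))
    (c := l (logSecond w h) - c * logSecond Ψ m) (by
      filter_upwards [hev w h hw, hev Ψ m hΨ0] with s e1 e2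
      exact (l.hasFDerivAt.comp_hasDerivAt s (hasDerivAt_mul_log w h e1)).sub
        ((hasDerivAt_mul_log Ψ m e2).const_mul c))
    ((l.hasFDerivAt.comp_hasDerivAt (0 : ℝ) (hasDerivAt_mul_log_snd w h hw)).sub
      ((hasDerivAt_mul_log_snd Ψ m hΨ0).const_mul c)) (by
      filter_upwards [hsm] with s hs
      have e := (hsd _ hs).2.2.2.2
      rw [hms, ← hla] at e
      have e1 : ∀ x y z : ℂ, l (x + y - 2 * z) = l x + l y - 2 * l z := by
        intro x y z
        have : 2 * z = (2 : ℝ) • z := by simp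
        rw [this, map_sub, map_add, map_smul]
        simp
      rw [e1] at e
      simp only [Complex.ofReal_neg, neg_mul, ← sub_eq_add_neg, Complex.ofReal_zero, zero_mul,
        add_zero]
      rw [hc]
      linear_combination e)
  rw [hla] at key
  rw [sub_eq_zero.1 key, hc]
  ring

/-- Adding `MapsEquation.log_second` over two orthogonal directions turns second derivatives of the
logarithmic terms into Laplacians, hence into 2/w̄ and 2|m|²/Ψ̄, where m is the fibre derivative at
1; the common factor m is then cancelled and the result conjugated. -/
theorem MapsEquation.log_relation (hM : MapsEquation φ U δ V δ' V')
    (hφ : IsPointTransformation φ U) (hn : 1 ≤ n) {q : Base n} {w : ℂ} (hz : (q, w) ∈ U) :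
    (φ (q, w)).2 * starRingEnd ℂ (hat (timeRate (fderiv ℝ φ (q, w))) δ)
      = (|timeRate (fderiv ℝ φ (q, w))| : ℝ) * starRingEnd ℂ δ'
        * (fderiv ℝ φ (q, w) (0, w)).2 := by
  have hr := hM.reduced hφ.1 hn hz
  have hw : w ≠ 0 := hφ.2.1 hz
  have hΨ0 : (φ (q, w)).2 ≠ 0 := hφ.2.2 hz
  have h1 := hM.log_second hφ hn hz 1
  have h2 := hM.log_second hφ hn hz (((1 : ℝ) : ℂ) * (Complex.I * 1))
  set L := fderiv ℝ φ (q, w) with hL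
  set Ψ := (φ (q, w)).2 with hΨ
  have hm0 : (L (0, 1)).2 ≠ 0 := hr.fiber_ne_zero (hφ.1.bijective hz).1 one_ne_zero
  set m := (L (0, 1)).2 with hm
  set θ := timeRate L with hθ
  have hε : (SignType.sign θ : ℝ) ^ 2 = 1 := by
    rcases lt_or_gt_of_ne hr.rate with h | h
    · rw [hθ, sign_neg h]; simp
    · rw [hθ, sign_pos h]; simp
  have e1 := logSecond_add w 1 hw 1 (by norm_num)
  have e2 := logSecond_add Ψ m hΨ0 _ hε
  have e3 : (L (0, ((1 : ℝ) : ℂ) * (Complex.I * 1))).2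
      = (SignType.sign θ : ℝ) * (Complex.I * m) := by
    rw [Complex.ofReal_one, one_mul, hr.conj]
  rw [e3] at h2
  rw [hr.fiber_apply] at h1 h2
  have e4 : m * (hat θ δ * hat θ (starRingEnd ℂ w
      * (logSecond w 1 + logSecond w (((1 : ℝ) : ℂ) * (Complex.I * 1)))))
      * starRingEnd ℂ Ψ
      = (|θ| : ℝ) * δ' * (starRingEnd ℂ Ψ * (logSecond Ψ m
        + logSecond Ψ ((SignType.sign θ : ℝ) * (Complex.I * m)))) * hat θ (starRingEnd ℂ w) := by
    rw [hat_mul θ (starRingEnd ℂ w), hat_add]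
    rw [hat_mul] at h1 h2
    linear_combination (h1 + h2) * (hat θ (starRingEnd ℂ w) * starRingEnd ℂ Ψ)
  rw [e1, e2, hat_conj, ← Complex.mul_conj m] at e4
  have e5 : hat θ (2 * (Complex.normSq 1 : ℂ)) = 2 := by
    have : (2 * (Complex.normSq 1 : ℂ)) = ((2 : ℝ) : ℂ) := by simp
    rw [this, hat_ofReal]; simp
  rw [e5] at e4
  have e6 : hat θ δ * starRingEnd ℂ Ψ
      = (|θ| : ℝ) * δ' * starRingEnd ℂ (m * hat θ w) := by
    apply mul_left_cancel₀ hm0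
    rw [map_mul]
    linear_combination e4 / 2
  have e7 := congrArg (starRingEnd ℂ) e6
  rw [hr.fiber_apply w, ← hm, ← hθ]
  simp only [map_mul, Complex.conj_conj, Complex.conj_ofReal] at e7
  linear_combination e7

/-- The transformed dependent variable is homogeneous and the nonlinearity coefficient is
rescaled. -/
theorem MapsEquation.homogeneous (hM : MapsEquation φ U δ V δ' V')
    (hφ : IsPointTransformation φ U) (hn : 1 ≤ n) (hδ : δ ≠ 0) {z : Vars n} (hz : z ∈ U) :
    (φ z).2 = (fderiv ℝ φ z (0, z.2)).2 ∧
      hat (timeRate (fderiv ℝ φ z)) δ = (|timeRate (fderiv ℝ φ z)| : ℝ) * δ' := by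
  obtain ⟨q, w⟩ := z
  have hr := hM.reduced hφ.1 hn hz
  have h0 := hM.log_relation hφ hn hz
  -- The relation is compared at two points of one fibre. Subtraction removes the constant part of
  -- the affine map and yields the law for δ; substituting that law back shows that the constant
  -- part is zero.
  obtain ⟨r, hr0, hsd⟩ := hM.second_difference hφ.1 hn hz
  have hh : ‖((r / 2 : ℝ) : ℂ)‖ < r := by
    rw [Complex.norm_real, Real.norm_eq_abs, abs_of_pos (by positivity)]; linarith
  obtain ⟨hz1, hP, ht, hL, -⟩ := hsd _ hh
  set h : ℂ := ((r / 2 : ℝ) : ℂ) with hhd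
  have hne : h ≠ 0 := by
    rw [hhd]; exact_mod_cast (by positivity : r / 2 ≠ 0)
  have h1 := hM.log_relation hφ hn hz1
  rw [hP, ht, hL] at h1
  have h2 : (fderiv ℝ φ (q, w) (0, w + h)).2
      = (fderiv ℝ φ (q, w) (0, w)).2 + (fderiv ℝ φ (q, w) (0, h)).2 := by
    have : ((0, w + h) : Vars n) = (0, w) + (0, h) := by simp
    rw [this, map_add, Prod.snd_add]
  rw [h2] at h1
  have hm := hr.fiber_ne_zero (hφ.1.bijective hz).1 hne
  have h3 : starRingEnd ℂ (hat (timeRate (fderiv ℝ φ (q, w))) δ)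
      = (|timeRate (fderiv ℝ φ (q, w))| : ℝ) * starRingEnd ℂ δ' := by
    apply mul_left_cancel₀ hm
    linear_combination h1 - h0
  have hd0 : starRingEnd ℂ (hat (timeRate (fderiv ℝ φ (q, w))) δ) ≠ 0 := by
    simpa using hat_ne_zero hδ
  constructor
  · rw [← h3] at h0
    apply mul_right_cancel₀ hd0
    rw [h0]; ring
  · have := congrArg (starRingEnd ℂ) h3
    simpa using this


end

/-! ### Rigidity of the Jacobian. -/

section
variable {φ : Vars n → Vars n} {U : Set (Vars n)} {δ δ' : ℂ} {V V' : Base n → ℂ}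
variable {L : Vars n →L[ℝ] Vars n} {Q : Vars n →L[ℝ] Vars n →L[ℝ] Vars n}

theorem Reduced.eq_zero_of_orthogonal (h : Reduced L Q) {y : Fin n → ℝ}
    (hy : ∀ c, ∑ b, y b * (L (ex c, 0)).1.2 b = 0) : y = 0 := by
  ext d
  have h1 : ∑ b, y b * ∑ c, (L (ex c, 0)).1.2 b * (L (ex c, 0)).1.2 d = 0 := by
    simp only [Finset.mul_sum]
    rw [Finset.sum_comm]
    refine Finset.sum_eq_zero fun c _ => ?_
    have : ∀ b, y b * ((L (ex c, 0)).1.2 b * (L (ex c, 0)).1.2 d)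
        = y b * (L (ex c, 0)).1.2 b * (L (ex c, 0)).1.2 d := fun b => by ring
    simp only [this, ← Finset.sum_mul, hy, zero_mul]
  simp only [h.orth] at h1
  have h2 := abs_ne_zero.2 h.rate
  simpa [h.rate] using h1

/-- A one-sided inverse of a square matrix is two-sided, so orthogonality of the columns passes to
the rows. -/
theorem Reduced.orth_rows (h : Reduced L Q) (a c : Fin n) :
    ∑ b, (L (ex a, 0)).1.2 b * (L (ex c, 0)).1.2 b = if a = c then |timeRate L| else 0 := by
  set B : Matrix (Fin n) (Fin n) ℝ :=
    Matrix.of fun a b => (L (ex a, 0)).1.2 b with hB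
  have hρ := abs_ne_zero.2 h.rate
  have h1 : ((|timeRate L|)⁻¹ • B.transpose) * B = 1 := by
    ext b c
    rw [Matrix.smul_mul, Matrix.smul_apply, Matrix.mul_apply]
    have := h.orth b c
    simp only [Matrix.transpose_apply, hB, Matrix.of_apply, this, smul_eq_mul, Matrix.one_apply]
    split_ifs <;> simp [h.rate]
  have h2 := mul_eq_one_comm.1 h1
  have h3 := congrFun (congrFun h2 a) c
  rw [Matrix.mul_smul, Matrix.smul_apply, Matrix.mul_apply] at h3
  simp only [Matrix.transpose_apply, hB, Matrix.of_apply, smul_eq_mul, Matrix.one_apply] at h3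
  rw [inv_mul_eq_iff_eq_mul₀ hρ] at h3
  rw [h3]
  split_ifs <;> simp

theorem hasFDerivAt_fderiv_coord {z : Vars n} (h : ContDiffAt ℝ ∞ φ z) (c : Vars n) (b : Fin n) :
    HasFDerivAt (fun y => (fderiv ℝ φ y c).1.2 b)
      ((xC b).comp ((ContinuousLinearMap.fst ℝ (Base n) ℂ).comp ((D2 φ z).flip c))) z := by
  have h1 := (ContDiffAt.hasFDerivAt_fderiv h).clm_apply (hasFDerivAt_const c z)
  have h2 := ((xC b).comp (ContinuousLinearMap.fst ℝ (Base n) ℂ)).hasFDerivAt.comp z h1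
  refine h2.congr_fderiv ?_
  refine ContinuousLinearMap.ext fun u => ?_
  simp

theorem hasFDerivAt_fderiv_snd {z : Vars n} (h : ContDiffAt ℝ ∞ φ z) (c : Vars n) :
    HasFDerivAt (fun y => (fderiv ℝ φ y c).2)
      ((ContinuousLinearMap.snd ℝ (Base n) ℂ).comp ((D2 φ z).flip c)) z := by
  have h1 := (ContDiffAt.hasFDerivAt_fderiv h).clm_apply (hasFDerivAt_const c z)
  have h2 := (ContinuousLinearMap.snd ℝ (Base n) ℂ).hasFDerivAt.comp z h1
  refine h2.congr_fderiv ?_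
  refine ContinuousLinearMap.ext fun u => ?_
  simp

/-- Moduli in δ̂ = |T_t| δ'. The right-hand side does not depend on the point, and this forces T_tt
= 0. -/
theorem MapsEquation.abs_rate (hM : MapsEquation φ U δ V δ' V')
    (hφ : IsPointTransformation φ U) (hn : 1 ≤ n) (hδ : δ ≠ 0) (hδ' : δ' ≠ 0) {z : Vars n}
    (hz : z ∈ U) : |timeRate (fderiv ℝ φ z)| = ‖δ‖ / ‖δ'‖ := by
  have h := congrArg norm (hM.homogeneous hφ hn hδ hz).2
  rw [norm_hat, norm_mul, Complex.norm_real, Real.norm_eq_abs, abs_abs] at h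
  rw [h, mul_div_cancel_right₀]
  simpa using hδ'

theorem MapsEquation.rate_deriv (hM : MapsEquation φ U δ V δ' V')
    (hφ : IsPointTransformation φ U) (hn : 1 ≤ n) (hδ : δ ≠ 0) (hδ' : δ' ≠ 0) {z : Vars n}
    (hz : z ∈ U) (u : Vars n) : (D2 φ z u (et, 0)).1.1 = 0 := by
  have hd : HasFDerivAt (fun y => timeRate (fderiv ℝ φ y))
      (tC.comp ((ContinuousLinearMap.fst ℝ (Base n) ℂ).comp ((D2 φ z).flip (et, 0)))) z := by
    have h1 := (ContDiffAt.hasFDerivAt_fderiv (hφ.1.contDiffAt hz)).clm_apply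
      (hasFDerivAt_const ((et, 0) : Vars n) z)
    refine ((tC.comp (ContinuousLinearMap.fst ℝ (Base n) ℂ)).hasFDerivAt.comp z h1).congr_fderiv ?_
    exact ContinuousLinearMap.ext fun u => by simp
  have h2 := hd.mul hd
  have h3 : ((fun y => timeRate (fderiv ℝ φ y)) * fun y => timeRate (fderiv ℝ φ y))
      =ᶠ[𝓝 z] fun _ => (‖δ‖ / ‖δ'‖) ^ 2 := by
    filter_upwards [hφ.1.1.mem_nhds hz] with y hy
    rw [← hM.abs_rate hφ hn hδ hδ' hy, sq_abs, Pi.mul_apply, sq]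
  have h4 := h2.unique ((hasFDerivAt_const _ z).congr_of_eventuallyEq h3)
  have h5 := DFunLike.congr_fun h4 u
  simp only [add_apply, smul_apply, ContinuousLinearMap.comp_apply, tC_apply,
    ContinuousLinearMap.coe_fst', ContinuousLinearMap.flip_apply, smul_eq_mul,
    zero_apply] at h5
  have h6 := (hM.reduced hφ.1 hn hz).rate
  have h7 : timeRate (fderiv ℝ φ z) * (D2 φ z u (et, 0)).1.1 = 0 := by linarith
  exact (mul_eq_zero.1 h7).resolve_left h6

/-- Antisymmetry of the derivative of the scaled orthogonal Jacobian. -/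
theorem MapsEquation.antisymm (hM : MapsEquation φ U δ V δ' V')
    (hφ : IsPointTransformation φ U) (hn : 1 ≤ n) (hδ : δ ≠ 0) (hδ' : δ' ≠ 0) {z : Vars n}
    (hz : z ∈ U) (u : Vars n) (a c : Fin n) :
    ∑ b, (D2 φ z u (ex a, 0)).1.2 b * (fderiv ℝ φ z (ex c, 0)).1.2 b
      = - ∑ b, (D2 φ z u (ex c, 0)).1.2 b * (fderiv ℝ φ z (ex a, 0)).1.2 b := by
  have hcd := hφ.1.contDiffAt hz
  have h1 := HasFDerivAt.fun_sum (u := Finset.univ) fun b _ =>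
    (hasFDerivAt_fderiv_coord hcd (ex a, 0) b).mul (hasFDerivAt_fderiv_coord hcd (ex c, 0) b)
  have h2 : (fun y => ∑ b, ((fun y => (fderiv ℝ φ y (ex a, 0)).1.2 b) *
      fun y => (fderiv ℝ φ y (ex c, 0)).1.2 b) y)
      =ᶠ[𝓝 z] fun _ => if a = c then ‖δ‖ / ‖δ'‖ else 0 := by
    filter_upwards [hφ.1.1.mem_nhds hz] with y hy
    have := (hM.reduced hφ.1 hn hy).orth_rows a c
    rw [hM.abs_rate hφ hn hδ hδ' hy] at this
    exact this
  have h3 := h1.unique ((hasFDerivAt_const _ z).congr_of_eventuallyEq h2)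
  have h4 := DFunLike.congr_fun h3 u
  simp only [sum_apply, add_apply, smul_apply, ContinuousLinearMap.comp_apply, xC_apply,
    ContinuousLinearMap.coe_fst', ContinuousLinearMap.flip_apply, smul_eq_mul,
    zero_apply, Finset.sum_add_distrib] at h4
  rw [eq_neg_iff_add_eq_zero, ← h4, add_comm]
  congr 1
  all_goals exact Finset.sum_congr rfl fun b _ => by ring

/-- The argument used for the uniqueness of a metric torsion-free connection: Σ_b ∂_u B_ab B_cb is
antisymmetric in (a, c) and symmetric in (u, a), hence zero. -/
theorem MapsEquation.spatial_second (hM : MapsEquation φ U δ V δ' V')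
    (hφ : IsPointTransformation φ U) (hn : 1 ≤ n) (hδ : δ ≠ 0) (hδ' : δ' ≠ 0) {z : Vars n}
    (hz : z ∈ U) (a b : Fin n) : (D2 φ z (ex a, 0) (ex b, 0)).1 = 0 := by
  have hr := hM.reduced hφ.1 hn hz
  refine Prod.ext (hr.time2 _ _ _ _) (hr.eq_zero_of_orthogonal fun c => ?_)
  have has := fun u a c => hM.antisymm hφ hn hδ hδ' hz u a c
  have e1 := has (ex a, 0) b c
  have e2 := has (ex c, 0) a b
  have e3 := has (ex b, 0) c a
  rw [hr.symm (ex a, 0) (ex c, 0)] at e1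
  rw [hr.symm (ex c, 0) (ex b, 0)] at e2
  rw [hr.symm (ex b, 0) (ex a, 0)] at e3
  linarith

/-- By homogeneity the new ψ is its own fibre derivative along ψ, so the linear determining equation
reads 2Ψ_a = drift_a Ψ. With vanishing second x-derivatives only the t-derivative of the new x
contributes to the drift. -/
theorem MapsEquation.phase_gradient (hM : MapsEquation φ U δ V δ' V')
    (hφ : IsPointTransformation φ U) (hn : 1 ≤ n) (hδ : δ ≠ 0) (hδ' : δ' ≠ 0) {z : Vars n}
    (hz : z ∈ U) (a : Fin n) :
    (fderiv ℝ φ z (ex a, 0)).2 = Complex.I * (timeRate (fderiv ℝ φ z)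
      / (2 * (‖δ‖ / ‖δ'‖) ^ 2)
      * ∑ b, (fderiv ℝ φ z (ex a, 0)).1.2 b * (fderiv ℝ φ z (et, 0)).1.2 b : ℝ) * (φ z).2 := by
  have hr := hM.reduced hφ.1 hn hz
  have hcd := hφ.1.contDiffAt hz
  have h1 := (hM.determining hφ.1 hn hz).linear a z.2
  rw [← (hM.homogeneous hφ hn hδ hz).1] at h1
  have hd1 : HasFDerivAt (fun y => (φ y).2) _ z := (hcd.differentiableAt (by simp)).hasFDerivAt.snd
  have hd2 : HasFDerivAt (fun y : Vars n => (fderiv ℝ φ y (0, y.2)).2) _ z :=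
    (ContinuousLinearMap.snd ℝ (Base n) ℂ).hasFDerivAt.comp z
      ((ContDiffAt.hasFDerivAt_fderiv hcd).clm_apply
      (((ContinuousLinearMap.inr ℝ (Base n) ℂ).comp
        (ContinuousLinearMap.snd ℝ (Base n) ℂ)).hasFDerivAt))
  have h2 : (fun y => (φ y).2) =ᶠ[𝓝 z] fun y : Vars n => (fderiv ℝ φ y (0, y.2)).2 := by
    filter_upwards [hφ.1.1.mem_nhds hz] with y hy
    exact (hM.homogeneous hφ hn hδ hy).1
  have h3 := DFunLike.congr_fun (hd1.unique (hd2.congr_of_eventuallyEq h2)) (ex a, 0)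
  simp only [ContinuousLinearMap.comp_apply, ContinuousLinearMap.coe_snd', add_apply,
    ContinuousLinearMap.flip_apply, map_zero,
    zero_add] at h3
  rw [← h3] at h1
  have hdrift : drift (fderiv ℝ φ z) (D2 φ z) a = 2 * (Complex.I * (timeRate (fderiv ℝ φ z)
      / (2 * (‖δ‖ / ‖δ'‖) ^ 2)
      * ∑ b, (fderiv ℝ φ z (ex a, 0)).1.2 b * (fderiv ℝ φ z (et, 0)).1.2 b : ℝ)) := by
    have e0 := abs_ne_zero.2 hr.rate
    have e1 : (SignType.sign (timeRate (fderiv ℝ φ z)) : ℝ) / |timeRate (fderiv ℝ φ z)|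
        = timeRate (fderiv ℝ φ z) / (‖δ‖ / ‖δ'‖) ^ 2 := by
      rw [← hM.abs_rate hφ hn hδ hδ' hz, div_eq_div_iff e0 (pow_ne_zero 2 e0), sq, ← mul_assoc,
        sign_mul_abs]
    have e2 : ((SignType.sign (timeRate (fderiv ℝ φ z)) : ℝ) : ℂ)
        / ((|timeRate (fderiv ℝ φ z)| : ℝ) : ℂ)
        = ((timeRate (fderiv ℝ φ z) / (‖δ‖ / ‖δ'‖) ^ 2 : ℝ) : ℂ) := by
      rw [← e1]; push_cast; rfl
    simp only [drift, Prod.fst_sum, hM.spatial_second hφ hn hδ hδ' hz, Finset.sum_const_zero,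
      Prod.snd_zero, Pi.zero_apply, Complex.ofReal_zero, add_zero]
    have e3 : ∑ b, ((fderiv ℝ φ z (ex a, 0)).1.2 b : ℂ) * (Complex.I
        * (SignType.sign (timeRate (fderiv ℝ φ z)) : ℝ) * ((fderiv ℝ φ z (et, 0)).1.2 b : ℂ))
        = Complex.I * (SignType.sign (timeRate (fderiv ℝ φ z)) : ℝ)
          * (∑ b, (fderiv ℝ φ z (ex a, 0)).1.2 b * (fderiv ℝ φ z (et, 0)).1.2 b : ℝ) := by
      push_cast
      rw [Finset.mul_sum]
      exact Finset.sum_congr rfl fun b _ => by ring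
    rw [e3]
    have e4 : ∀ x y s r : ℂ, x * s * y / r = x * (s / r) * y := fun x y s r => by ring
    rw [e4, e2]
    push_cast
    ring
  rw [hdrift] at h1
  linear_combination h1 / 2

/-- A rotation O(t) would make the phase gradient have a curl. Indeed Σ_b ∂_t B_cb B_ab is symmetric
in (a, c), because it is the x-derivative of the phase gradient up to a nonzero factor, and
antisymmetric by constancy of BBᵀ. -/
theorem MapsEquation.mixed_second (hM : MapsEquation φ U δ V δ' V')
    (hφ : IsPointTransformation φ U) (hn : 1 ≤ n) (hδ : δ ≠ 0) (hδ' : δ' ≠ 0) {z : Vars n}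
    (hz : z ∈ U) (a : Fin n) : (D2 φ z (et, 0) (ex a, 0)).1 = 0 := by
  have hr := hM.reduced hφ.1 hn hz
  have hcd := hφ.1.contDiffAt hz
  have hΨ : (φ z).2 ≠ 0 := hφ.2.2 hz
  set ρ := ‖δ‖ / ‖δ'‖ with hρ
  have hρ0 : ρ ≠ 0 := by
    rw [hρ, ← hM.abs_rate hφ hn hδ hδ' hz]; exact abs_ne_zero.2 hr.rate
  set σ := fun (y : Vars n) (a : Fin n) =>
    ∑ b, (fderiv ℝ φ y (ex a, 0)).1.2 b * (fderiv ℝ φ y (et, 0)).1.2 b with hσ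
  have hrate : ∀ y ∈ U, HasFDerivAt (fun y => timeRate (fderiv ℝ φ y))
      (0 : Vars n →L[ℝ] ℝ) y := by
    intro y hy
    have h1 := (ContDiffAt.hasFDerivAt_fderiv (hφ.1.contDiffAt hy)).clm_apply
      (hasFDerivAt_const ((et, 0) : Vars n) y)
    refine ((tC.comp (ContinuousLinearMap.fst ℝ (Base n) ℂ)).hasFDerivAt.comp y h1).congr_fderiv ?_
    refine ContinuousLinearMap.ext fun u => ?_
    simpa using hM.rate_deriv hφ hn hδ hδ' hy u
  have hsd : ∀ a c, HasFDerivAt (fun y => σ y a)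
      (∑ b, ((fderiv ℝ φ z (ex a, 0)).1.2 b •
        ((xC b).comp ((ContinuousLinearMap.fst ℝ (Base n) ℂ).comp ((D2 φ z).flip (et, 0))))
        + (fderiv ℝ φ z (et, 0)).1.2 b •
        ((xC b).comp ((ContinuousLinearMap.fst ℝ (Base n) ℂ).comp ((D2 φ z).flip (ex a, 0)))))) z ∧
      (∑ b, ((fderiv ℝ φ z (ex a, 0)).1.2 b •
        ((xC b).comp ((ContinuousLinearMap.fst ℝ (Base n) ℂ).comp ((D2 φ z).flip (et, 0))))
        + (fderiv ℝ φ z (et, 0)).1.2 b •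
        ((xC b).comp ((ContinuousLinearMap.fst ℝ (Base n) ℂ).comp
          ((D2 φ z).flip (ex a, 0)))))) (ex c, 0)
      = ∑ b, (D2 φ z (et, 0) (ex c, 0)).1.2 b * (fderiv ℝ φ z (ex a, 0)).1.2 b := by
    intro a c
    constructor
    · exact HasFDerivAt.fun_sum (u := Finset.univ) fun b _ =>
        (hasFDerivAt_fderiv_coord hcd (ex a, 0) b).mul (hasFDerivAt_fderiv_coord hcd (et, 0) b)
    · simp only [sum_apply, add_apply, smul_apply, ContinuousLinearMap.comp_apply, xC_apply,
        ContinuousLinearMap.coe_fst', ContinuousLinearMap.flip_apply, smul_eq_mul,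
        hM.spatial_second hφ hn hδ hδ' hz, Prod.snd_zero, Pi.zero_apply, mul_zero, add_zero,
        hr.symm (ex c, 0) (et, 0)]
      exact Finset.sum_congr rfl fun b _ => mul_comm _ _
  -- Derivative of the phase-gradient formula. The last term is symmetric in `a` and `c`, so
  -- symmetry of the left side passes to the sum.
  have hkey : ∀ a c, (D2 φ z (ex c, 0) (ex a, 0)).2
      = Complex.I * (timeRate (fderiv ℝ φ z) / (2 * ρ ^ 2)
        * ∑ b, (D2 φ z (et, 0) (ex c, 0)).1.2 b * (fderiv ℝ φ z (ex a, 0)).1.2 b : ℝ) * (φ z).2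
        + Complex.I * (timeRate (fderiv ℝ φ z) / (2 * ρ ^ 2) * σ z a : ℝ)
          * (Complex.I * (timeRate (fderiv ℝ φ z) / (2 * ρ ^ 2) * σ z c : ℝ) * (φ z).2) := by
    intro a c
    have d1 := hasFDerivAt_fderiv_snd hcd (ex a, 0)
    have d2 := ((Complex.ofRealCLM.hasFDerivAt.comp z
      (((hrate z hz).mul_const (2 * ρ ^ 2)⁻¹).mul (hsd a c).1)).const_mul Complex.I).mul
      (hcd.differentiableAt (by simp)).hasFDerivAt.snd
    have heq : (fun y => (fderiv ℝ φ y (ex a, 0)).2) =ᶠ[𝓝 z]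
        ((fun y => Complex.I * (Complex.ofRealCLM ∘
          ((fun y => timeRate (fderiv ℝ φ y) * (2 * ρ ^ 2)⁻¹) * fun y => σ y a)) y)
          * fun y => (φ y).2) := by
      filter_upwards [hφ.1.1.mem_nhds hz] with y hy
      rw [hM.phase_gradient hφ hn hδ hδ' hy a]
      rfl
    have e := DFunLike.congr_fun (d1.unique (d2.congr_of_eventuallyEq heq)) (ex c, 0)
    simp only [ContinuousLinearMap.comp_apply, ContinuousLinearMap.coe_snd', add_apply,
      smul_apply, ContinuousLinearMap.flip_apply, smul_eq_mul, Function.comp_apply, Pi.mul_apply,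
      (hsd a c).2, smul_zero, zero_apply, mul_zero, add_zero,
      Complex.ofRealCLM_apply, hM.phase_gradient hφ hn hδ hδ' hz c] at e
    rw [e, ← hρ]
    simp only [hσ, div_eq_mul_inv]
    ring
  have hsymm : ∀ a c, ∑ b, (D2 φ z (et, 0) (ex c, 0)).1.2 b * (fderiv ℝ φ z (ex a, 0)).1.2 b
      = ∑ b, (D2 φ z (et, 0) (ex a, 0)).1.2 b * (fderiv ℝ φ z (ex c, 0)).1.2 b := by
    intro a c
    have e1 := hkey a c
    rw [hr.symm, hkey c a] at e1
    have e2 : Complex.I * ((timeRate (fderiv ℝ φ z) / (2 * ρ ^ 2) : ℝ) : ℂ) * (φ z).2 ≠ 0 := by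
      refine mul_ne_zero (mul_ne_zero Complex.I_ne_zero ?_) hΨ
      exact_mod_cast div_ne_zero hr.rate (by positivity)
    have e3 : ((∑ b, (D2 φ z (et, 0) (ex c, 0)).1.2 b * (fderiv ℝ φ z (ex a, 0)).1.2 b : ℝ) : ℂ)
        = ((∑ b, (D2 φ z (et, 0) (ex a, 0)).1.2 b * (fderiv ℝ φ z (ex c, 0)).1.2 b : ℝ) : ℂ) := by
      apply mul_left_cancel₀ e2
      simp only [Complex.ofReal_mul] at e1
      linear_combination -e1
    exact_mod_cast e3
  refine Prod.ext ?_ (hr.eq_zero_of_orthogonal fun c => ?_)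
  · rw [hr.symm]
    exact hM.rate_deriv hφ hn hδ hδ' hz _
  · have e1 := hM.antisymm hφ hn hδ hδ' hz (et, 0) a c
    have e2 := hsymm a c
    linarith

/-- The spatial part of the Jacobian is locally constant. -/
theorem MapsEquation.second_eq_zero (hM : MapsEquation φ U δ V δ' V')
    (hφ : IsPointTransformation φ U) (hn : 1 ≤ n) (hδ : δ ≠ 0) (hδ' : δ' ≠ 0) {z : Vars n}
    (hz : z ∈ U) (u : Vars n) (a : Fin n) : (D2 φ z u (ex a, 0)).1 = 0 := by
  have hr := hM.reduced hφ.1 hn hz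
  have hu : u = u.1.1 • ((et, 0) : Vars n) + ∑ b, u.1.2 b • ((ex b, 0) : Vars n) + (0, u.2) := by
    refine Prod.ext ?_ ?_
    · conv_lhs => rw [base_eq_sum u.1]
      simp [Prod.fst_sum]
    · simp [Prod.snd_sum]
  rw [hu]
  simp only [map_add, map_sum, map_smul, add_apply, sum_apply, smul_apply, Prod.fst_add,
    Prod.fst_sum, Prod.smul_fst, hM.mixed_second hφ hn hδ hδ' hz,
    hM.spatial_second hφ hn hδ hδ' hz, hr.symm (0, u.2) (ex a, 0), hr.base2, smul_zero,
    Finset.sum_const_zero, add_zero]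


end

/-! ### Integration over a patch. -/

section
variable {U : Set (Vars n)}

theorem isOpen_times (hU : IsOpen U) : IsOpen (times U) :=
  (isOpenMap_fst.comp isOpenMap_fst) U hU

theorem mem_times {z : Vars n} (hz : z ∈ U) : z.1.1 ∈ times U := ⟨z, hz, rfl⟩

/-- A smooth function on a patch that is locally independent of `x` and `ψ` is a function
of `t`. -/
theorem IsPatch.exists_time_function {F : Type*} [NormedAddCommGroup F] [NormedSpace ℝ F]
    (hU : IsPatch U) {f : Vars n → F} (hf : ContDiffOn ℝ ∞ f U)
    (h0 : ∀ z ∈ U, ∀ v w, fderiv ℝ f z ((0, v), w) = 0) :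
    ∃ g : ℝ → F, ContDiffOn ℝ ∞ g (times U) ∧
      ∀ z ∈ U, f z = g z.1.1 ∧ HasDerivAt g (fderiv ℝ f z (et, 0)) z.1.1 := by
  classical
  have hsec : ∀ z ∈ U, ∀ y ∈ U, z.1.1 = y.1.1 → f z = f y := by
    rintro ⟨⟨t, x⟩, w⟩ hz ⟨⟨t', x'⟩, w'⟩ hy (rfl : t = t')
    set j : (Fin n → ℝ) × ℂ → Vars n := fun p => ((t, p.1), p.2) with hj
    have hjd : ∀ p, HasFDerivAt j
        (((0 : (Fin n → ℝ) × ℂ →L[ℝ] ℝ).prod (ContinuousLinearMap.fst ℝ _ _)).prod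
          (ContinuousLinearMap.snd ℝ _ _)) p := fun p =>
      ((hasFDerivAt_const t p).prodMk hasFDerivAt_fst).prodMk hasFDerivAt_snd
    have hjc : Continuous j := by fun_prop
    have hd : ∀ p ∈ j ⁻¹' U, HasFDerivAt (fun p => f (j p)) _ p := fun p hp =>
      ((hf.contDiffAt (hU.isOpen.mem_nhds hp)).differentiableAt (by simp)).hasFDerivAt.comp p
        (hjd p)
    refine (hU.isOpen.preimage hjc).is_const_of_fderiv_eq_zero (𝕜 := ℝ) (f := fun p => f (j p))
      (hU.section_conn t) (fun p hp => (hd p hp).differentiableAt.differentiableWithinAt)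
      (fun p hp => ?_) (x := (x, w)) (y := (x', w')) hz hy
    rw [(hd p hp).fderiv]
    exact ContinuousLinearMap.ext fun u => h0 _ hp u.1 u.2
  -- The choice of a point over `t` is immaterial because `f` is constant on connected sections; the
  -- value 0 is used only outside the set of times.
  set g : ℝ → F := fun t => if h : ∃ z ∈ U, z.1.1 = t then f h.choose else 0 with hg
  have hfg : ∀ z ∈ U, f z = g z.1.1 := by
    intro z hz
    have h : ∃ y ∈ U, y.1.1 = z.1.1 := ⟨z, hz, rfl⟩
    simp only [hg, dif_pos h]
    exact hsec z hz _ h.choose_spec.1 h.choose_spec.2.symm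
  -- Near each time `g` is `f` restricted to a line parallel to the t-axis, which gives its
  -- smoothness and derivative despite the choices in its definition.
  have hloc : ∀ z ∈ U, g =ᶠ[𝓝 z.1.1] fun t => f ((t, z.1.2), z.2) := by
    intro z hz
    have hc : ContinuousAt (fun t : ℝ => (((t, z.1.2), z.2) : Vars n)) z.1.1 := by fun_prop
    filter_upwards [hc.preimage_mem_nhds (hU.isOpen.mem_nhds (show ((z.1.1, z.1.2), z.2) ∈ U from hz))]
      with t ht
    exact (hfg _ ht).symm
  refine ⟨g, ?_, fun z hz => ⟨hfg z hz, ?_⟩⟩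
  · rintro _ ⟨z, hz, rfl⟩
    refine ContDiffAt.contDiffWithinAt (ContDiffAt.congr_of_eventuallyEq ?_ (hloc z hz))
    have h1 : ContDiffAt ℝ ∞ f ((z.1.1, z.1.2), z.2) := hf.contDiffAt (hU.isOpen.mem_nhds hz)
    exact h1.comp (f := fun t : ℝ => (((t, z.1.2), z.2) : Vars n)) z.1.1
      ((contDiffAt_id.prodMk contDiffAt_const).prodMk contDiffAt_const)
  · refine HasDerivAt.congr_of_eventuallyEq ?_ (hloc z hz)
    have h1 : HasFDerivAt f (fderiv ℝ f z) ((z.1.1, z.1.2), z.2) :=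
      ((hf.contDiffAt (hU.isOpen.mem_nhds hz)).differentiableAt (by simp)).hasFDerivAt
    have h2 : HasDerivAt (fun t : ℝ => (((t, z.1.2), z.2) : Vars n)) (et, 0) z.1.1 :=
      ((hasDerivAt_id z.1.1).prodMk (hasDerivAt_const _ _)).prodMk (hasDerivAt_const _ _)
    exact h1.comp_hasDerivAt z.1.1 h2

theorem const_on_times {F : Type*} [NormedAddCommGroup F] [NormedSpace ℝ F]
    (hU : IsPatch U) {g : ℝ → F} (h : ∀ t ∈ times U, HasDerivAt g 0 t) {s t : ℝ}
    (hs : s ∈ times U) (ht : t ∈ times U) : g s = g t :=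
  (isOpen_times hU.isOpen).is_const_of_deriv_eq_zero hU.times_conn
    (fun s hs => (h s hs).differentiableAt.differentiableWithinAt) (fun s hs => (h s hs).deriv)
    hs ht

theorem IsPatch.const_of_fderiv_eq_zero {F : Type*} [NormedAddCommGroup F] [NormedSpace ℝ F]
    (hU : IsPatch U) {f : Vars n → F} (hf : ContDiffOn ℝ ∞ f U)
    (h0 : ∀ z ∈ U, ∀ u, fderiv ℝ f z u = 0) {y z : Vars n} (hy : y ∈ U) (hz : z ∈ U) :
    f y = f z := by
  obtain ⟨g, -, hg⟩ := hU.exists_time_function hf fun z hz v w => h0 z hz _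
  rw [(hg y hy).1, (hg z hz).1]
  refine const_on_times hU ?_ (mem_times hy) (mem_times hz)
  rintro _ ⟨x, hx, rfl⟩
  have := (hg x hx).2
  rwa [h0 x hx] at this

/-- A nonvanishing smooth complex-valued function on an interval has a smooth logarithm. -/
theorem exists_smooth_log {I : Set ℝ} (hI : IsOpen I) (hc : IsPreconnected I) {G : ℝ → ℂ}
    (hG : ContDiffOn ℝ ∞ G I) (h0 : ∀ t ∈ I, G t ≠ 0) :
    ∃ S Z : ℝ → ℝ, ContDiffOn ℝ ∞ S I ∧ ContDiffOn ℝ ∞ Z I ∧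
      ∀ t ∈ I, G t = Complex.exp (Complex.I * (S t : ℂ) + (Z t : ℂ)) := by
  rcases I.eq_empty_or_nonempty with rfl | ⟨t0, ht0⟩
  · exact ⟨0, 0, by simp, by simp, by simp⟩
  have hdG : ContDiffOn ℝ ∞ (deriv G) I := hG.deriv_of_isOpen hI (by simp)
  have hq : ContDiffOn ℝ ∞ (fun t => deriv G t / G t) I := by
    simp only [div_eq_mul_inv]
    exact hdG.mul (hG.inv h0)
  have hqc := hq.continuousOn
  -- The logarithm is obtained by integrating G′/G, since the principal branch need not be
  -- continuous along the curve; the principal value is used only at `t0`.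
  set l : ℝ → ℂ := fun t => ∫ s in t0..t, deriv G s / G s with hl
  have hld : ∀ t ∈ I, HasDerivAt l (deriv G t / G t) t := by
    intro t ht
    have hsub : Set.uIcc t0 t ⊆ I := hc.ordConnected.uIcc_subset ht0 ht
    exact intervalIntegral.integral_hasDerivAt_right
      ((hqc.mono hsub).intervalIntegrable)
      (hqc.stronglyMeasurableAtFilter hI t ht) (hqc.continuousAt (hI.mem_nhds ht))
  have hlc : ContDiffOn ℝ ∞ l I := by
    rw [contDiffOn_infty_iff_deriv_of_isOpen hI]
    exact ⟨fun t ht => (hld t ht).differentiableAt.differentiableWithinAt,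
      hq.congr fun t ht => (hld t ht).deriv⟩
  have hGd : ∀ t ∈ I, HasDerivAt G (deriv G t) t := fun t ht =>
    ((hG.contDiffAt (hI.mem_nhds ht)).differentiableAt (by simp)).hasDerivAt
  have hK : ∀ t ∈ I, HasDerivAt (fun t => G t * Complex.exp (-l t)) 0 t := by
    intro t ht
    have h1 := (hGd t ht).mul (hld t ht).neg.cexp
    refine h1.congr_deriv ?_
    have := h0 t ht
    simp only [Pi.neg_apply]
    field_simp
    ring
  have hconst : ∀ t ∈ I, G t * Complex.exp (-l t) = G t0 := by
    intro t ht
    have := hI.is_const_of_deriv_eq_zero hc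
      (fun s hs => (hK s hs).differentiableAt.differentiableWithinAt)
      (fun s hs => (hK s hs).deriv) ht ht0
    rw [this]
    simp [hl]
  set c := Complex.log (G t0) with hcdef
  refine ⟨fun t => (c + l t).im, fun t => (c + l t).re, ?_, ?_, fun t ht => ?_⟩
  · exact Complex.imCLM.contDiff.comp_contDiffOn (contDiffOn_const.add hlc)
  · exact Complex.reCLM.contDiff.comp_contDiffOn (contDiffOn_const.add hlc)
  · have h1 : Complex.I * ((c + l t).im : ℂ) + ((c + l t).re : ℂ) = c + l t := by
      conv_rhs => rw [← Complex.re_add_im (c + l t)]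
      ring
    rw [h1, Complex.exp_add, hcdef, Complex.exp_log (h0 t0 ht0), ← hconst t ht, mul_assoc,
      ← Complex.exp_add]
    simp


end

/-! ### Parameters of a transformation over a patch. -/

section
variable {φ : Vars n → Vars n} {U : Set (Vars n)} {δ δ' : ℂ} {V V' : Base n → ℂ}

/-- Admissible values of the parameters of equivalence transformations over `U`. -/
structure IsParam (U : Set (Vars n)) (T : ℝ → ℝ) (X : Fin n → ℝ → ℝ)
    (O : Matrix (Fin n) (Fin n) ℝ) (S Z : ℝ → ℝ) : Prop where
  smooth_T : ContDiffOn ℝ ∞ T (times U)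
  smooth_X : ∀ a, ContDiffOn ℝ ∞ (X a) (times U)
  smooth_S : ContDiffOn ℝ ∞ S (times U)
  smooth_Z : ContDiffOn ℝ ∞ Z (times U)
  orth : O ∈ Matrix.orthogonalGroup (Fin n) ℝ
  rate : ∀ t ∈ times U, deriv T t ≠ 0 ∧ deriv (deriv T) t = 0

theorem vars_eq_sum (u : Vars n) :
    u = u.1.1 • ((et, 0) : Vars n) + ∑ b, u.1.2 b • ((ex b, 0) : Vars n) + (0, u.2) := by
  refine Prod.ext ?_ ?_
  · conv_lhs => rw [base_eq_sum u.1]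
    simp [Prod.fst_sum]
  · simp [Prod.snd_sum]

theorem spatial_vars_eq_sum (v : Fin n → ℝ) (w : ℂ) :
    (((0, v), w) : Vars n) = ∑ b, v b • ((ex b, 0) : Vars n) + (0, w) := by
  have := vars_eq_sum (((0, v), w) : Vars n)
  simpa using this

theorem hasFDerivAt_phase {η : Fin n → ℝ → ℝ} {z : Vars n}
    (hη : ∀ a, DifferentiableAt ℝ (η a) z.1.1) :
    HasFDerivAt (fun y : Vars n => ∑ a, η a y.1.1 * y.1.2 a)
      (∑ a, (η a z.1.1 • (xC a).comp (ContinuousLinearMap.fst ℝ (Base n) ℂ)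
        + z.1.2 a • deriv (η a) z.1.1 • tC.comp (ContinuousLinearMap.fst ℝ (Base n) ℂ))) z := by
  refine HasFDerivAt.fun_sum fun a _ => ?_
  have h1 : HasFDerivAt (fun y : Vars n => η a y.1.1)
      (deriv (η a) z.1.1 • tC.comp (ContinuousLinearMap.fst ℝ (Base n) ℂ)) z :=
    (hη a).hasDerivAt.comp_hasFDerivAt (f := fun y : Vars n => y.1.1) z
      (tC.comp (ContinuousLinearMap.fst ℝ (Base n) ℂ)).hasFDerivAt
  exact h1.mul ((xC a).comp (ContinuousLinearMap.fst ℝ (Base n) ℂ)).hasFDerivAt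

theorem hasFDerivAt_hat_inv (s : ℝ) {z : Vars n} (hz : z.2 ≠ 0) :
    HasFDerivAt (fun y : Vars n => (hat s y.2)⁻¹)
      (((ContinuousLinearMap.toSpanSingleton ℂ (-(hat s z.2 ^ 2)⁻¹)).restrictScalars ℝ).comp
        ((hatL s).comp (ContinuousLinearMap.snd ℝ (Base n) ℂ))) z := by
  have h1 := ((hasDerivAt_inv (hat_ne_zero (s := s) hz)).hasFDerivAt.restrictScalars ℝ)
  have h2 : HasFDerivAt (fun y : Vars n => hat s y.2)
      ((hatL s).comp (ContinuousLinearMap.snd ℝ (Base n) ℂ)) z := by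
    have e : (fun y : Vars n => hat s y.2) =
        (hatL s).comp (ContinuousLinearMap.snd ℝ (Base n) ℂ) := by
      ext1 y; simp
    rw [e]
    exact ContinuousLinearMap.hasFDerivAt _
  exact h1.comp z h2

theorem real_sign_mul_abs (r : ℝ) : Real.sign r * |r| = r := by
  rcases lt_trichotomy r 0 with h | rfl | h
  · rw [Real.sign_of_neg h, abs_of_neg h]; ring
  · simp
  · rw [Real.sign_of_pos h, abs_of_pos h]; ring

/-- The rate θ and the x-Jacobian are constant on the patch. Subtracting the linear part from the
new x, and dividing the new ψ by ψ̂ and by the x-dependent phase, leaves functions of t only. -/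
theorem MapsEquation.exists_param (hM : MapsEquation φ U δ V δ' V')
    (hφ : IsPointTransformation φ U) (hn : 1 ≤ n) (hδ : δ ≠ 0) (hδ' : δ' ≠ 0)
    (hU : IsPatch U) :
    ∃ (T : ℝ → ℝ) (X : Fin n → ℝ → ℝ) (O : Matrix (Fin n) (Fin n) ℝ) (S Z : ℝ → ℝ),
      IsParam U T X O S Z ∧ ∀ t x ψ, ((t, x), ψ) ∈ U →
        φ ((t, x), ψ) = ((T t, newX T X O t x), newPsi T X O S Z t x ψ) := by
  -- The constants are read off at a base point, so the empty patch is treated separately.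
  rcases U.eq_empty_or_nonempty with rfl | ⟨z0, hz0⟩
  · refine ⟨0, 0, 1, 0, 0, ⟨?_, fun a => ?_, ?_, ?_, one_mem _, ?_⟩, ?_⟩ <;> simp [times]
  have hcd := fun (z : Vars n) (hz : z ∈ U) => hφ.1.contDiffAt hz
  have hdiff := fun (z : Vars n) (hz : z ∈ U) => (hcd z hz).differentiableAt (by simp)
  have hred := fun (z : Vars n) (hz : z ∈ U) => hM.reduced hφ.1 hn hz
  have hfd : ∀ c, ContDiffOn ℝ ∞ (fun z => fderiv ℝ φ z c) U := fun c =>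
    (hφ.1.2.1.fderiv_of_isOpen hφ.1.1 (by simp)).clm_apply contDiffOn_const
  set θ := timeRate (fderiv ℝ φ z0) with hθ
  have hθ0 : θ ≠ 0 := (hred z0 hz0).rate
  have hρ0 : |θ| ≠ 0 := abs_ne_zero.2 hθ0
  have hρ : ‖δ‖ / ‖δ'‖ = |θ| := (hM.abs_rate hφ hn hδ hδ' hz0).symm
  have hrate : ∀ z ∈ U, timeRate (fderiv ℝ φ z) = θ := by
    intro z hz
    refine hU.const_of_fderiv_eq_zero (f := fun z => timeRate (fderiv ℝ φ z))
      ((tC.comp (ContinuousLinearMap.fst ℝ (Base n) ℂ)).contDiff.comp_contDiffOn (hfd (et, 0)))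
      (fun y hy u => ?_) hz hz0
    have h1 := (tC.comp (ContinuousLinearMap.fst ℝ (Base n) ℂ)).hasFDerivAt.comp y
      ((ContDiffAt.hasFDerivAt_fderiv (hcd y hy)).clm_apply
        (hasFDerivAt_const ((et, 0) : Vars n) y))
    have h2 : fderiv ℝ (fun z => timeRate (fderiv ℝ φ z)) y = _ := h1.fderiv
    rw [h2]
    simpa using hM.rate_deriv hφ hn hδ hδ' hy u
  set B : Fin n → Fin n → ℝ := fun a b => (fderiv ℝ φ z0 (ex a, 0)).1.2 b with hB
  have hBc : ∀ z ∈ U, ∀ a b, (fderiv ℝ φ z (ex a, 0)).1.2 b = B a b := by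
    intro z hz a b
    refine hU.const_of_fderiv_eq_zero (f := fun z => (fderiv ℝ φ z (ex a, 0)).1.2 b)
      (((xC b).comp (ContinuousLinearMap.fst ℝ (Base n) ℂ)).contDiff.comp_contDiffOn
        (hfd (ex a, 0))) (fun y hy u => ?_) hz hz0
    rw [(hasFDerivAt_fderiv_coord (hcd y hy) (ex a, 0) b).fderiv]
    simp [hM.second_eq_zero hφ hn hδ hδ' hy u a]
  obtain ⟨T, hTs, hT⟩ := hU.exists_time_function (f := fun z => (φ z).1.1)
    ((tC.comp (ContinuousLinearMap.fst ℝ (Base n) ℂ)).contDiff.comp_contDiffOn hφ.1.2.1)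
    (fun z hz v w => by
      rw [(hdiff z hz).hasFDerivAt.fst.fst.fderiv]
      exact (hred z hz).time v w)
  have hTd : ∀ t ∈ times U, deriv T t = θ := by
    rintro _ ⟨z, hz, rfl⟩
    have := (hT z hz).2
    rw [(hdiff z hz).hasFDerivAt.fst.fst.fderiv] at this
    rw [this.deriv]
    exact hrate z hz
  have hTdd : ∀ t ∈ times U, deriv (deriv T) t = 0 := by
    intro t ht
    have : deriv T =ᶠ[𝓝 t] fun _ => θ := by
      filter_upwards [(isOpen_times hU.isOpen).mem_nhds ht] with s hs using hTd s hs
    rw [this.deriv_eq, deriv_const]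
  have hXd : ∀ a, ∀ z ∈ U, HasFDerivAt (fun y : Vars n => (φ y).1.2 a - ∑ b, B b a * y.1.2 b)
      (((xC a).comp (ContinuousLinearMap.fst ℝ (Base n) ℂ)).comp (fderiv ℝ φ z)
        - ∑ b, B b a • (xC b).comp (ContinuousLinearMap.fst ℝ (Base n) ℂ)) z := by
    intro a z hz
    exact (((xC a).comp (ContinuousLinearMap.fst ℝ (Base n) ℂ)).hasFDerivAt.comp z
      (hdiff z hz).hasFDerivAt).sub (HasFDerivAt.fun_sum fun b _ =>
        ((xC b).comp (ContinuousLinearMap.fst ℝ (Base n) ℂ)).hasFDerivAt.const_mul (B b a))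
  have hXex : ∀ a, ∃ g : ℝ → ℝ, ContDiffOn ℝ ∞ g (times U) ∧
      ∀ z ∈ U, (φ z).1.2 a - ∑ b, B b a * z.1.2 b = g z.1.1 ∧
        HasDerivAt g ((fderiv ℝ φ z (et, 0)).1.2 a) z.1.1 := by
    intro a
    obtain ⟨g, h1, h2⟩ := hU.exists_time_function
      (f := fun y : Vars n => (φ y).1.2 a - ∑ b, B b a * y.1.2 b)
      (by
        refine ContDiffOn.sub (((xC a).comp
          (ContinuousLinearMap.fst ℝ (Base n) ℂ)).contDiff.comp_contDiffOn hφ.1.2.1) ?_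
        refine ContDiff.contDiffOn ?_
        fun_prop)
      (fun z hz v w => by
        rw [(hXd a z hz).fderiv, spatial_vars_eq_sum, map_add, map_sum]
        simp only [map_smul, sub_apply, ContinuousLinearMap.comp_apply,
          ContinuousLinearMap.coe_fst', xC_apply, hBc z hz, sum_apply, smul_apply,
          (hred z hz).base, smul_eq_mul]
        simp [ex, Pi.single_apply, mul_comm])
    refine ⟨g, h1, fun z hz => ⟨(h2 z hz).1, ?_⟩⟩
    have := (h2 z hz).2
    rw [(hXd a z hz).fderiv] at this
    simpa [et] using this
  choose X hXs hX using hXex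
  have hXt : ∀ z ∈ U, ∀ a, deriv (X a) z.1.1 = (fderiv ℝ φ z (et, 0)).1.2 a := fun z hz a =>
    ((hX a z hz).2).deriv
  -- The indices are swapped because `B a b` is the derivative of the b-th new coordinate with
  -- respect to x_a.
  set O : Matrix (Fin n) (Fin n) ℝ :=
    Matrix.of fun a b => B b a / |θ| ^ (1 / 2 : ℝ) with hO
  have hsq : |θ| ^ (1 / 2 : ℝ) * |θ| ^ (1 / 2 : ℝ) = |θ| := by
    rw [← Real.rpow_add (abs_pos.2 hθ0)]; norm_num
  have hsq0 : |θ| ^ (1 / 2 : ℝ) ≠ 0 := (Real.rpow_pos_of_pos (abs_pos.2 hθ0) _).ne'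
  have hOorth : O ∈ Matrix.orthogonalGroup (Fin n) ℝ := by
    rw [Matrix.mem_orthogonalGroup_iff]
    ext b c
    rw [Matrix.mul_apply]
    have h1 := (hred z0 hz0).orth b c
    have h2 : ∀ a, O b a * O.transpose a c = B a b * B a c / |θ| := by
      intro a
      rw [Matrix.transpose_apply, hO, Matrix.of_apply, Matrix.of_apply, div_mul_div_comm,
        hsq]
    rw [Finset.sum_congr rfl fun a _ => h2 a, ← Finset.sum_div, h1, Matrix.one_apply, ← hθ]
    split_ifs <;> simp [hθ0]
  -- The coefficient in `MapsEquation.phase_gradient`, now seen to be a function of t alone.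
  set η : Fin n → ℝ → ℝ := fun a t => θ / (2 * |θ| ^ 2) * ∑ b, B a b * deriv (X b) t with hη
  have hηs : ∀ a, ContDiffOn ℝ ∞ (η a) (times U) := by
    intro a
    refine contDiffOn_const.mul (ContDiffOn.sum fun b _ => contDiffOn_const.mul ?_)
    exact (hXs b).deriv_of_isOpen (isOpen_times hU.isOpen) (by simp)
  have hgrad : ∀ z ∈ U, ∀ a,
      (fderiv ℝ φ z (ex a, 0)).2 = Complex.I * (η a z.1.1 : ℝ) * (φ z).2 := by
    intro z hz a
    rw [hM.phase_gradient hφ hn hδ hδ' hz a, hρ, hrate z hz]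
    simp only [hBc z hz, hη, hXt z hz]
  have hΨ : ∀ z ∈ U, ∀ w, (fderiv ℝ φ z (0, w)).2 * hat θ z.2 = (φ z).2 * hat θ w := by
    intro z hz w
    rw [(hM.homogeneous hφ hn hδ hz).1, (hred z hz).fiber_apply w, (hred z hz).fiber_apply z.2,
      hrate z hz]
    ring
  have hηd : ∀ z ∈ U, ∀ a, DifferentiableAt ℝ (η a) z.1.1 := fun z hz a =>
    ((hηs a).contDiffAt ((isOpen_times hU.isOpen).mem_nhds (mem_times hz))).differentiableAt
      (by simp)
  have hreg : ∀ z ∈ U, z.2 ≠ 0 := fun z hz => hU.subset_regular hz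
  -- The quotient has no derivative along x by `hgrad` and none along the fibre by `hΨ`; it is
  -- exp(iΣ + Z).
  obtain ⟨G, hGs, hG⟩ := hU.exists_time_function
    (f := fun z : Vars n => (φ z).2 * (hat θ z.2)⁻¹
      * Complex.exp (-(Complex.I * ((∑ a, η a z.1.1 * z.1.2 a : ℝ) : ℂ))))
    (by
      refine ContDiffOn.mul (ContDiffOn.mul hφ.1.2.1.snd (ContDiffOn.inv ?_ fun z hz =>
        hat_ne_zero (hreg z hz))) (ContDiffOn.cexp (ContDiffOn.neg (contDiffOn_const.mul ?_)))
      · have : ContDiff ℝ ∞ fun z : Vars n => hatL θ z.2 := by fun_prop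
        simpa using this.contDiffOn
      · have h1 : ContDiffOn ℝ ∞ (fun z : Vars n => ∑ a, η a z.1.1 * z.1.2 a) U :=
          ContDiffOn.sum fun a _ => ContDiffOn.mul ((hηs a).comp (g := η a)
            (f := fun z : Vars n => z.1.1) (by fun_prop) fun z hz => mem_times hz)
              (by fun_prop)
        exact Complex.ofRealCLM.contDiff.comp_contDiffOn h1)
    (fun z hz v w => by
      have d := ((hdiff z hz).hasFDerivAt.snd.mul (hasFDerivAt_hat_inv θ (hreg z hz))).mul
        ((Complex.ofRealCLM.hasFDerivAt.comp z
          (hasFDerivAt_phase (hηd z hz))).const_mul Complex.I).neg.cexp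
      refine (DFunLike.congr_fun d.fderiv ((0, v), w)).trans ?_
      have h1 : (fderiv ℝ φ z ((0, v), w)).2
          = Complex.I * ((∑ a, η a z.1.1 * v a : ℝ) : ℂ) * (φ z).2
            + (φ z).2 * hat θ w * (hat θ z.2)⁻¹ := by
        rw [spatial_vars_eq_sum, map_add, map_sum, Prod.snd_add, Prod.snd_sum, ← hΨ z hz,
          mul_inv_cancel_right₀ (hat_ne_zero (hreg z hz))]
        congr 1
        simp only [map_smul, Prod.smul_snd, hgrad z hz, Complex.real_smul]
        push_cast
        rw [Finset.mul_sum, Finset.sum_mul]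
        exact Finset.sum_congr rfl fun a _ => by ring
      have h0 := hat_ne_zero (s := θ) (hreg z hz)
      simp only [add_apply, smul_apply, ContinuousLinearMap.comp_apply, neg_apply, sum_apply,
        ContinuousLinearMap.coe_fst', ContinuousLinearMap.coe_snd', tC_apply, xC_apply,
        smul_eq_mul, mul_zero, add_zero, hatL_apply, ContinuousLinearMap.coe_restrictScalars',
        ContinuousLinearMap.toSpanSingleton_apply, Complex.ofRealCLM_apply, h1, Pi.mul_apply,
        Pi.neg_apply, Function.comp_apply]
      field_simp
      ring)
  obtain ⟨S, Z, hSs, hZs, hSZ⟩ := exists_smooth_log (isOpen_times hU.isOpen) hU.times_conn hGs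
    (by
      rintro _ ⟨z, hz, rfl⟩
      rw [← (hG z hz).1]
      exact mul_ne_zero (mul_ne_zero (hφ.2.2 hz) (inv_ne_zero (hat_ne_zero (hreg z hz))))
        (Complex.exp_ne_zero _))
  refine ⟨T, X, O, S, Z, ⟨hTs, hXs, hSs, hZs, hOorth, fun t ht => ⟨?_, hTdd t ht⟩⟩, ?_⟩
  · rw [hTd t ht]; exact hθ0
  intro t x ψ hz
  have ht : t ∈ times U := mem_times hz
  refine Prod.ext (Prod.ext ?_ ?_) ?_
  · exact (hT _ hz).1
  · ext a
    have := (hX a _ hz).1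
    simp only at this
    simp only [newX, hTd t ht]
    rw [← this, Finset.mul_sum]
    have h2 : ∀ b, |θ| ^ (1 / 2 : ℝ) * (O a b * x b) = B b a * x b := by
      intro b
      rw [hO, Matrix.of_apply]
      field_simp
    simp only [h2]
    ring
  · have h1 := (hG _ hz).1
    simp only at h1
    rw [hSZ t ht] at h1
    have h0 := hat_ne_zero (s := θ) (hreg _ hz)
    simp only at h0
    have h3 : 1 / 2 * ∑ b, ∑ a, Real.sign θ * deriv (X b) t / |θ| ^ (1 / 2 : ℝ) * O b a * x a
        = ∑ a, η a t * x a := by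
      rw [Finset.sum_comm, Finset.mul_sum]
      refine Finset.sum_congr rfl fun a _ => ?_
      change _ = θ / (2 * |θ| ^ 2) * (∑ b, B a b * deriv (X b) t) * x a
      rw [Finset.mul_sum, Finset.mul_sum, Finset.sum_mul]
      refine Finset.sum_congr rfl fun b _ => ?_
      rw [hO, Matrix.of_apply]
      have e1 := real_sign_mul_abs θ
      have e2 : θ / (2 * |θ| ^ 2) = 1 / 2 * (Real.sign θ / |θ|) := by
        nth_rewrite 1 [← e1]
        field_simp
      rw [e2]
      nth_rewrite 3 [← hsq]
      field_simp
    simp only [newPsi, hTd t ht, hTdd t ht, zero_div, mul_zero, zero_mul, zero_add]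
    rw [h3]
    have h4 : Complex.exp (Complex.I * ((∑ a, η a t * x a + S t : ℝ) : ℂ) + (Z t : ℂ))
        = Complex.exp (Complex.I * ((∑ a, η a t * x a : ℝ) : ℂ))
          * Complex.exp (Complex.I * (S t : ℂ) + (Z t : ℂ)) := by
      rw [← Complex.exp_add]
      congr 1
      push_cast
      ring
    rw [h4, ← h1, Complex.exp_neg]
    have h5 := Complex.exp_ne_zero (Complex.I * ((∑ a, η a t * x a : ℝ) : ℂ))
    field_simp


end

/-! ### Sufficiency of the determining equations and the standard form. -/

section
variable {φ : Vars n → Vars n} {U : Set (Vars n)} {δ δ' : ℂ} {V V' : Base n → ℂ}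

/-- With zero defect, `Reduced.transfer` makes the new left-hand side, times |T_t|, the image of the
old one under an injective fibre map, so they vanish together. -/
theorem mapsEquation_of_determining (hU : IsOpen U) (hφ : ContDiffOn ℝ ∞ φ U)
    (hr : ∀ z ∈ U, Reduced (fderiv ℝ φ z) (D2 φ z))
    (h0 : ∀ z ∈ U, ∀ w, (fderiv ℝ φ z (0, w)).2 = 0 → w = 0)
    (hd : ∀ z ∈ U, Determining (fderiv ℝ φ z) (D2 φ z)
      (δ * z.2 * (Real.log ‖z.2‖ : ℂ) + V z.1 * z.2)
      (δ' * (φ z).2 * (Real.log ‖(φ z).2‖ : ℂ) + V' (φ z).1 * (φ z).2)) :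
    MapsEquation φ U δ V δ' V' := by
  intro p ψ ψ' hz hψ hψ' h
  have hc := hφ.contDiffAt (hU.mem_nhds hz)
  have P : Prolongs (fderiv ℝ φ (p, ψ p)) (D2 φ (p, ψ p)) (fderiv ℝ ψ p) (D2 ψ p)
      (fderiv ℝ ψ' (φ (p, ψ p)).1) (D2 ψ' (φ (p, ψ p)).1) :=
    ⟨fderiv_transformed hc hψ hψ' h, D2_transformed hc hψ hψ' h⟩
  have ht := (hr _ hz).transfer P (δ * ψ p * (Real.log ‖ψ p‖ : ℂ) + V p * ψ p)
    (δ' * (φ (p, ψ p)).2 * (Real.log ‖(φ (p, ψ p)).2‖ : ℂ)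
      + V' (φ (p, ψ p)).1 * (φ (p, ψ p)).2)
  rw [(hr _ hz).defect_eq_zero (hd _ hz), add_zero] at ht
  rw [satisfiesAt_iff hψ, satisfiesAt_iff hψ', h.self_of_nhds]
  have hρ : ((|timeRate (fderiv ℝ φ (p, ψ p))| : ℝ) : ℂ) ≠ 0 := by
    exact_mod_cast abs_ne_zero.2 (hr _ hz).rate
  constructor
  · intro e
    rw [e, ← Prod.zero_eq_mk, map_zero, Prod.snd_zero] at ht
    exact (mul_eq_zero.1 ht).resolve_left hρ
  · intro e
    rw [e, mul_zero] at ht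
    exact h0 _ hz _ ht.symm

/-- The coefficients of `x_a` in the phase of an equivalence transformation. -/
def phaseCoef (θ : ℝ) (X : Fin n → ℝ → ℝ) (O : Matrix (Fin n) (Fin n) ℝ) (a : Fin n) (t : ℝ) :
    ℝ :=
  ∑ b, Real.sign θ / (2 * |θ| ^ (1 / 2 : ℝ)) * O b a * deriv (X b) t

/-- The exponent of the multiplier of `ψ` in an equivalence transformation. -/
def stdExponent (θ : ℝ) (X : Fin n → ℝ → ℝ) (O : Matrix (Fin n) (Fin n) ℝ) (S Z : ℝ → ℝ)
    (z : Vars n) : ℂ :=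
  Complex.I * ((∑ a, phaseCoef θ X O a z.1.1 * z.1.2 a + S z.1.1 : ℝ) : ℂ) + (Z z.1.1 : ℂ)

/-- The action of an equivalence transformation on the variables, with `T = θ t + τ`. -/
def stdForm (θ τ : ℝ) (X : Fin n → ℝ → ℝ) (O : Matrix (Fin n) (Fin n) ℝ) (S Z : ℝ → ℝ)
    (z : Vars n) : Vars n :=
  ((θ * z.1.1 + τ, fun a => |θ| ^ (1 / 2 : ℝ) * ∑ b, O a b * z.1.2 b + X a z.1.1),
    Complex.exp (stdExponent θ X O S Z z) * hat θ z.2)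

section Std

variable {θ τ : ℝ} {X : Fin n → ℝ → ℝ} {O : Matrix (Fin n) (Fin n) ℝ} {S Z : ℝ → ℝ}
  {T : ℝ → ℝ}

theorem IsParam.exists_affine (h : IsParam U T X O S Z) (hU : IsPatch U) :
    ∃ θ τ : ℝ, θ ≠ 0 ∧ ∀ t ∈ times U, T t = θ * t + τ ∧ deriv T t = θ := by
  -- With no times present, any nonzero rate serves.
  rcases (times U).eq_empty_or_nonempty with he | ⟨t0, ht0⟩
  · exact ⟨1, 0, one_ne_zero, by simp [he]⟩
  have hI := isOpen_times hU.isOpen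
  have hTd : ∀ t ∈ times U, HasDerivAt T (deriv T t) t := fun t ht =>
    ((h.smooth_T.contDiffAt (hI.mem_nhds ht)).differentiableAt (by simp)).hasDerivAt
  have hTdd : ∀ t ∈ times U, HasDerivAt (deriv T) 0 t := by
    intro t ht
    have h1 := ((h.smooth_T.deriv_of_isOpen hI (m := ∞) (by simp)).contDiffAt
      (hI.mem_nhds ht)).differentiableAt (by simp)
    have h2 := h1.hasDerivAt
    rwa [(h.rate t ht).2] at h2
  have hc : ∀ t ∈ times U, deriv T t = deriv T t0 := fun t ht => const_on_times hU hTdd ht ht0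
  refine ⟨deriv T t0, T t0 - deriv T t0 * t0, (h.rate t0 ht0).1, fun t ht => ⟨?_, hc t ht⟩⟩
  have h3 : ∀ t ∈ times U, HasDerivAt (fun t => T t - deriv T t0 * t) 0 t := by
    intro t ht
    have h4 := (hTd t ht).sub ((hasDerivAt_id t).const_mul (deriv T t0))
    refine h4.congr_deriv ?_
    rw [hc t ht]; ring
  have h5 := const_on_times hU h3 ht ht0
  linarith

theorem stdForm_eq (h : IsParam U T X O S Z) (hT : ∀ t ∈ times U, T t = θ * t + τ ∧ deriv T t = θ)
    {t : ℝ} {x : Fin n → ℝ} {ψ : ℂ} (hz : ((t, x), ψ) ∈ U) :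
    ((T t, newX T X O t x), newPsi T X O S Z t x ψ) = stdForm θ τ X O S Z ((t, x), ψ) := by
  have ht : t ∈ times U := mem_times hz
  refine Prod.ext (Prod.ext ?_ ?_) ?_
  · exact (hT t ht).1
  · ext a
    simp [newX, stdForm, (hT t ht).2]
  · simp only [newPsi, stdForm, stdExponent, (hT t ht).2, (h.rate t ht).2, zero_div, mul_zero,
      zero_mul, zero_add]
    have : 1 / 2 * ∑ b, ∑ a, Real.sign θ * deriv (X b) t / |θ| ^ (1 / 2 : ℝ) * O b a * x a
        = ∑ a, phaseCoef θ X O a t * x a := by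
      rw [Finset.sum_comm, Finset.mul_sum]
      refine Finset.sum_congr rfl fun a _ => ?_
      rw [phaseCoef, Finset.mul_sum, Finset.sum_mul]
      exact Finset.sum_congr rfl fun b _ => by ring
    rw [this]

/-- Smoothness of the parameters over the set of values of `t`. -/
structure SmoothParam (U : Set (Vars n)) (θ : ℝ) (X : Fin n → ℝ → ℝ)
    (O : Matrix (Fin n) (Fin n) ℝ) (S Z : ℝ → ℝ) : Prop where
  isOpen : IsOpen U
  rate : θ ≠ 0
  smooth_X : ∀ a, ContDiffOn ℝ ∞ (X a) (times U)
  smooth_S : ContDiffOn ℝ ∞ S (times U)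
  smooth_Z : ContDiffOn ℝ ∞ Z (times U)
  orth : O ∈ Matrix.orthogonalGroup (Fin n) ℝ

end Std


end

/-! ### First and second derivatives of the standard form. -/

section
variable {U : Set (Vars n)} {θ τ : ℝ} {X : Fin n → ℝ → ℝ} {O : Matrix (Fin n) (Fin n) ℝ}
  {S Z : ℝ → ℝ}

theorem SmoothParam.phaseCoef_contDiffOn (h : SmoothParam U θ X O S Z) (a : Fin n) :
    ContDiffOn ℝ ∞ (phaseCoef θ X O a) (times U) :=
  ContDiffOn.sum fun b _ => contDiffOn_const.mul
    ((h.smooth_X b).deriv_of_isOpen (isOpen_times h.isOpen) (by simp))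

theorem contDiffOn_time_comp {f : ℝ → ℝ} (hf : ContDiffOn ℝ ∞ f (times U)) :
    ContDiffOn ℝ ∞ (fun z : Vars n => f z.1.1) U :=
  hf.comp (f := fun z : Vars n => z.1.1) (by fun_prop) fun _ hz => mem_times hz

theorem SmoothParam.differentiableAt (h : SmoothParam U θ X O S Z) {f : ℝ → ℝ}
    (hf : ContDiffOn ℝ ∞ f (times U)) {z : Vars n} (hz : z ∈ U) :
    DifferentiableAt ℝ f z.1.1 :=
  (hf.contDiffAt ((isOpen_times h.isOpen).mem_nhds (mem_times hz))).differentiableAt (by simp)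

theorem SmoothParam.stdForm_contDiffOn (h : SmoothParam U θ X O S Z) :
    ContDiffOn ℝ ∞ (stdForm θ τ X O S Z) U := by
  refine ContDiffOn.prodMk (ContDiffOn.prodMk (by fun_prop) ?_) (ContDiffOn.mul
    (ContDiffOn.cexp ?_) ?_)
  · rw [contDiffOn_pi]
    intro a
    exact ContDiffOn.add (by fun_prop) (contDiffOn_time_comp (h.smooth_X a))
  · refine ContDiffOn.add (contDiffOn_const.mul ?_)
      (Complex.ofRealCLM.contDiff.comp_contDiffOn (contDiffOn_time_comp h.smooth_Z))
    have h1 : ContDiffOn ℝ ∞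
        (fun z : Vars n => ∑ a, phaseCoef θ X O a z.1.1 * z.1.2 a + S z.1.1) U :=
      (ContDiffOn.sum fun a _ => (contDiffOn_time_comp (h.phaseCoef_contDiffOn a)).mul
        (by fun_prop)).add (contDiffOn_time_comp h.smooth_S)
    exact Complex.ofRealCLM.contDiff.comp_contDiffOn h1
  · have : ContDiff ℝ ∞ fun z : Vars n => hatL θ z.2 := by fun_prop
    simpa using this.contDiffOn

/-- The differential of the exponent of the multiplier of `ψ`. -/
def stdExponentDeriv (θ : ℝ) (X : Fin n → ℝ → ℝ) (O : Matrix (Fin n) (Fin n) ℝ) (S Z : ℝ → ℝ)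
    (z u : Vars n) : ℂ :=
  Complex.I * ((∑ a, (phaseCoef θ X O a z.1.1 * u.1.2 a
      + z.1.2 a * (deriv (phaseCoef θ X O a) z.1.1 * u.1.1)) + deriv S z.1.1 * u.1.1 : ℝ) : ℂ)
    + ((deriv Z z.1.1 * u.1.1 : ℝ) : ℂ)

theorem hasFDerivAt_time_comp {f : ℝ → ℝ} {z : Vars n} (hf : DifferentiableAt ℝ f z.1.1) :
    HasFDerivAt (fun y : Vars n => f y.1.1)
      (deriv f z.1.1 • tC.comp (ContinuousLinearMap.fst ℝ (Base n) ℂ)) z :=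
  hf.hasDerivAt.comp_hasFDerivAt (f := fun y : Vars n => y.1.1) z
    (tC.comp (ContinuousLinearMap.fst ℝ (Base n) ℂ)).hasFDerivAt

theorem SmoothParam.hasFDerivAt_exponent (h : SmoothParam U θ X O S Z) {z : Vars n}
    (hz : z ∈ U) : ∃ E : Vars n →L[ℝ] ℂ, HasFDerivAt (stdExponent θ X O S Z) E z ∧
      ∀ u, E u = stdExponentDeriv θ X O S Z z u := by
  have h1 := hasFDerivAt_phase (fun a => h.differentiableAt (h.phaseCoef_contDiffOn a) hz)
  have h2 := hasFDerivAt_time_comp (h.differentiableAt h.smooth_S hz)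
  have h3 := hasFDerivAt_time_comp (h.differentiableAt h.smooth_Z hz)
  have h4 := ((Complex.ofRealCLM.hasFDerivAt.comp z (h1.add h2)).const_mul Complex.I).add
    (Complex.ofRealCLM.hasFDerivAt.comp z h3)
  refine ⟨_, h4, fun u => ?_⟩
  simp only [stdExponentDeriv, add_apply, smul_apply, ContinuousLinearMap.comp_apply, sum_apply,
    tC_apply, xC_apply, ContinuousLinearMap.coe_fst', smul_eq_mul, Complex.ofRealCLM_apply]

theorem SmoothParam.fderiv_stdForm (h : SmoothParam U θ X O S Z) {z : Vars n} (hz : z ∈ U)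
    (u : Vars n) : fderiv ℝ (stdForm θ τ X O S Z) z u
      = ((θ * u.1.1, fun a => |θ| ^ (1 / 2 : ℝ) * ∑ b, O a b * u.1.2 b
          + deriv (X a) z.1.1 * u.1.1),
        (stdForm θ τ X O S Z z).2 * stdExponentDeriv θ X O S Z z u
          + Complex.exp (stdExponent θ X O S Z z) * hat θ u.2) := by
  obtain ⟨E, hE, hEu⟩ := h.hasFDerivAt_exponent hz
  have h1 : HasFDerivAt (fun y : Vars n => θ * y.1.1 + τ) _ z :=
    ((tC.comp (ContinuousLinearMap.fst ℝ (Base n) ℂ)).hasFDerivAt.const_mul θ).add_const τ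
  have h2 : HasFDerivAt (fun (y : Vars n) (a : Fin n) =>
      |θ| ^ (1 / 2 : ℝ) * ∑ b, O a b * y.1.2 b + X a y.1.1) _ z :=
    hasFDerivAt_pi.2 fun a => ((HasFDerivAt.fun_sum (u := Finset.univ) fun b _ =>
      ((xC b).comp (ContinuousLinearMap.fst ℝ (Base n) ℂ)).hasFDerivAt.const_mul
        (O a b)).const_mul (|θ| ^ (1 / 2 : ℝ))).add
      (hasFDerivAt_time_comp (h.differentiableAt (h.smooth_X a) hz))
  have h3 : HasFDerivAt (fun y : Vars n => hat θ y.2)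
      ((hatL θ).comp (ContinuousLinearMap.snd ℝ (Base n) ℂ)) z := by
    have e : (fun y : Vars n => hat θ y.2) =
        (hatL θ).comp (ContinuousLinearMap.snd ℝ (Base n) ℂ) := by
      ext1 y; simp
    rw [e]
    exact ContinuousLinearMap.hasFDerivAt _
  have h4 : HasFDerivAt (stdForm θ τ X O S Z) _ z := (h1.prodMk h2).prodMk (hE.cexp.mul h3)
  rw [h4.fderiv]
  refine Prod.ext (Prod.ext ?_ ?_) ?_
  · simp
  · ext a
    simp [sum_apply]
  · simp only [ContinuousLinearMap.prod_apply, add_apply, smul_apply,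
      ContinuousLinearMap.comp_apply, ContinuousLinearMap.coe_snd', hatL_apply, hEu, smul_eq_mul,
      stdForm]
    ring

theorem stdExponentDeriv_fiber (z : Vars n) (w : ℂ) :
    stdExponentDeriv θ X O S Z z (0, w) = 0 := by
  simp [stdExponentDeriv]

theorem stdExponentDeriv_spatial (z : Vars n) (a : Fin n) :
    stdExponentDeriv θ X O S Z z (ex a, 0) = Complex.I * (phaseCoef θ X O a z.1.1 : ℝ) := by
  simp [stdExponentDeriv, ex, Pi.single_apply]

theorem stdExponentDeriv_time (z : Vars n) :
    stdExponentDeriv θ X O S Z z (et, 0)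
      = Complex.I * ((∑ a, z.1.2 a * deriv (phaseCoef θ X O a) z.1.1 + deriv S z.1.1 : ℝ) : ℂ)
        + ((deriv Z z.1.1 : ℝ) : ℂ) := by
  simp [stdExponentDeriv, et]

section Derivatives

variable (h : SmoothParam U θ X O S Z) {z : Vars n} (hz : z ∈ U)
include h hz

theorem SmoothParam.fderiv_fiber (w : ℂ) : fderiv ℝ (stdForm θ τ X O S Z) z (0, w)
    = (0, Complex.exp (stdExponent θ X O S Z z) * hat θ w) := by
  rw [h.fderiv_stdForm hz, stdExponentDeriv_fiber]
  refine Prod.ext (Prod.ext ?_ ?_) ?_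
  · simp
  · ext a; simp
  · simp

theorem SmoothParam.fderiv_spatial (a : Fin n) : fderiv ℝ (stdForm θ τ X O S Z) z (ex a, 0)
    = ((0, fun b => |θ| ^ (1 / 2 : ℝ) * O b a), (stdForm θ τ X O S Z z).2
      * (Complex.I * (phaseCoef θ X O a z.1.1 : ℝ))) := by
  rw [h.fderiv_stdForm hz, stdExponentDeriv_spatial]
  refine Prod.ext (Prod.ext ?_ ?_) ?_
  · simp [ex]
  · ext b; simp [ex, Pi.single_apply]
  · simp

theorem SmoothParam.fderiv_time : fderiv ℝ (stdForm θ τ X O S Z) z (et, 0)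
    = ((θ, fun b => deriv (X b) z.1.1), (stdForm θ τ X O S Z z).2
      * (Complex.I * ((∑ a, z.1.2 a * deriv (phaseCoef θ X O a) z.1.1
        + deriv S z.1.1 : ℝ) : ℂ) + ((deriv Z z.1.1 : ℝ) : ℂ))) := by
  rw [h.fderiv_stdForm hz, stdExponentDeriv_time]
  refine Prod.ext (Prod.ext ?_ ?_) ?_
  · simp [et]
  · ext b; simp [et]
  · simp

theorem SmoothParam.timeRate_stdForm :
    timeRate (fderiv ℝ (stdForm θ τ X O S Z) z) = θ := by
  rw [timeRate, h.fderiv_time hz]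

theorem SmoothParam.fderiv_injective :
    Function.Injective (fderiv ℝ (stdForm θ τ X O S Z) z) := by
  rw [injective_iff_map_eq_zero]
  intro u hu
  rw [h.fderiv_stdForm hz] at hu
  have h1 : θ * u.1.1 = 0 := congrArg (fun y : Vars n => y.1.1) hu
  have h2 : u.1.1 = 0 := (mul_eq_zero.1 h1).resolve_left h.rate
  have hs : |θ| ^ (1 / 2 : ℝ) ≠ 0 := (Real.rpow_pos_of_pos (abs_pos.2 h.rate) _).ne'
  have h3 : O.mulVec u.1.2 = 0 := by
    ext a
    have h4 : |θ| ^ (1 / 2 : ℝ) * ∑ b, O a b * u.1.2 b + deriv (X a) z.1.1 * u.1.1 = 0 :=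
      congrArg (fun y : Vars n => y.1.2 a) hu
    rw [h2, mul_zero, add_zero] at h4
    exact (mul_eq_zero.1 h4).resolve_left hs
  have h5 : u.1.2 = 0 := by
    have h6 := congrArg (O.transpose.mulVec) h3
    rw [Matrix.mulVec_mulVec, Matrix.mulVec_zero] at h6
    have h7 : O.transpose * O = 1 := (Matrix.mem_orthogonalGroup_iff' (Fin n) ℝ).1 h.orth
    rwa [h7, Matrix.one_mulVec] at h6
  have h8 : u = (0, u.2) := Prod.ext (Prod.ext h2 h5) rfl
  have h9 := congrArg Prod.snd hu
  rw [h8] at h9 ⊢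
  simp only [stdExponentDeriv_fiber, mul_zero, zero_add, Prod.snd_zero] at h9
  have h10 := (mul_eq_zero.1 h9).resolve_left (Complex.exp_ne_zero _)
  have h11 : u.2 = 0 := by
    by_contra hne
    exact hat_ne_zero hne h10
  rw [h11]; rfl

theorem SmoothParam.reduced_stdForm :
    Reduced (fderiv ℝ (stdForm θ τ X O S Z) z) (D2 (stdForm θ τ X O S Z) z) := by
  have hs : |θ| ^ (1 / 2 : ℝ) * |θ| ^ (1 / 2 : ℝ) = |θ| := by
    rw [← Real.rpow_add (abs_pos.2 h.rate)]; norm_num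
  have hcd := h.stdForm_contDiffOn (τ := τ)
  have ht : ∀ y ∈ U, ∀ v w, (fderiv ℝ (stdForm θ τ X O S Z) y ((0, v), w)).1.1 = 0 := by
    intro y hy v w
    rw [h.fderiv_stdForm hy]; simp
  refine
  { time := ht z hz
    base := fun w => by rw [h.fderiv_fiber hz]
    rate := by rw [h.timeRate_stdForm hz]; exact h.rate
    orth := fun b c => ?_
    conj := fun s => ?_
    time2 := fun v w v' w' => D2_clm_eq_zero h.isOpen hcd
      (tC.comp (ContinuousLinearMap.fst ℝ (Base n) ℂ)) ((0, v'), w')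
      (fun y hy => ht y hy v' w') hz _
    base2 := fun u w => D2_clm_eq_zero h.isOpen hcd (ContinuousLinearMap.fst ℝ (Base n) ℂ) (0, w)
      (fun y hy => by rw [h.fderiv_fiber hy]; rfl) hz u
    symm := D2_symm (hcd.contDiffAt (h.isOpen.mem_nhds hz)) }
  · rw [h.timeRate_stdForm hz]
    have h1 : ∑ a, O b a * O.transpose a c = (1 : Matrix (Fin n) (Fin n) ℝ) b c := by
      rw [← Matrix.mul_apply]
      exact congrFun (congrFun ((Matrix.mem_orthogonalGroup_iff (Fin n) ℝ).1 h.orth) b) c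
    have h2 : ∀ a, (fderiv ℝ (stdForm θ τ X O S Z) z (ex a, 0)).1.2 b
        * (fderiv ℝ (stdForm θ τ X O S Z) z (ex a, 0)).1.2 c
        = |θ| * (O b a * O.transpose a c) := by
      intro a
      rw [h.fderiv_spatial hz, Matrix.transpose_apply]
      linear_combination (O b a * O c a) * hs
    rw [Finset.sum_congr rfl fun a _ => h2 a, ← Finset.mul_sum, h1, Matrix.one_apply]
    split_ifs <;> simp
  · rw [h.timeRate_stdForm hz, h.fderiv_fiber hz, h.fderiv_fiber hz]
    simp only
    rw [hat_mul, hat_I h.rate]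
    ring

theorem SmoothParam.second_fiber (u : Vars n) (w : ℂ) :
    (D2 (stdForm θ τ X O S Z) z u (0, w)).2
      = Complex.exp (stdExponent θ X O S Z z) * stdExponentDeriv θ X O S Z z u * hat θ w := by
  have hcd := h.stdForm_contDiffOn (τ := τ) |>.contDiffAt (h.isOpen.mem_nhds hz)
  obtain ⟨E, hE, hEu⟩ := h.hasFDerivAt_exponent hz
  have h1 := hasFDerivAt_fderiv_snd hcd (0, w)
  have h2 := hE.cexp.mul_const (hat θ w)
  have h3 : (fun y => (fderiv ℝ (stdForm θ τ X O S Z) y (0, w)).2) =ᶠ[𝓝 z]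
      fun y => Complex.exp (stdExponent θ X O S Z y) * hat θ w := by
    filter_upwards [h.isOpen.mem_nhds hz] with y hy
    rw [h.fderiv_fiber hy]
  have h4 := DFunLike.congr_fun (h1.unique (h2.congr_of_eventuallyEq h3)) u
  simp only [ContinuousLinearMap.comp_apply, ContinuousLinearMap.coe_snd',
    ContinuousLinearMap.flip_apply, smul_apply, hEu, smul_eq_mul] at h4
  rw [h4]; ring

theorem SmoothParam.second_spatial_fst (u : Vars n) (a : Fin n) :
    (D2 (stdForm θ τ X O S Z) z u (ex a, 0)).1 = 0 :=
  D2_clm_eq_zero h.isOpen h.stdForm_contDiffOn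
    (ContinuousLinearMap.fst ℝ (Base n) ℂ) (ex a, 0)
    (k := (0, fun b => |θ| ^ (1 / 2 : ℝ) * O b a))
    (fun y hy => by rw [h.fderiv_spatial hy]; rfl) hz u

theorem SmoothParam.second_spatial_snd (a : Fin n) :
    (D2 (stdForm θ τ X O S Z) z (ex a, 0) (ex a, 0)).2
      = (stdForm θ τ X O S Z z).2 * (Complex.I * (phaseCoef θ X O a z.1.1 : ℝ)) ^ 2 := by
  have hcd := h.stdForm_contDiffOn (τ := τ) |>.contDiffAt (h.isOpen.mem_nhds hz)
  have h1 := hasFDerivAt_fderiv_snd hcd (ex a, 0)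
  have hd := (hcd.differentiableAt (by simp)).hasFDerivAt.snd
  have h2 := hd.mul ((Complex.ofRealCLM.hasFDerivAt.comp z (hasFDerivAt_time_comp
    (h.differentiableAt (h.phaseCoef_contDiffOn a) hz))).const_mul Complex.I)
  have h3 : (fun y => (fderiv ℝ (stdForm θ τ X O S Z) y (ex a, 0)).2) =ᶠ[𝓝 z]
      (fun x => (stdForm θ τ X O S Z x).2) * fun y =>
        Complex.I * (⇑Complex.ofRealCLM ∘ fun y : Vars n => phaseCoef θ X O a y.1.1) y := by
    filter_upwards [h.isOpen.mem_nhds hz] with y hy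
    rw [h.fderiv_spatial hy]
    rfl
  have h4 := DFunLike.congr_fun (h1.unique (h2.congr_of_eventuallyEq h3)) (ex a, 0)
  simp only [ContinuousLinearMap.comp_apply, ContinuousLinearMap.coe_snd', add_apply,
    ContinuousLinearMap.flip_apply, smul_apply, tC_apply, ContinuousLinearMap.coe_fst', ex,
    smul_eq_mul, mul_zero, map_zero, zero_add, Function.comp_apply,
    Complex.ofRealCLM_apply] at h4
  have h5 := h.fderiv_spatial (τ := τ) hz a
  simp only [ex] at h5 ⊢
  rw [h4, h5]
  ring

end Derivatives


end

/-! ### The standard form satisfies the determining equations. -/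

section
variable {U : Set (Vars n)} {θ τ : ℝ} {X : Fin n → ℝ → ℝ} {O : Matrix (Fin n) (Fin n) ℝ}
  {S Z : ℝ → ℝ}

theorem signType_sign_eq (r : ℝ) : ((SignType.sign r : SignType) : ℝ) = Real.sign r := by
  rcases lt_trichotomy r 0 with h | rfl | h
  · rw [Real.sign_of_neg h, sign_neg h]; simp
  · simp
  · rw [Real.sign_of_pos h, sign_pos h]; simp

theorem real_sign_sq (h : θ ≠ 0) : Real.sign θ * Real.sign θ = 1 := by
  rcases lt_or_gt_of_ne h with h | h
  · rw [Real.sign_of_neg h]; ring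
  · rw [Real.sign_of_pos h]; ring

theorem sqrt_rate_sq (h : θ ≠ 0) : |θ| ^ (1 / 2 : ℝ) * |θ| ^ (1 / 2 : ℝ) = |θ| := by
  rw [← Real.rpow_add (abs_pos.2 h)]; norm_num

/-- The action of an equivalence transformation with `T_t = θ` on the values of `V`. -/
def stdV (θ : ℝ) (X : Fin n → ℝ → ℝ) (O : Matrix (Fin n) (Fin n) ℝ) (S Z : ℝ → ℝ)
    (p : Base n) (δ v : ℂ) : ℂ :=
  hat θ v / ((|θ| : ℝ) : ℂ)
    + ((∑ b, ∑ a, deriv (deriv (X b)) p.1 / (2 * |θ| ^ (3 / 2 : ℝ)) * O b a * p.2 a : ℝ) : ℂ)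
    - hat θ δ * ((Z p.1 / |θ| : ℝ) : ℂ)
    - ((1 / 4 * ∑ a, deriv (X a) p.1 * deriv (X a) p.1 / θ ^ 2 : ℝ) : ℂ)
    + (((deriv S p.1 : ℝ) : ℂ) - Complex.I * ((deriv Z p.1 : ℝ) : ℂ)) / (θ : ℂ)

theorem newV_eq_stdV {T : ℝ → ℝ} {t : ℝ} (hT : deriv T t = θ) (x : Fin n → ℝ) (δ v : ℂ) :
    newV T X O S Z t x δ v = stdV θ X O S Z (t, x) δ v := by
  subst hT; rfl

theorem log_norm_stdForm {z : Vars n} (hz : z.2 ≠ 0) :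
    Real.log ‖(stdForm θ τ X O S Z z).2‖ = Z z.1.1 + Real.log ‖z.2‖ := by
  have h1 : (stdExponent θ X O S Z z).re = Z z.1.1 := by
    simp [stdExponent, -Complex.ofReal_sum, -Complex.ofReal_add]
  rw [stdForm, norm_mul, norm_hat, Complex.norm_exp, h1, Real.log_mul (Real.exp_ne_zero _)
    (norm_ne_zero_iff.2 hz), Real.log_exp]

/-- Source of the term −𝒳_t²/(4T_t²) in the new V: orthogonality of O removes it from the squared
phase gradient. -/
theorem sum_sq_phaseCoef (hθ : θ ≠ 0) (hO : O ∈ Matrix.orthogonalGroup (Fin n) ℝ) (t : ℝ) :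
    ∑ a, phaseCoef θ X O a t ^ 2 = |θ| * (1 / 4 * ∑ a, deriv (X a) t * deriv (X a) t / θ ^ 2) := by
  set k : ℝ := Real.sign θ / (2 * |θ| ^ (1 / 2 : ℝ)) with hk
  set y : Fin n → ℝ := fun b => deriv (X b) t with hy
  have h1 : ∀ a, phaseCoef θ X O a t = k * (O.transpose.mulVec y) a := by
    intro a
    simp only [phaseCoef, Matrix.mulVec, dotProduct, Matrix.transpose_apply, Finset.mul_sum, ← hk,
      mul_assoc, hy]
  have h2 : ∑ a, (O.transpose.mulVec y) a * (O.transpose.mulVec y) a = ∑ a, y a * y a := by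
    change (O.transpose.mulVec y) ⬝ᵥ (O.transpose.mulVec y) = y ⬝ᵥ y
    rw [Matrix.dotProduct_mulVec, Matrix.vecMul_transpose, Matrix.mulVec_mulVec,
      (Matrix.mem_orthogonalGroup_iff (Fin n) ℝ).1 hO, Matrix.one_mulVec]
  have hs := sqrt_rate_sq hθ
  have hρ : |θ| ≠ 0 := abs_ne_zero.2 hθ
  have h3 : k ^ 2 = 1 / (4 * |θ|) := by
    rw [hk, div_pow, pow_two (Real.sign θ), real_sign_sq hθ, mul_pow, pow_two (_ ^ (1 / 2 : ℝ)), hs]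
    norm_num
  simp only [h1, mul_pow, h3]
  rw [← Finset.mul_sum, ← Finset.sum_div]
  simp only [pow_two] at h2 ⊢
  rw [h2, ← abs_mul_abs_self θ]
  field_simp
  rfl

/-- Source of the 𝒳_tt term in the new V: it is the t-derivative of the x-linear phase. -/
theorem sum_deriv_phaseCoef {t : ℝ} (hX : ∀ b, DifferentiableAt ℝ (deriv (X b)) t) (hθ : θ ≠ 0)
    (x : Fin n → ℝ) : Real.sign θ * ∑ a, x a * deriv (phaseCoef θ X O a) t
      = |θ| * ∑ b, ∑ a, deriv (deriv (X b)) t / (2 * |θ| ^ (3 / 2 : ℝ)) * O b a * x a := by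
  have h1 : ∀ a, deriv (phaseCoef θ X O a) t
      = ∑ b, Real.sign θ / (2 * |θ| ^ (1 / 2 : ℝ)) * O b a * deriv (deriv (X b)) t := fun a =>
    (HasDerivAt.fun_sum fun b _ => (hX b).hasDerivAt.const_mul _).deriv
  have h2 : |θ| ^ (3 / 2 : ℝ) = |θ| * |θ| ^ (1 / 2 : ℝ) := by
    rw [show (3 / 2 : ℝ) = 1 + 1 / 2 by norm_num, Real.rpow_add (abs_pos.2 hθ), Real.rpow_one]
  have hρ : |θ| ≠ 0 := abs_ne_zero.2 hθ
  have hs : |θ| ^ (1 / 2 : ℝ) ≠ 0 := (Real.rpow_pos_of_pos (abs_pos.2 hθ) _).ne'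
  rw [Finset.sum_comm, Finset.mul_sum, Finset.mul_sum]
  refine Finset.sum_congr rfl fun a _ => ?_
  rw [h1, h2, Finset.mul_sum, Finset.mul_sum, Finset.mul_sum]
  refine Finset.sum_congr rfl fun b _ => ?_
  have h3 := real_sign_sq hθ
  field_simp
  linear_combination (x a * O b a * deriv (deriv (X b)) t) * h3

section Derivatives

variable (h : SmoothParam U θ X O S Z) {z : Vars n} (hz : z ∈ U)
include h hz

/-- The phase coefficients are half the drift up to the factor i, which is what the linear
determining equation asks for. -/
theorem SmoothParam.drift_stdForm (a : Fin n) :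
    drift (fderiv ℝ (stdForm θ τ X O S Z) z) (D2 (stdForm θ τ X O S Z) z) a
      = 2 * (Complex.I * (phaseCoef θ X O a z.1.1 : ℝ)) := by
  have h1 : (∑ c : Fin n, D2 (stdForm θ τ X O S Z) z (ex c, 0) (ex c, 0)).1 = 0 := by
    rw [Prod.fst_sum]
    exact Finset.sum_eq_zero fun c _ => h.second_spatial_fst hz _ c
  have hs := sqrt_rate_sq h.rate
  have hs0 : |θ| ^ (1 / 2 : ℝ) ≠ 0 := (Real.rpow_pos_of_pos (abs_pos.2 h.rate) _).ne'
  rw [drift, h1, h.timeRate_stdForm hz, h.fderiv_spatial hz, h.fderiv_time hz, signType_sign_eq]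
  dsimp only
  rw [phaseCoef, Complex.ofReal_sum, Finset.mul_sum, Finset.mul_sum, Finset.sum_div]
  refine Finset.sum_congr rfl fun b _ => ?_
  simp only [Prod.snd_zero, Pi.zero_apply, Complex.ofReal_zero, add_zero]
  nth_rewrite 2 [← hs]
  have : ((|θ| ^ (1 / 2 : ℝ) : ℝ) : ℂ) ≠ 0 := by exact_mod_cast hs0
  push_cast
  field_simp

/-- After division by the new ψ, the drift and the second x-derivatives together contribute the
squared phase gradient, the t-derivative contributes Σ_t, Z_t and the 𝒳_tt term, and ln|ψ| shifts by
Z, giving −δ̂Z. Collecting these is the definition of `stdV`. -/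
theorem SmoothParam.free_stdForm (h0 : z.2 ≠ 0) (δ v : ℂ) :
    defect (fderiv ℝ (stdForm θ τ X O S Z) z) (D2 (stdForm θ τ X O S Z) z)
      (δ * z.2 * (Real.log ‖z.2‖ : ℂ) + v * z.2)
      (hat θ δ / (|θ| : ℝ) * (stdForm θ τ X O S Z z).2
          * (Real.log ‖(stdForm θ τ X O S Z z).2‖ : ℂ)
        + stdV θ X O S Z z.1 δ v * (stdForm θ τ X O S Z z).2) 0 = 0 := by
  have hρ : ((|θ| : ℝ) : ℂ) ≠ 0 := by exact_mod_cast abs_ne_zero.2 h.rate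
  have hθ : (θ : ℂ) ≠ 0 := by exact_mod_cast h.rate
  have e1 : ((|θ| : ℝ) : ℂ) * ((1 / 4 * ∑ a, deriv (X a) z.1.1 * deriv (X a) z.1.1 / θ ^ 2 : ℝ) : ℂ)
      = ∑ a, (phaseCoef θ X O a z.1.1 : ℂ) ^ 2 := by
    rw [← Complex.ofReal_mul, ← sum_sq_phaseCoef h.rate h.orth]; push_cast; rfl
  have e2 : ((|θ| : ℝ) : ℂ) * ((∑ b, ∑ a, deriv (deriv (X b)) z.1.1 / (2 * |θ| ^ (3 / 2 : ℝ))
      * O b a * z.1.2 a : ℝ) : ℂ)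
      = (Real.sign θ : ℂ) * ((∑ a, z.1.2 a * deriv (phaseCoef θ X O a) z.1.1 : ℝ) : ℂ) := by
    rw [← Complex.ofReal_mul, ← Complex.ofReal_mul, sum_deriv_phaseCoef (fun b => ?_) h.rate]
    exact h.differentiableAt ((h.smooth_X b).deriv_of_isOpen (isOpen_times h.isOpen)
      (by simp)) hz
  have e3 : ((|θ| : ℝ) : ℂ) / (θ : ℂ) = (Real.sign θ : ℂ) := by
    rw [div_eq_iff hθ]
    have : |θ| = Real.sign θ * θ := by
      nth_rewrite 3 [← real_sign_mul_abs θ]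
      rw [← mul_assoc, real_sign_sq h.rate, one_mul]
    exact_mod_cast this
  simp only [defect, Pi.zero_apply]
  simp only [h.drift_stdForm hz, h.second_spatial_snd hz, h.fderiv_fiber hz,
    h.timeRate_stdForm hz, signType_sign_eq, hat_zero, mul_zero, add_zero]
  simp only [h.fderiv_spatial hz, h.fderiv_time hz, log_norm_stdForm h0]
  have e4 : ∑ a, 2 * (Complex.I * (phaseCoef θ X O a z.1.1 : ℂ))
        * ((stdForm θ τ X O S Z z).2 * (Complex.I * (phaseCoef θ X O a z.1.1 : ℂ)))
      = -2 * (stdForm θ τ X O S Z z).2 * ∑ a, (phaseCoef θ X O a z.1.1 : ℂ) ^ 2 := by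
    rw [Finset.mul_sum]
    refine Finset.sum_congr rfl fun a _ => ?_
    linear_combination (2 * (stdForm θ τ X O S Z z).2 * (phaseCoef θ X O a z.1.1 : ℂ) ^ 2)
      * Complex.I_sq
  have e5 : ∑ a, (stdForm θ τ X O S Z z).2 * (Complex.I * (phaseCoef θ X O a z.1.1 : ℂ)) ^ 2
      = - (stdForm θ τ X O S Z z).2 * ∑ a, (phaseCoef θ X O a z.1.1 : ℂ) ^ 2 := by
    rw [Finset.mul_sum]
    refine Finset.sum_congr rfl fun a _ => ?_
    linear_combination ((stdForm θ τ X O S Z z).2 * (phaseCoef θ X O a z.1.1 : ℂ) ^ 2)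
      * Complex.I_sq
  have e6 : Complex.exp (stdExponent θ X O S Z z)
        * hat θ (δ * z.2 * (Real.log ‖z.2‖ : ℂ) + v * z.2)
      = (stdForm θ τ X O S Z z).2 * (hat θ δ * (Real.log ‖z.2‖ : ℂ) + hat θ v) := by
    simp only [hat_add, hat_mul, hat_ofReal, stdForm]; ring
  rw [e4, e5, e6]
  set Ψ := (stdForm θ τ X O S Z z).2
  have e7 : ((|θ| : ℝ) : ℂ) * stdV θ X O S Z z.1 δ v = hat θ v
      + (Real.sign θ : ℂ) * ((∑ a, z.1.2 a * deriv (phaseCoef θ X O a) z.1.1 : ℝ) : ℂ)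
      - hat θ δ * (Z z.1.1 : ℂ) - ∑ a, (phaseCoef θ X O a z.1.1 : ℂ) ^ 2
      + (Real.sign θ : ℂ) * (((deriv S z.1.1 : ℝ) : ℂ)
        - Complex.I * ((deriv Z z.1.1 : ℝ) : ℂ)) := by
    rw [stdV, ← e1, ← e2, ← e3]
    push_cast
    field_simp
  have e8 : ((|θ| : ℝ) : ℂ) * (hat θ δ / ((|θ| : ℝ) : ℂ)) = hat θ δ := mul_div_cancel₀ _ hρ
  rw [Complex.ofReal_add, Complex.ofReal_add]
  linear_combination Ψ * e7 + Ψ * ((Z z.1.1 : ℂ) + (Real.log ‖z.2‖ : ℂ)) * e8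
    + (Real.sign θ : ℂ) * Ψ * (((∑ a, z.1.2 a * deriv (phaseCoef θ X O a) z.1.1 : ℝ) : ℂ)
      + (deriv S z.1.1 : ℝ)) * Complex.I_sq

theorem SmoothParam.determining_stdForm (h0 : z.2 ≠ 0) (δ v : ℂ) :
    Determining (fderiv ℝ (stdForm θ τ X O S Z) z) (D2 (stdForm θ τ X O S Z) z)
      (δ * z.2 * (Real.log ‖z.2‖ : ℂ) + v * z.2)
      (hat θ δ / (|θ| : ℝ) * (stdForm θ τ X O S Z z).2
          * (Real.log ‖(stdForm θ τ X O S Z z).2‖ : ℂ)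
        + stdV θ X O S Z z.1 δ v * (stdForm θ τ X O S Z z).2) where
  quadratic w := by
    rw [h.second_fiber hz, stdExponentDeriv_fiber, mul_zero, zero_mul]
  linear a w := by
    rw [h.second_fiber hz, stdExponentDeriv_spatial, h.drift_stdForm hz, h.fderiv_fiber hz]
    ring
  free := h.free_stdForm hz h0 δ v

end Derivatives


end

/-! ### Equivalence transformations, normalization and the description of the group. -/

section
variable {φ : Vars n → Vars n} {U : Set (Vars n)} {δ δ' : ℂ} {V V' : Base n → ℂ}
  {θ τ : ℝ} {X : Fin n → ℝ → ℝ} {O : Matrix (Fin n) (Fin n) ℝ} {S Z : ℝ → ℝ}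

theorem isInvertible_of_injective {E : Type*} [NormedAddCommGroup E] [NormedSpace ℝ E]
    [FiniteDimensional ℝ E] {f : E →L[ℝ] E} (hf : Function.Injective f) : f.IsInvertible :=
  ⟨(LinearEquiv.ofInjectiveEndo (f : E →ₗ[ℝ] E) hf).toContinuousLinearEquiv, by ext x; rfl⟩

theorem IsDiffeoOn.congr {E : Type*} [NormedAddCommGroup E] [NormedSpace ℝ E] {f g : E → E}
    {U : Set E} (h : IsDiffeoOn f U) (hfg : Set.EqOn g f U) : IsDiffeoOn g U := by
  refine ⟨h.1, h.2.1.congr hfg, h.2.2.1.congr hfg.symm, fun z hz => ?_⟩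
  rw [(hfg.eventuallyEq_of_mem (h.1.mem_nhds hz)).fderiv_eq]
  exact h.2.2.2 z hz

theorem IsPointTransformation.mono (h : IsPointTransformation φ U) {W : Set (Vars n)}
    (hW : W ⊆ U) (ho : IsOpen W) : IsPointTransformation φ W :=
  ⟨⟨ho, h.1.2.1.mono hW, h.1.2.2.1.mono hW, fun z hz => h.1.2.2.2 z (hW hz)⟩,
    hW.trans h.2.1, h.2.2.mono_left hW⟩

theorem hat_injective (s : ℝ) : Function.Injective (hat s) := fun x y hxy => by
  rw [← hat_hat s x, hxy, hat_hat]

/-- The inverse of the action of an equivalence transformation on `(t, x)`. -/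
def stdInv (θ τ : ℝ) (X : Fin n → ℝ → ℝ) (O : Matrix (Fin n) (Fin n) ℝ) (y : Base n) : Base n :=
  ((y.1 - τ) / θ, fun a => (∑ b, O b a * (y.2 b - X b ((y.1 - τ) / θ))) / |θ| ^ (1 / 2 : ℝ))

/-- The new (t, x) does not involve ψ, so functions of the old (t, x), V in particular, can be
carried to the target; no restriction to `U` is needed. -/
theorem stdInv_stdForm (hθ : θ ≠ 0) (hO : O ∈ Matrix.orthogonalGroup (Fin n) ℝ) (z : Vars n) :
    stdInv θ τ X O (stdForm θ τ X O S Z z).1 = z.1 := by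
  have hs : |θ| ^ (1 / 2 : ℝ) ≠ 0 := (Real.rpow_pos_of_pos (abs_pos.2 hθ) _).ne'
  have h1 : (θ * z.1.1 + τ - τ) / θ = z.1.1 := by field_simp; ring
  refine Prod.ext h1 ?_
  ext a
  have h2 : O.transpose.mulVec (O.mulVec z.1.2) = z.1.2 := by
    rw [Matrix.mulVec_mulVec, show O.transpose * O = 1 from
      (Matrix.mem_orthogonalGroup_iff' (Fin n) ℝ).1 hO, Matrix.one_mulVec]
  have h3 : ∑ b, O b a * ∑ c, O b c * z.1.2 c = z.1.2 a := congrFun h2 a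
  have h4 : ∀ b, (stdForm θ τ X O S Z z).1.2 b - X b z.1.1
      = |θ| ^ (1 / 2 : ℝ) * ∑ c, O b c * z.1.2 c := fun b => add_sub_cancel_right _ _
  change (∑ b, O b a * ((stdForm θ τ X O S Z z).1.2 b - X b ((θ * z.1.1 + τ - τ) / θ)))
    / |θ| ^ (1 / 2 : ℝ) = z.1.2 a
  simp only [h1, h4]
  rw [div_eq_iff hs, ← h3, Finset.sum_mul]
  exact Finset.sum_congr rfl fun b _ => by ring

theorem stdForm_ne_zero {z : Vars n} (hz : z.2 ≠ 0) : (stdForm θ τ X O S Z z).2 ≠ 0 :=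
  mul_ne_zero (Complex.exp_ne_zero _) (hat_ne_zero hz)

theorem stdForm_injective (hθ : θ ≠ 0) (hO : O ∈ Matrix.orthogonalGroup (Fin n) ℝ) :
    Function.Injective (stdForm θ τ X O S Z) := by
  intro z y hzy
  have h1 : z.1 = y.1 := by
    rw [← stdInv_stdForm (τ := τ) (X := X) (S := S) (Z := Z) hθ hO z, hzy, stdInv_stdForm hθ hO]
  have h2 : stdExponent θ X O S Z z = stdExponent θ X O S Z y := by simp only [stdExponent, h1]
  have h3 := congrArg Prod.snd hzy
  simp only [stdForm, h2] at h3
  exact Prod.ext h1 (hat_injective θ (mul_left_cancel₀ (Complex.exp_ne_zero _) h3))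

theorem SmoothParam.isPointTransformation (h : SmoothParam U θ X O S Z) (hU : U ⊆ regular n) :
    IsPointTransformation (stdForm θ τ X O S Z) U :=
  ⟨⟨h.isOpen, h.stdForm_contDiffOn, (stdForm_injective h.rate h.orth).injOn,
    fun _ hz => isInvertible_of_injective (h.fderiv_injective hz)⟩, hU,
    fun _ hz => stdForm_ne_zero (hU hz)⟩

/-- The values of the arbitrary elements of the transformed equation are uniquely determined. -/
theorem SmoothParam.elements_eq (h : SmoothParam U θ X O S Z)
    (hM : MapsEquation φ U δ V δ' V') (hφ : IsPointTransformation φ U) (hn : 1 ≤ n) (hδ : δ ≠ 0)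
    (he : Set.EqOn φ (stdForm θ τ X O S Z) U) {z : Vars n} (hz : z ∈ U) :
    δ' = hat θ δ / (|θ| : ℝ) ∧ V' (φ z).1 = stdV θ X O S Z z.1 δ (V z.1) := by
  have hρ : ((|θ| : ℝ) : ℂ) ≠ 0 := by exact_mod_cast abs_ne_zero.2 h.rate
  have hev := he.eventuallyEq_of_mem (h.isOpen.mem_nhds hz)
  have h1 := (hM.homogeneous hφ hn hδ hz).2
  have h2 := (hM.determining hφ.1 hn hz).free
  have h3 := h.free_stdForm (τ := τ) hz (hφ.2.1 hz) δ (V z.1)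
  rw [hev.fderiv_eq, h.timeRate_stdForm hz] at h1
  have hδ' : δ' = hat θ δ / (|θ| : ℝ) := by rw [h1, mul_div_cancel_left₀ _ hρ]
  refine ⟨hδ', ?_⟩
  rw [hev.fderiv_eq, D2_congr hev, he hz, hδ'] at h2
  rw [he hz]
  simp only [defect, h.timeRate_stdForm hz] at h2 h3
  -- The free equations for `V'` and for `stdV` differ only in this term, whose coefficient is
  -- nonzero.
  have h4 : ((|θ| : ℝ) : ℂ) * (stdForm θ τ X O S Z z).2
      * (V' (stdForm θ τ X O S Z z).1 - stdV θ X O S Z z.1 δ (V z.1)) = 0 := by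
    linear_combination h2 - h3
  exact sub_eq_zero.1 ((mul_eq_zero.1 h4).resolve_left
    (mul_ne_zero hρ (stdForm_ne_zero (hφ.2.1 hz))))

theorem contDiffOn_time {f : ℝ → ℝ} (hf : ContDiffOn ℝ ∞ f (times U)) :
    ContDiffOn ℝ ∞ (fun p : Base n => f p.1) (Prod.fst '' U) :=
  hf.comp (f := fun p : Base n => p.1) (by fun_prop) (by
    rintro _ ⟨z, hz, rfl⟩; exact mem_times hz)

theorem SmoothParam.stdV_contDiffOn (h : SmoothParam U θ X O S Z) :
    ContDiffOn ℝ ∞ (fun e : Base n × (ℂ × ℂ) => stdV θ X O S Z e.1 e.2.1 e.2.2)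
      ((Prod.fst '' U) ×ˢ Set.univ) := by
  have hI := isOpen_times h.isOpen
  have hT : ∀ {f : ℝ → ℝ}, ContDiffOn ℝ ∞ f (times U) →
      ContDiffOn ℝ ∞ (fun e : Base n × (ℂ × ℂ) => f e.1.1) ((Prod.fst '' U) ×ˢ Set.univ) :=
    fun hf => (contDiffOn_time hf).comp (f := Prod.fst) contDiff_fst.contDiffOn fun e he => he.1
  have hd : ∀ {f : ℝ → ℝ}, ContDiffOn ℝ ∞ f (times U) → ContDiffOn ℝ ∞ (deriv f) (times U) :=
    fun hf => hf.deriv_of_isOpen hI (by simp)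
  have hc : ∀ {f : Base n × (ℂ × ℂ) → ℝ} {s}, ContDiffOn ℝ ∞ f s →
      ContDiffOn ℝ ∞ (fun e => (f e : ℂ)) s := fun hf =>
    Complex.ofRealCLM.contDiff.comp_contDiffOn hf
  have hh : ∀ l : (ℂ × ℂ) →L[ℝ] ℂ, ContDiff ℝ ∞ fun e : Base n × (ℂ × ℂ) => hat θ (l e.2) := by
    intro l
    have : ContDiff ℝ ∞ fun e : Base n × (ℂ × ℂ) => hatL θ (l e.2) := by fun_prop
    simpa using this
  refine ContDiffOn.add (ContDiffOn.sub (ContDiffOn.sub (ContDiffOn.add ?_ (hc ?_)) ?_) (hc ?_)) ?_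
  · exact (hh (ContinuousLinearMap.snd ℝ ℂ ℂ)).contDiffOn.div_const _
  · exact ContDiffOn.sum fun b _ => ContDiffOn.sum fun a _ =>
      (((hT (hd (hd (h.smooth_X b)))).div_const _).mul contDiffOn_const).mul (by fun_prop)
  · exact (hh (ContinuousLinearMap.fst ℝ ℂ ℂ)).contDiffOn.mul (hc ((hT h.smooth_Z).div_const _))
  · exact contDiffOn_const.mul (ContDiffOn.sum fun a _ =>
      ((hT (hd (h.smooth_X a))).mul (hT (hd (h.smooth_X a)))).div_const _)
  · exact ((hc (hT (hd h.smooth_S))).sub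
      (contDiffOn_const.mul (hc (hT (hd h.smooth_Z))))).div_const _

theorem SmoothParam.stdInv_contDiffOn (h : SmoothParam U θ X O S Z) :
    ContDiffOn ℝ ∞ (stdInv θ τ X O) (Prod.fst '' (stdForm θ τ X O S Z '' U)) := by
  have h1 : ContDiff ℝ ∞ fun y : Base n => (y.1 - τ) / θ := by fun_prop
  refine h1.contDiffOn.prodMk (contDiffOn_pi.2 fun a => ContDiffOn.div_const
    (ContDiffOn.sum fun b _ => contDiffOn_const.mul (ContDiffOn.sub (by fun_prop)
      ((h.smooth_X b).comp h1.contDiffOn ?_))) _)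
  rintro _ ⟨_, ⟨z, hz, rfl⟩, rfl⟩
  have h2 := congrArg Prod.fst (stdInv_stdForm (τ := τ) (X := X) (S := S) (Z := Z) h.rate h.orth z)
  change (stdInv θ τ X O (stdForm θ τ X O S Z z).1).1 ∈ times U
  rw [h2]
  exact mem_times hz

/-- The function `V` of the transformed equation. -/
def stdPotential (θ τ : ℝ) (X : Fin n → ℝ → ℝ) (O : Matrix (Fin n) (Fin n) ℝ) (S Z : ℝ → ℝ)
    (δ : ℂ) (V : Base n → ℂ) (y : Base n) : ℂ :=
  stdV θ X O S Z (stdInv θ τ X O y) δ (V (stdInv θ τ X O y))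

theorem SmoothParam.stdPotential_stdForm (h : SmoothParam U θ X O S Z) (z : Vars n) :
    stdPotential θ τ X O S Z δ V (stdForm θ τ X O S Z z).1
      = stdV θ X O S Z z.1 δ (V z.1) := by
  rw [stdPotential, stdInv_stdForm h.rate h.orth]

theorem SmoothParam.isAdmissible (h : SmoothParam U θ X O S Z) (hU : U ⊆ regular n)
    (hV : InClass (Prod.fst '' U) δ V) :
    IsAdmissible U δ V (stdForm θ τ X O S Z) (hat θ δ / (|θ| : ℝ))
      (stdPotential θ τ X O S Z δ V) := by
  have hρ : ((|θ| : ℝ) : ℂ) ≠ 0 := by exact_mod_cast abs_ne_zero.2 h.rate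
  have hm : Set.MapsTo (stdInv θ τ X O) (Prod.fst '' (stdForm θ τ X O S Z '' U))
      (Prod.fst '' U) := by
    rintro _ ⟨_, ⟨z, hz, rfl⟩, rfl⟩
    rw [stdInv_stdForm h.rate h.orth]
    exact ⟨z, hz, rfl⟩
  refine ⟨h.isPointTransformation hU, hV, ⟨div_ne_zero (hat_ne_zero hV.1) hρ, ?_⟩, ?_⟩
  · have h1 := h.stdInv_contDiffOn (τ := τ)
    have h2 : ContDiffOn ℝ ∞ (fun y => (stdInv θ τ X O y, (δ, V (stdInv θ τ X O y))))
        (Prod.fst '' (stdForm θ τ X O S Z '' U)) :=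
      h1.prodMk (contDiffOn_const.prodMk (hV.2.comp h1 hm))
    have h3 : Set.MapsTo (fun y => (stdInv θ τ X O y, (δ, V (stdInv θ τ X O y))))
        (Prod.fst '' (stdForm θ τ X O S Z '' U)) ((Prod.fst '' U) ×ˢ Set.univ) :=
      fun y hy => Set.mk_mem_prod (hm hy) (Set.mem_univ _)
    have h4 := h.stdV_contDiffOn.comp h2 h3
    refine h4.congr fun y _ => ?_
    rw [stdPotential, Function.comp_apply]
  · refine mapsEquation_of_determining h.isOpen h.stdForm_contDiffOn
      (fun z hz => h.reduced_stdForm hz) (fun z hz w hw => ?_) fun z hz => ?_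
    · rw [h.fderiv_fiber hz] at hw
      by_contra hne
      exact hat_ne_zero hne ((mul_eq_zero.1 hw).resolve_left (Complex.exp_ne_zero _))
    · rw [h.stdPotential_stdForm]
      exact h.determining_stdForm hz (hU hz) δ (V z.1)

/-- The equivalence transformation with given values of parameters. -/
def stdExt (θ τ : ℝ) (X : Fin n → ℝ → ℝ) (O : Matrix (Fin n) (Fin n) ℝ) (S Z : ℝ → ℝ)
    (e : Ext n) : Ext n :=
  (stdForm θ τ X O S Z e.1, (hat θ e.2.1 / (|θ| : ℝ), stdV θ X O S Z e.1.1 e.2.1 e.2.2))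

theorem stdV_eq_add (p : Base n) (δ v : ℂ) :
    stdV θ X O S Z p δ v = hat θ v / (|θ| : ℝ) + stdV θ X O S Z p δ 0 := by
  simp only [stdV, hat_zero, zero_div]; ring

/-- The map is triangular: the variables are moved by themselves, δ by a nonzero scaling and
possible conjugation, and V in the same way plus a shift independent of V. -/
theorem SmoothParam.isDiffeoOn_stdExt (h : SmoothParam U θ X O S Z) :
    IsDiffeoOn (stdExt θ τ X O S Z) (U ×ˢ ({0}ᶜ ×ˢ Set.univ)) := by
  have hρ : ((|θ| : ℝ) : ℂ) ≠ 0 := by exact_mod_cast abs_ne_zero.2 h.rate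
  have ho : IsOpen (U ×ˢ (({0}ᶜ : Set ℂ) ×ˢ (Set.univ : Set ℂ))) :=
    h.isOpen.prod (isOpen_compl_singleton.prod isOpen_univ)
  have h2 : ContDiff ℝ ∞ fun e : Ext n => hat θ e.2.1 / ((|θ| : ℝ) : ℂ) := by
    have : ContDiff ℝ ∞ fun e : Ext n => hatL θ e.2.1 / ((|θ| : ℝ) : ℂ) := by fun_prop
    simpa using this
  have h3 : ContDiffOn ℝ ∞ (fun e : Ext n => stdV θ X O S Z e.1.1 e.2.1 e.2.2)
      (U ×ˢ ({0}ᶜ ×ˢ Set.univ)) :=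
    h.stdV_contDiffOn.comp (f := fun e : Ext n => (e.1.1, e.2)) (by fun_prop)
      fun e he => ⟨⟨e.1, he.1, rfl⟩, Set.mem_univ _⟩
  refine ⟨ho, ?_, ?_, ?_⟩
  · exact (h.stdForm_contDiffOn.comp contDiff_fst.contDiffOn fun e he => he.1).prodMk
      (h2.contDiffOn.prodMk h3)
  · rintro ⟨z, d, v⟩ - ⟨z', d', v'⟩ - he
    have e1 : z = z' := stdForm_injective h.rate h.orth (congrArg Prod.fst he)
    have e2 : d = d' := by
      have := congrArg (fun e : Ext n => e.2.1) he
      exact hat_injective θ ((div_left_inj' hρ).1 this)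
    have e3 : stdV θ X O S Z z.1 d v = stdV θ X O S Z z'.1 d' v' :=
      congrArg (fun e : Ext n => e.2.2) he
    rw [← e1, ← e2, stdV_eq_add z.1 d v, stdV_eq_add z.1 d v'] at e3
    rw [e1, e2, hat_injective θ ((div_left_inj' hρ).1 (add_right_cancel e3))]
  · rintro e he
    refine isInvertible_of_injective ((injective_iff_map_eq_zero _).2 fun u hu => ?_)
    have d1 : HasFDerivAt (fun e : Ext n => stdForm θ τ X O S Z e.1) _ e :=
      (((h.stdForm_contDiffOn (τ := τ)).contDiffAt (h.isOpen.mem_nhds he.1)).differentiableAt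
        (by simp)).hasFDerivAt.comp e hasFDerivAt_fst
    have d2 : HasFDerivAt (fun e : Ext n => hat θ e.2.1 / ((|θ| : ℝ) : ℂ))
        ((((|θ| : ℝ) : ℂ)⁻¹ • hatL θ).comp ((ContinuousLinearMap.fst ℝ ℂ ℂ).comp
          (ContinuousLinearMap.snd ℝ (Vars n) (ℂ × ℂ)))) e := by
      refine (ContinuousLinearMap.hasFDerivAt _).congr_of_eventuallyEq (.of_forall fun y => ?_)
      simp [div_eq_inv_mul]
    have d3 := ((h3.contDiffAt (ho.mem_nhds he)).differentiableAt (by simp)).hasFDerivAt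
    have d4 : HasFDerivAt (stdExt θ τ X O S Z) _ e := d1.prodMk (d2.prodMk d3)
    rw [d4.fderiv] at hu
    obtain ⟨z, d, v⟩ := u
    have e1 : fderiv ℝ (stdForm θ τ X O S Z) e.1 z = 0 := congrArg Prod.fst hu
    have e2 : ((|θ| : ℝ) : ℂ)⁻¹ • hatL θ d = 0 := congrArg (fun e : Ext n => e.2.1) hu
    have e3 : fderiv ℝ (fun e : Ext n => stdV θ X O S Z e.1.1 e.2.1 e.2.2) e (z, d, v) = 0 :=
      congrArg (fun e : Ext n => e.2.2) hu
    have hz : z = 0 := h.fderiv_injective he.1 (e1.trans (map_zero _).symm)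
    have hd : d = 0 := by
      rw [smul_eq_mul, hatL_apply] at e2
      by_contra hne
      exact hat_ne_zero hne ((mul_eq_zero.1 e2).resolve_left (inv_ne_zero hρ))
    subst hz hd
    -- The derivative in the last variable is computed twice, by restriction and from the affine
    -- formula, to identify `e3` with an injective map applied to `v`.
    have d5 : HasFDerivAt (fun c : ℂ => stdV θ X O S Z e.1.1 e.2.1 c) _ e.2.2 :=
      HasFDerivAt.comp (g := fun e : Ext n => stdV θ X O S Z e.1.1 e.2.1 e.2.2)
        (f := fun c : ℂ => ((e.1, (e.2.1, c)) : Ext n)) e.2.2 d3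
        ((hasFDerivAt_const e.1 e.2.2).prodMk
          ((hasFDerivAt_const e.2.1 e.2.2).prodMk (hasFDerivAt_id e.2.2)))
    have d6 : HasFDerivAt (fun c : ℂ => stdV θ X O S Z e.1.1 e.2.1 c)
        (((|θ| : ℝ) : ℂ)⁻¹ • hatL θ) e.2.2 := by
      refine ((((|θ| : ℝ) : ℂ)⁻¹ • hatL θ).hasFDerivAt.add_const
        (stdV θ X O S Z e.1.1 e.2.1 0)).congr_of_eventuallyEq (.of_forall fun c => ?_)
      simp only [smul_apply, hatL_apply, smul_eq_mul]
      rw [stdV_eq_add, div_eq_inv_mul]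
    have e4 := DFunLike.congr_fun (d5.unique d6) v
    have e5 : ((|θ| : ℝ) : ℂ)⁻¹ • hatL θ v = 0 := e4.symm.trans e3
    have hv : v = 0 := by
      rw [smul_eq_mul, hatL_apply] at e5
      by_contra hne
      exact hat_ne_zero hne ((mul_eq_zero.1 e5).resolve_left (inv_ne_zero hρ))
    rw [hv]; rfl

theorem SmoothParam.isEquivalenceTransformation (h : SmoothParam U θ X O S Z)
    (hU : U ⊆ regular n) {Φ : Ext n → Ext n}
    (hΦ : Set.EqOn Φ (stdExt θ τ X O S Z) (U ×ˢ ({0}ᶜ ×ˢ Set.univ))) :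
    IsEquivalenceTransformation U Φ := by
  refine ⟨h.isDiffeoOn_stdExt.congr hΦ, stdForm θ τ X O S Z, h.isPointTransformation hU,
    fun e he => by rw [hΦ he]; rfl, fun δ V hV => ⟨_, _, fun z hz => ?_, h.isAdmissible hU hV⟩⟩
  have hm : ((z, (δ, V z.1)) : Ext n) ∈ U ×ˢ (({0}ᶜ : Set ℂ) ×ˢ (Set.univ : Set ℂ)) :=
    ⟨hz, hV.1, Set.mem_univ _⟩
  rw [hΦ hm, h.stdPotential_stdForm]
  rfl

theorem IsParam.smoothParam {T : ℝ → ℝ} (h : IsParam U T X O S Z) (hU : IsOpen U) (hθ : θ ≠ 0) :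
    SmoothParam U θ X O S Z :=
  ⟨hU, hθ, h.smooth_X, h.smooth_S, h.smooth_Z, h.orth⟩

/-- The class `𝒫₀` is normalized. -/
theorem isNormalized (hn : 1 ≤ n) : IsNormalized n := by
  intro U δ V φ δ' V' hA W hWU hW
  have hφ := hA.1.mono hWU hW.isOpen
  have hM : MapsEquation φ W δ V δ' V' := fun p ψ ψ' hp => hA.2.2.2 p ψ ψ' (hWU hp)
  obtain ⟨T, X, O, S, Z, hP, hf⟩ := hM.exists_param hφ hn hA.2.1.1 hA.2.2.1.1 hW
  obtain ⟨θ, τ, hθ, hT⟩ := hP.exists_affine hW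
  have h := hP.smoothParam hW.isOpen hθ
  have he : Set.EqOn φ (stdForm θ τ X O S Z) W := fun z hz => (hf _ _ _ hz).trans
    (stdForm_eq hP hT hz)
  refine ⟨stdExt θ τ X O S Z, h.isEquivalenceTransformation hW.subset_regular (Set.eqOn_refl _ _),
    fun z hz => ?_⟩
  obtain ⟨h1, h2⟩ := h.elements_eq hM hφ hn hA.2.1.1 he hz
  rw [h2, h1, he hz]
  rfl

/-- The projection to the variables is common to all equations of the class, so one equation
determines its parameters; the remaining components follow because the transformed elements are
unique. -/
theorem IsEquivalenceTransformation.exists_param (hn : 1 ≤ n) (hU : IsPatch U)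
    {Φ : Ext n → Ext n} (hΦ : IsEquivalenceTransformation U Φ) :
    ∃ T X O S Z, IsParam U T X O S Z ∧
      ∀ (t : ℝ) (x : Fin n → ℝ) (ψ δ v : ℂ), ((t, x), ψ) ∈ U → δ ≠ 0 →
        Φ (((t, x), ψ), (δ, v)) = (((T t, newX T X O t x), newPsi T X O S Z t x ψ),
          (newDelta T t δ, newV T X O S Z t x δ v)) := by
  obtain ⟨-, φ, hφ, -, hel⟩ := hΦ
  -- One member of the class, with δ = 1 and V = 0, suffices to find the projection.
  obtain ⟨d, V, -, hA⟩ := hel 1 0 ⟨one_ne_zero, contDiffOn_const⟩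
  obtain ⟨T, X, O, S, Z, hP, hf⟩ := hA.2.2.2.exists_param hφ hn one_ne_zero hA.2.2.1.1 hU
  obtain ⟨θ, τ, hθ, hT⟩ := hP.exists_affine hU
  have h := hP.smoothParam hU.isOpen hθ
  have he : Set.EqOn φ (stdForm θ τ X O S Z) U := fun z hz => (hf _ _ _ hz).trans
    (stdForm_eq hP hT hz)
  refine ⟨T, X, O, S, Z, hP, fun t x ψ δ v hz hδ => ?_⟩
  -- Constant potentials reach every point of the joint space, and Φ sees only the value of V at a
  -- point.
  obtain ⟨δ', V', hE, hA'⟩ := hel δ (fun _ => v) ⟨hδ, contDiffOn_const⟩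
  obtain ⟨h1, h2⟩ := h.elements_eq hA'.2.2.2 hφ hn hδ he hz
  have hd := (hT t (mem_times hz)).2
  rw [hE _ hz, h2, h1, hf _ _ _ hz, newV_eq_stdV hd, newDelta, hd]

theorem IsParam.isEquivalenceTransformation {T : ℝ → ℝ} (hP : IsParam U T X O S Z)
    (hU : IsPatch U) {Φ : Ext n → Ext n}
    (hΦ : ∀ (t : ℝ) (x : Fin n → ℝ) (ψ δ v : ℂ), ((t, x), ψ) ∈ U → δ ≠ 0 →
      Φ (((t, x), ψ), (δ, v)) = (((T t, newX T X O t x), newPsi T X O S Z t x ψ),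
        (newDelta T t δ, newV T X O S Z t x δ v))) : IsEquivalenceTransformation U Φ := by
  obtain ⟨θ, τ, hθ, hT⟩ := hP.exists_affine hU
  refine (hP.smoothParam hU.isOpen hθ).isEquivalenceTransformation (τ := τ) hU.subset_regular ?_
  rintro ⟨⟨⟨t, x⟩, ψ⟩, δ, v⟩ ⟨hz, hδ, -⟩
  have hd := (hT t (mem_times hz)).2
  rw [hΦ t x ψ δ v hz hδ, stdForm_eq hP hT hz, newV_eq_stdV hd, newDelta, hd]
  rfl


end


end LogNLS

end


open LogNLS in
theorem mainTheorem8 (n : ℕ) (hn : 1 ≤ n) :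
    IsNormalized n ∧
    ∀ (U : Set (Vars n)), IsPatch U → ∀ Φ : Ext n → Ext n,
      IsEquivalenceTransformation U Φ ↔
        ∃ (T : ℝ → ℝ) (X : Fin n → ℝ → ℝ) (O : Matrix (Fin n) (Fin n) ℝ) (S Z : ℝ → ℝ),
          ContDiffOn ℝ ∞ T (times U) ∧ (∀ a, ContDiffOn ℝ ∞ (X a) (times U)) ∧
          ContDiffOn ℝ ∞ S (times U) ∧ ContDiffOn ℝ ∞ Z (times U) ∧
          O ∈ Matrix.orthogonalGroup (Fin n) ℝ ∧
          (∀ t ∈ times U, deriv T t ≠ 0 ∧ deriv (deriv T) t = 0) ∧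
          ∀ (t : ℝ) (x : Fin n → ℝ) (ψ δ v : ℂ), ((t, x), ψ) ∈ U → δ ≠ 0 →
            Φ (((t, x), ψ), (δ, v)) =
              (((T t, newX T X O t x), newPsi T X O S Z t x ψ),
                (newDelta T t δ, newV T X O S Z t x δ v)) := by
  refine ⟨isNormalized hn, fun U hU Φ => ⟨fun hΦ => ?_, ?_⟩⟩
  · obtain ⟨T, X, O, S, Z, h, hf⟩ := hΦ.exists_param hn hU
    exact ⟨T, X, O, S, Z, h.smooth_T, h.smooth_X, h.smooth_S, h.smooth_Z, h.orth, h.rate, hf⟩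
  · rintro ⟨T, X, O, S, Z, h1, h2, h3, h4, h5, h6, hf⟩
    exact IsParam.isEquivalenceTransformation ⟨h1, h2, h3, h4, h5, h6⟩ hU hf
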